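/- Let $M$ be a Hausdorff smooth manifold (without boundary) of any dimension $n$, and let $F:TM\to[0,\infty)$ be a Finsler structure: $F$ is smooth off the zero section, $F(\lambda y)=\lambda F(y)$ for $\lambda>0$, and for every $y\neq 0$ the fundamental tensor $g_y(u,v)=\frac12\frac{\partial^2}{\partial t\,\partial s}F^2(y+tu+sv)\big|_{s=t=0}$ is positive definite. Let $d_F(p,q)$ be the infimum of the lengths $\int F(\gamma,\gamma')$ of the piecewise smooth curves from $p$ to $q$, and for $K\subset M$ put $d_F(K,q)=\inf_{a\in K}d_F(a,q)$. Assume that any point $p$ is joined to any point $q$ by a shortest (piecewise smooth) unit speed curve. Notions. The cut locus of $K$ is the set of points $q$ that are reached from $K$ by two different unit speed curves of length $d_F(K,q)$. For a wave which has front $W$ at time $0$ and has swept the region $B$ before time $0$, the wavefront at time $\tau$ is $\{p\notin B: d_F(W,p)=\tau\}$; the wavefront at time $\delta$ of a wave emitted at the point $q$ is $\phi_q(\delta)=\{p: d_F(q,p)=\delta\}$. A wave ray from $W$ to $p$ is a unit speed curve $\gamma:[0,\ell]\to M$ with $\gamma(0)\in W$, $\gamma(\ell)=p$ and length $d_F(W,p)$.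 Tangent vectors of a subset $S\subset M$ at $p$ are the velocities at time $0$ of curves through $p$ at time $0$ that are differentiable at time $0$ and lie in $S$ for all times near $0$. Two subsets are tangent at a common point if their tangent vectors there form one and the same hyperplane of $T_pM$. A nonzero $y\in T_pM$ with $p\in S$ is orthogonal to $S$ if $g_y(y,v)=0$ for all tangent vectors $v$ of $S$ at $p$. Theorem. Let $A\subset M$ be compact, $\rho(p)=d_F(A,p)$, let $U\subset M$ satisfy $\rho(U)=[s,r]$ with $0<s<r$, and suppose that no point of $\rho^{-1}([s,r])$ belongs to the cut locus of $A$. Consider the wave which has front $\rho^{-1}(s)$ at time $0$ and has swept $\{\rho<s\}$ before. Then: 1. For each $t\in[s,r]$, the wavefront at time $t-s$ is $\rho^{-1}(t)$. 2. (Huygens' envelope principle.) For $s\le t_0<t\le r$ and $\delta=t-t_0$, $\rho^{-1}(t)$ is the envelope, outside the region $\{\rho<t_0\}$ already swept, of the wavefronts $\phi_q(\delta)$, $q\in\rho^{-1}(t_0)$. That is, $\rho^{-1}(t)$ is the set of the points $p$ with $\rho(p)\ge t_0$ which lie on some $\phi_q(\delta)$ with $q\in\rho^{-1}(t_0)$ and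 on no $\phi_q(\tau)$ with $q\in\rho^{-1}(t_0)$ and $\tau<\delta$; and $\rho^{-1}(t)$ is tangent at each of its points to every $\phi_q(\delta)$, $q\in\rho^{-1}(t_0)$, through that point. 3. For each $t\in[s,r]$, the tangent vectors of $\rho^{-1}(t)$ at each of its points form a hyperplane of the tangent space of $M$. 4. For each $t\in(s,r]$ and $p\in\rho^{-1}(t)$ there is a wave ray from $\rho^{-1}(s)$ to $p$. Every such wave ray $\gamma$ is defined on $[0,t-s]$ and is a geodesic of $F$, that is, a smooth unit speed curve which minimizes length between any two of its points; and for every $u\in[0,t-s]$, $\gamma(u)\in\rho^{-1}(s+u)$ and $\gamma'(u)$ is orthogonal to the wavefront $\rho^{-1}(s+u)$. -/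

import Mathlib

open Set Filter Topology MeasureTheory
open scoped Manifold ContDiff

namespace Finsler

/-- The fundamental tensor `g_y(u, v) = 1/2 ∂²/∂t∂s N²(y + t u + s v)` at `t = s = 0` of a function
`N` on a real vector space. -/
noncomputable def fundamentalTensor {V : Type*} [AddCommGroup V] [Module ℝ V] (N : V → ℝ)
    (y u v : V) : ℝ :=
  (1 / 2) * deriv (fun t : ℝ => deriv (fun s : ℝ => (N (y + t • u + s • v)) ^ 2) 0) 0

section

variable {n : ℕ} {M : Type*} [TopologicalSpace M] [ChartedSpace (EuclideanSpace ℝ (Fin n)) M]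

/-- Finsler structures on a smooth `n`-manifold `M`: nonnegative functions on `TM`, smooth off the
zero section, which restrict to a Minkowski norm on each tangent space (smoothness of the
restriction to a punctured fibre is contained in smoothness on `TM` off the zero section). -/
structure IsFinslerStructure [IsManifold (𝓡 n) ∞ M] (F : TangentBundle (𝓡 n) M → ℝ) : Prop where
  nonneg : ∀ v, 0 ≤ F v
  smooth : ContMDiffOn (𝓡 n).tangent 𝓘(ℝ, ℝ) ∞ F {v | v.2 ≠ 0}
  homogeneous : ∀ (x : M) (y : TangentSpace (𝓡 n) x) (c : ℝ), 0 < c →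
    F ⟨x, c • y⟩ = c * F ⟨x, y⟩
  posDef : ∀ (x : M) (y : TangentSpace (𝓡 n) x), y ≠ 0 → ∀ u : TangentSpace (𝓡 n) x, u ≠ 0 →
    0 < fundamentalTensor (fun w : TangentSpace (𝓡 n) x => F ⟨x, w⟩) y u u

/-- The velocity of a curve, as a point of `TM`. -/
noncomputable def velocity (γ : ℝ → M) (x : ℝ) : TangentBundle (𝓡 n) M :=
  ⟨γ x, mfderiv 𝓘(ℝ, ℝ) (𝓡 n) γ x (1 : ℝ)⟩

/-- The velocity of a curve defined on a set `J` of times; it is one-sided at the endpoints of an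
interval `J`. -/
noncomputable def velocityWithin (γ : ℝ → M) (J : Set ℝ) (x : ℝ) : TangentBundle (𝓡 n) M :=
  ⟨γ x, mfderivWithin 𝓘(ℝ, ℝ) (𝓡 n) γ J x (1 : ℝ)⟩

/-- `γ` is a piecewise smooth curve on `[a, b]`: it is continuous there, and smooth on each closed
subinterval with no point of a suitable finite set `P` in its interior. -/
def IsPiecewiseSmooth (n : ℕ) {M : Type*} [TopologicalSpace M]
    [ChartedSpace (EuclideanSpace ℝ (Fin n)) M] (γ : ℝ → M) (a b : ℝ) : Prop :=
  ContinuousOn γ (Icc a b) ∧ ∃ P : Finset ℝ, ∀ c d : ℝ, a ≤ c → c < d → d ≤ b →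
    (∀ x ∈ P, x ∉ Ioo c d) → ContMDiffOn 𝓘(ℝ, ℝ) (𝓡 n) ∞ γ (Icc c d)

/-- The length `∫ F(γ, γ')` of `γ` on `[a, b]`. -/
noncomputable def length (F : TangentBundle (𝓡 n) M → ℝ) (γ : ℝ → M) (a b : ℝ) : ℝ :=
  ∫ x in a..b, F (velocity γ x)

/-- The (not necessarily symmetric) distance `d_F(p, q)`: the infimum of the lengths of the
piecewise smooth curves from `p` to `q`. -/
noncomputable def fdist (F : TangentBundle (𝓡 n) M → ℝ) (p q : M) : ℝ :=
  sInf {L : ℝ | ∃ (a b : ℝ) (γ : ℝ → M), a ≤ b ∧ IsPiecewiseSmooth n γ a b ∧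
    γ a = p ∧ γ b = q ∧ L = length F γ a b}

/-- The distance `d_F(K, q)` from a set `K` to a point `q`. -/
noncomputable def fdistFrom (F : TangentBundle (𝓡 n) M → ℝ) (K : Set M) (q : M) : ℝ :=
  sInf ((fun a => fdist F a q) '' K)

/-- `γ` has unit speed on `[a, b]`; nothing is asked at the corners of `γ`. -/
def IsUnitSpeed (F : TangentBundle (𝓡 n) M → ℝ) (γ : ℝ → M) (a b : ℝ) : Prop :=
  ∀ x ∈ Ioo a b, MDifferentiableAt 𝓘(ℝ, ℝ) (𝓡 n) γ x → F (velocity γ x) = 1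

/-- `γ : [0, ℓ] → M` is a shortest unit speed curve from the set `K` to the point `q`. -/
structure IsShortest (F : TangentBundle (𝓡 n) M → ℝ) (K : Set M) (q : M) (γ : ℝ → M)
    (ℓ : ℝ) : Prop where
  nonneg : 0 ≤ ℓ
  piecewiseSmooth : IsPiecewiseSmooth n γ 0 ℓ
  unitSpeed : IsUnitSpeed F γ 0 ℓ
  source : γ 0 ∈ K
  target : γ ℓ = q
  length_eq : length F γ 0 ℓ = fdistFrom F K q

/-- The cut locus of `K`: the points reached from `K` by two different shortest unit speed
curves. -/
def cutLocus (F : TangentBundle (𝓡 n) M → ℝ) (K : Set M) : Set M :=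
  {q | ∃ (ℓ : ℝ) (γ₁ γ₂ : ℝ → M), IsShortest F K q γ₁ ℓ ∧ IsShortest F K q γ₂ ℓ ∧
    ¬ EqOn γ₁ γ₂ (Icc 0 ℓ)}

/-- `γ : [0, ℓ] → M` is a unit speed geodesic of `F`: a smooth unit speed curve which minimizes
length between any two of its points. -/
structure IsGeodesic (F : TangentBundle (𝓡 n) M → ℝ) (γ : ℝ → M) (ℓ : ℝ) : Prop where
  smooth : ContMDiffOn 𝓘(ℝ, ℝ) (𝓡 n) ∞ γ (Icc 0 ℓ)
  unitSpeed : ∀ u ∈ Icc 0 ℓ, F (velocityWithin γ (Icc 0 ℓ) u) = 1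
  minimizing : ∀ u v : ℝ, 0 ≤ u → u ≤ v → v ≤ ℓ → length F γ u v = fdist F (γ u) (γ v)

/-- The vectors at `p` tangent to a subset `S` of `M`: the velocities at time `0` of the curves
lying in `S`. -/
def tangentVectors (S : Set M) (p : M) : Set (TangentSpace (𝓡 n) p) :=
  {v | ∃ c : ℝ → M, MDifferentiableAt 𝓘(ℝ, ℝ) (𝓡 n) c 0 ∧ (∀ᶠ u in 𝓝 (0 : ℝ), c u ∈ S) ∧
    velocity c 0 = (⟨p, v⟩ : TangentBundle (𝓡 n) M)}

/-- The vectors tangent to `S` at `p` form the hyperplane `H` of the tangent space of `M`. -/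
def HasTangentHyperplane (S : Set M) (p : M) (H : Submodule ℝ (TangentSpace (𝓡 n) p)) : Prop :=
  Module.finrank ℝ H + 1 = n ∧ tangentVectors S p = (H : Set (TangentSpace (𝓡 n) p))

/-- The hypersurfaces `S` and `S'` are tangent to each other at the common point `p`. -/
def AreTangentAt (n : ℕ) {M : Type*} [TopologicalSpace M]
    [ChartedSpace (EuclideanSpace ℝ (Fin n)) M] (S S' : Set M) (p : M) : Prop :=
  p ∈ S ∧ p ∈ S' ∧ ∃ H : Submodule ℝ (TangentSpace (𝓡 n) p),
    HasTangentHyperplane S p H ∧ HasTangentHyperplane S' p H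

/-- The nonzero tangent vector `y` is orthogonal to `S` at its base point: `g_y(y, v) = 0` for all
`v` tangent to `S`. -/
def IsOrthogonalTo (F : TangentBundle (𝓡 n) M → ℝ) (y : TangentBundle (𝓡 n) M) (S : Set M) :
    Prop :=
  y.2 ≠ 0 ∧ y.1 ∈ S ∧ ∀ v ∈ tangentVectors S y.1,
    fundamentalTensor (fun w : TangentSpace (𝓡 n) y.1 => F ⟨y.1, w⟩) y.2 y.2 v = 0

/-- A wave has front `W` at time `0` and has swept the region `B` before time `0`. Its front after
time `τ` consists of the points outside `B` at distance `τ` from `W`: the infimum of the travel times, at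
unit speed, from `W` to the point is `τ`. With `B = ∅` and `W = {q}` this is the front of a wave emitted at `q`. -/
def wavefront (F : TangentBundle (𝓡 n) M → ℝ) (B W : Set M) (τ : ℝ) : Set M :=
  {p | p ∉ B ∧ fdistFrom F W p = τ}

/-- `E` is the envelope, outside the swept region `B`, of the fronts after time `δ` of the waves
emitted at the points of `W`: it is the set of the points which lie on one of these fronts and
which none of these waves reaches before time `δ`, and it is tangent at each of its points to the
fronts through that point. -/
def IsEnvelope (F : TangentBundle (𝓡 n) M → ℝ) (B W : Set M) (δ : ℝ) (E : Set M) : Prop :=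
  E = {p | p ∉ B ∧ (∃ q ∈ W, p ∈ wavefront F ∅ {q} δ) ∧
    ∀ q ∈ W, ∀ τ < δ, p ∉ wavefront F ∅ {q} τ} ∧
  ∀ p ∈ E, ∀ q ∈ W, p ∈ wavefront F ∅ {q} δ → AreTangentAt n (wavefront F ∅ {q} δ) E p

end

end Finsler

namespace Finsler

/-! The metric half of the theorem needs only the triangle inequality and the existence of shortest
curves. A shortest curve from `A` to `p` crosses the level `t₀` of `ρ` at time `t₀`, so the distance
from that level to `p` is `ρ p - t₀` whenever `ρ p ≥ t₀` (`fdistFrom_level`). This gives the fronts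
of claim 1, the points of the envelope, the existence of wave rays, and the fact that `ρ` grows at
unit speed along each ray, which therefore minimizes between any two of its points.

The infinitesimal half rests on the differentiability of `ρ` at points `p` with `ρ p > 0` off the
cut locus (`exists_hasFDerivAt_fdistFrom`). Writing `N` for `F` on the tangent space at `p`, the
derivative is `dN_v`, with `v` the final velocity of the unique shortest curve. First variation of
that curve bounds `ρ` from above; first variation of the shortest curves to nearby points bounds it
from below, since by uniqueness and compactness these run close to the curve to `p`. As `dN_v(v) =
1`, the level of `ρ` through `p` has the tangent hyperplane `ker dN_v`. Only differentiability at
the point and continuity nearby are used, so the curves in the level set are built by the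
intermediate value theorem (`exists_curve_in_levelSet`).

Strict convexity of the unit ball gives `dN_v(w) ≤ 1` for unit `w`, with equality only for `w = v`
(`fderiv_lt_one`). Hence a unit speed curve along which `ρ` grows at unit speed has the velocity `v`
dual to `dρ`. It has no corners, and it is orthogonal to the levels because `g_v(v, ·) = N(v) dN_v`.
For `q` between `A` and `p`, the derivative of `d_F(q, ·)` at `p` is dual to the same velocity; so
the two levels share their hyperplane, which is Huygens' principle.

Smoothness of rays: comparing an arc with its translates in a chart yields the integrated
Euler-Lagrange equation (`IsUnitCurve.euler_lagrange`). The Legendre transformation, a local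
diffeomorphism by positive definiteness, turns it into a smooth first order system, and
bootstrapping applies (`contDiffOn_of_euler`). -/

theorem fundamentalTensor_comp_linear {V W : Type*} [AddCommGroup V] [Module ℝ V]
    [AddCommGroup W] [Module ℝ W] (N : W → ℝ) (T : V →ₗ[ℝ] W) (y u v : V) :
    fundamentalTensor (fun w => N (T w)) y u v = fundamentalTensor N (T y) (T u) (T v) := by
  simp [fundamentalTensor]

/-! ### Minkowski norms: homogeneity and strict convexity. -/

section Fibre

variable {V : Type*} [NormedAddCommGroup V] [NormedSpace ℝ V]

/-- Minkowski norms: the restrictions of Finsler structures to the tangent spaces. -/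
structure IsMinkowski (N : V → ℝ) : Prop where
  nonneg : ∀ y, 0 ≤ N y
  smooth : ContDiffOn ℝ ∞ N {0}ᶜ
  homogeneous : ∀ (y : V) (c : ℝ), 0 < c → N (c • y) = c * N y
  posDef : ∀ y : V, y ≠ 0 → ∀ u : V, u ≠ 0 → 0 < fundamentalTensor N y u u

/-- With `u = v` the two parameters enter only through their sum, so the mixed derivative is an
ordinary second derivative along a line. -/
theorem fundamentalTensor_self (N : V → ℝ) (y u : V) :
    fundamentalTensor N y u u = 1 / 2 * deriv (deriv fun t : ℝ => N (y + t • u) ^ 2) 0 := by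
  unfold fundamentalTensor
  congr 2
  funext t
  have h := deriv_comp_const_add (fun τ : ℝ => N (y + τ • u) ^ 2) t 0
  simp only [add_smul, ← add_assoc, add_zero] at h
  exact h

namespace IsMinkowski

variable {N : V → ℝ} (hN : IsMinkowski N)
include hN

theorem map_zero : N 0 = 0 := by
  have := hN.homogeneous 0 2 two_pos
  rw [smul_zero] at this
  linarith

theorem contDiffAt {y : V} (hy : y ≠ 0) : ContDiffAt ℝ ∞ N y :=
  hN.smooth.contDiffAt (isOpen_compl_singleton.mem_nhds hy)

theorem hasFDerivAt {y : V} (hy : y ≠ 0) : HasFDerivAt N (fderiv ℝ N y) y :=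
  ((hN.contDiffAt hy).differentiableAt (by simp)).hasFDerivAt

/-- If `N y = 0`, homogeneity makes `N` vanish on the ray through `y`, so `g_y(y, y) = 0`, against
positive definiteness. -/
theorem pos {y : V} (hy : y ≠ 0) : 0 < N y := by
  refine (hN.nonneg y).lt_of_ne' fun h0 => ?_
  have h := hN.posDef y hy y hy
  rw [fundamentalTensor_self] at h
  have h1 : (fun t : ℝ => N (y + t • y) ^ 2) =ᶠ[𝓝 0] fun _ => 0 := by
    filter_upwards [lt_mem_nhds (show (-1 : ℝ) < 0 by norm_num)] with t ht
    rw [show y + t • y = (1 + t) • y by rw [add_smul, one_smul],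
      hN.homogeneous _ _ (by linarith), h0]
    simp
  rw [h1.deriv.deriv_eq] at h
  simp at h

theorem fderiv_self {y : V} (hy : y ≠ 0) : fderiv ℝ N y y = N y := by
  have h1 : HasDerivAt (fun t : ℝ => N (t • y)) (fderiv ℝ N y y) 1 := by
    have h2 : HasDerivAt (fun t : ℝ => t • y) y 1 := by
      simpa using (hasDerivAt_id (1 : ℝ)).smul_const y
    have h3 : HasFDerivAt N (fderiv ℝ N y) ((1 : ℝ) • y) := by
      rw [one_smul]; exact hN.hasFDerivAt hy
    exact h3.comp_hasDerivAt (1 : ℝ) h2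
  have h4 : HasDerivAt (fun t : ℝ => N (t • y)) (N y) 1 := by
    have h5 : HasDerivAt (fun t : ℝ => t * N y) (N y) 1 := by
      simpa using (hasDerivAt_id (1 : ℝ)).mul_const (N y)
    refine h5.congr_of_eventuallyEq ?_
    filter_upwards [lt_mem_nhds one_pos] with t ht using hN.homogeneous y t ht
  exact h1.unique h4

theorem fderiv_smul {y : V} (hy : y ≠ 0) {c : ℝ} (hc : 0 < c) :
    fderiv ℝ N (c • y) = fderiv ℝ N y := by
  have h1 : HasFDerivAt (fun z : V => N (c • z)) (c • fderiv ℝ N (c • y)) y := by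
    have h2 : HasFDerivAt (fun z : V => c • z) (c • ContinuousLinearMap.id ℝ V) y :=
      (hasFDerivAt_id y).const_smul c
    have h3 := (hN.hasFDerivAt (smul_ne_zero hc.ne' hy)).comp y h2
    refine h3.congr_fderiv ?_
    ext v
    simp
  have h2 : HasFDerivAt (fun z : V => N (c • z)) (c • fderiv ℝ N y) y := by
    have : (fun z : V => N (c • z)) = fun z => c • N z := by
      funext z; simpa using hN.homogeneous z c hc
    rw [this]
    exact (hN.hasFDerivAt hy).const_smul c
  exact smul_right_injective _ hc.ne' (h1.unique h2)

/-- By homogeneity the inner derivative is linear in `1 + t`. The identity converts orthogonality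
with respect to `g_y` into membership in the kernel of `dN_y`. -/
theorem fundamentalTensor_left_self {y : V} (hy : y ≠ 0) (v : V) :
    fundamentalTensor N y y v = N y * fderiv ℝ N y v := by
  have h1 : (fun t : ℝ => deriv (fun s : ℝ => N (y + t • y + s • v) ^ 2) 0) =ᶠ[𝓝 0]
      fun t => (1 + t) * (2 * N y * fderiv ℝ N y v) := by
    filter_upwards [lt_mem_nhds (show (-1 : ℝ) < 0 by norm_num)] with t ht
    have ht' : 0 < 1 + t := by linarith
    have e : y + t • y = (1 + t) • y := by rw [add_smul, one_smul]
    have h2 : HasDerivAt (fun s : ℝ => y + t • y + s • v) v 0 := by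
      simpa using ((hasDerivAt_id (0 : ℝ)).smul_const v).const_add (y + t • y)
    have h3 : HasFDerivAt N (fderiv ℝ N y) (y + t • y + (0 : ℝ) • v) := by
      rw [zero_smul, add_zero, e, ← hN.fderiv_smul hy ht']
      exact hN.hasFDerivAt (smul_ne_zero ht'.ne' hy)
    have h4 := (h3.comp_hasDerivAt (0 : ℝ) h2).pow 2
    have h5 := h4.deriv
    simp only [Function.comp_def, Pi.pow_def] at h5
    rw [h5, zero_smul, add_zero, e, hN.homogeneous _ _ ht']
    push_cast
    ring
  unfold fundamentalTensor
  rw [h1.deriv_eq]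
  have h6 : HasDerivAt (fun t : ℝ => (1 + t) * (2 * N y * fderiv ℝ N y v))
      (1 * (2 * N y * fderiv ℝ N y v)) 0 := ((hasDerivAt_id (0 : ℝ)).const_add 1).mul_const _
  rw [h6.deriv]
  ring

/-- Strict convexity of the unit ball: `N²` is strictly convex on the segment from `v` to `w` and
equals `1` at both ends, so its derivative `2 (dN_v(w) - 1)` at the start is negative. -/
theorem fderiv_lt_one {v w : V} (hv : N v = 1) (hw : N w = 1) (hvw : w ≠ v) :
    fderiv ℝ N v w < 1 := by
  have hv0 : v ≠ 0 := by rintro rfl; rw [hN.map_zero] at hv; norm_num at hv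
  have hw0 : w ≠ 0 := by rintro rfl; rw [hN.map_zero] at hw; norm_num at hw
  -- `N²` need not be smooth at `0`, so a segment through the origin is treated apart; there `w` is
  -- a nonpositive multiple of `v` and `dN_v(w) ≤ 0`.
  by_cases hseg : ∃ t ∈ Icc (0 : ℝ) 1, v + t • (w - v) = 0
  · obtain ⟨t, ⟨ht0, ht1⟩, h⟩ := hseg
    have h1 : t • w = -((1 - t) • v) := by
      rw [eq_neg_iff_add_eq_zero, ← h]; module
    have ht : 0 < t := by
      rcases ht0.lt_or_eq with h' | h'
      · exact h'
      · subst h'; simp at h; exact absurd h hv0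
    have h2 : t * fderiv ℝ N v w = -(1 - t) := by
      have := congrArg (fderiv ℝ N v) h1
      simpa [hN.fderiv_self hv0, hv] using this
    nlinarith
  · push Not at hseg
    set ψ : ℝ → ℝ := fun t => N (v + t • (w - v)) ^ 2 with hψ
    have hd : ∀ t ∈ Icc (0 : ℝ) 1, ContDiffAt ℝ ∞ ψ t := by
      intro t ht
      have h1 : ContDiffAt ℝ ∞ (fun t : ℝ => v + t • (w - v)) t := by fun_prop
      exact (ContDiffAt.comp t (hN.contDiffAt (hseg t ht)) h1).pow 2
    have hpos : ∀ t ∈ Icc (0 : ℝ) 1, 0 < deriv (deriv ψ) t := by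
      intro t ht
      have h1 := hN.posDef _ (hseg t ht) (w - v) (sub_ne_zero.2 hvw)
      rw [fundamentalTensor_self] at h1
      have h2 : (fun τ : ℝ => N (v + t • (w - v) + τ • (w - v)) ^ 2) = fun τ => ψ (t + τ) := by
        funext τ; simp only [hψ, add_smul, add_assoc]
      have h3 : deriv (fun τ : ℝ => ψ (t + τ)) = fun τ => deriv ψ (t + τ) := by
        funext τ; exact deriv_comp_const_add ψ t τ
      rw [h2, h3, deriv_comp_const_add, add_zero] at h1
      linarith
    have hcont : ContinuousOn ψ (Icc 0 1) := fun t ht => (hd t ht).continuousAt.continuousWithinAt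
    have hconv : StrictConvexOn ℝ (Icc 0 1) ψ := by
      refine strictConvexOn_of_deriv2_pos (convex_Icc 0 1) hcont fun t ht => ?_
      rw [interior_Icc] at ht
      exact hpos t (Ioo_subset_Icc_self ht)
    have h0 : HasDerivAt ψ (2 * (fderiv ℝ N v w - 1)) 0 := by
      have h2 : HasDerivAt (fun s : ℝ => v + s • (w - v)) (w - v) 0 := by
        simpa using ((hasDerivAt_id (0 : ℝ)).smul_const (w - v)).const_add v
      have h3 : HasFDerivAt N (fderiv ℝ N v) (v + (0 : ℝ) • (w - v)) := by
        rw [zero_smul, add_zero]; exact hN.hasFDerivAt hv0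
      have h4 := (h3.comp_hasDerivAt (0 : ℝ) h2).pow 2
      refine (h4.congr_deriv ?_)
      simp [hv, hN.fderiv_self hv0]
    have h1 := hconv.lt_slope_of_hasDerivAt (left_mem_Icc.2 zero_le_one)
      (right_mem_Icc.2 zero_le_one) one_pos h0
    have e0 : ψ 0 = 1 := by simp [hψ, hv]
    have e1 : ψ 1 = 1 := by simp [hψ, hw]
    simp only [slope_def_field, e0, e1] at h1
    linarith

/-- The fundamental inequality of Finsler geometry, obtained by scaling `w` to unit length. Its
equality case on unit vectors, `eq_of_fderiv_eq_one`, is what later identifies velocities. -/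
theorem fderiv_le_of_unit {v : V} (hv : N v = 1) (w : V) : fderiv ℝ N v w ≤ N w := by
  by_cases hw : w = 0
  · simp [hw, hN.map_zero]
  have hp := hN.pos hw
  have hv0 : v ≠ 0 := by rintro rfl; rw [hN.map_zero] at hv; norm_num at hv
  have h1 : N ((N w)⁻¹ • w) = 1 := by
    rw [hN.homogeneous _ _ (inv_pos.2 hp), inv_mul_cancel₀ hp.ne']
  have h2 : fderiv ℝ N v ((N w)⁻¹ • w) ≤ 1 := by
    by_cases h : (N w)⁻¹ • w = v
    · rw [h, hN.fderiv_self hv0, hv]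
    · exact (hN.fderiv_lt_one hv h1 h).le
  rw [_root_.map_smul, smul_eq_mul, inv_mul_le_iff₀ hp, mul_one] at h2
  exact h2

theorem eq_of_fderiv_eq_one {v w : V} (hv : N v = 1) (hw : N w = 1) (h : fderiv ℝ N v w = 1) :
    w = v := by
  by_contra hvw
  exact (hN.fderiv_lt_one hv hw hvw).ne h

end IsMinkowski

end Fibre

end Finsler

/-! ### Piecewise differentiable curves in a vector space, and Finsler structures in a chart. -/

namespace Finsler

theorem ae_restrict_Ioc_of_forall_notMem {a b : ℝ} (P : Finset ℝ) {p : ℝ → Prop}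
    (h : ∀ x ∈ Ioo a b, x ∉ P → p x) : ∀ᵐ x ∂(volume.restrict (Ioc a b)), p x := by
  rw [ae_restrict_iff' measurableSet_Ioc]
  filter_upwards [(P.countable_toSet).ae_notMem volume,
    (countable_singleton b).ae_notMem volume] with x hx hxb hxab
  exact h x ⟨hxab.1, hxab.2.lt_of_ne hxb⟩ hx

section Curves

variable {V : Type*} [NormedAddCommGroup V] [NormedSpace ℝ V] [CompleteSpace V]

theorem intervalIntegrable_deriv {c : ℝ → V} {a b B : ℝ} (hab : a ≤ b) (P : Finset ℝ)
    (hB : ∀ x ∈ Ioo a b, x ∉ P → ‖deriv c x‖ ≤ B) :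
    IntervalIntegrable (deriv c) volume a b := by
  rw [intervalIntegrable_iff_integrableOn_Ioc_of_le hab]
  exact Integrable.of_bound (aestronglyMeasurable_deriv c _) B
    (ae_restrict_Ioc_of_forall_notMem P hB)

theorem integral_deriv_of_piecewise {c : ℝ → V} {a b B : ℝ} (hab : a ≤ b)
    (hc : ContinuousOn c (Icc a b)) (P : Finset ℝ)
    (hd : ∀ x ∈ Ioo a b, x ∉ P → DifferentiableAt ℝ c x)
    (hB : ∀ x ∈ Ioo a b, x ∉ P → ‖deriv c x‖ ≤ B) :
    ∫ x in a..b, deriv c x = c b - c a :=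
  integral_eq_of_hasDerivAt_off_countable_of_le c (deriv c) hab P.countable_toSet hc
    (fun x hx => (hd x hx.1 hx.2).hasDerivAt) (intervalIntegrable_deriv hab P hB)

theorem norm_sub_le_of_piecewise {c : ℝ → V} {a b B : ℝ} (hab : a ≤ b)
    (hc : ContinuousOn c (Icc a b)) (P : Finset ℝ)
    (hd : ∀ x ∈ Ioo a b, x ∉ P → DifferentiableAt ℝ c x)
    (hB : ∀ x ∈ Ioo a b, x ∉ P → ‖deriv c x‖ ≤ B) :
    ‖c b - c a‖ ≤ B * (b - a) := by
  rw [← integral_deriv_of_piecewise hab hc P hd hB, ← abs_of_nonneg (sub_nonneg.2 hab)]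
  refine intervalIntegral.norm_integral_le_of_norm_le_const_ae ?_
  rw [uIoc_of_le hab, ← ae_restrict_iff' measurableSet_Ioc]
  exact ae_restrict_Ioc_of_forall_notMem P hB

end Curves

section Local

variable {V : Type*} [NormedAddCommGroup V] [NormedSpace ℝ V]

/-- The expressions of Finsler structures in a chart with image `Ω`. -/
structure IsLocalFinsler (Ω : Set V) (f : V → V → ℝ) : Prop where
  isOpen : IsOpen Ω
  smooth : ContDiffOn ℝ ∞ (Function.uncurry f) (Ω ×ˢ {0}ᶜ)
  isMinkowski : ∀ x ∈ Ω, IsMinkowski (f x)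

namespace IsLocalFinsler

variable {Ω : Set V} {f : V → V → ℝ} (hf : IsLocalFinsler Ω f)
include hf

theorem ne_zero_of_unit {x w : V} (hx : x ∈ Ω) (hw : f x w = 1) : w ≠ 0 := by
  rintro rfl
  rw [(hf.isMinkowski x hx).map_zero] at hw
  norm_num at hw

theorem isOpen_slit : IsOpen (Ω ×ˢ ({0}ᶜ : Set V)) := hf.isOpen.prod isOpen_compl_singleton

theorem contDiffAt {x y : V} (hx : x ∈ Ω) (hy : y ≠ 0) :
    ContDiffAt ℝ ∞ (Function.uncurry f) (x, y) :=
  hf.smooth.contDiffAt (hf.isOpen_slit.mem_nhds ⟨hx, hy⟩)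

theorem hasFDerivAt {x y : V} (hx : x ∈ Ω) (hy : y ≠ 0) :
    HasFDerivAt (Function.uncurry f) (fderiv ℝ (Function.uncurry f) (x, y)) (x, y) :=
  ((hf.contDiffAt hx hy).differentiableAt (by simp)).hasFDerivAt

theorem fderiv_fibre {x y : V} (hx : x ∈ Ω) (hy : y ≠ 0) :
    fderiv ℝ (f x) y =
      (fderiv ℝ (Function.uncurry f) (x, y)).comp (ContinuousLinearMap.inr ℝ V V) :=
  ((hf.hasFDerivAt hx hy).comp y (hasFDerivAt_prodMk_right x y)).fderiv

theorem fderiv_apply {x y : V} (hx : x ∈ Ω) (hy : y ≠ 0) (k₁ k₂ : V) :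
    fderiv ℝ (Function.uncurry f) (x, y) (k₁, k₂) =
      fderiv ℝ (Function.uncurry f) (x, y) (k₁, 0) + fderiv ℝ (f x) y k₂ := by
  rw [hf.fderiv_fibre hx hy, ContinuousLinearMap.comp_apply, ContinuousLinearMap.inr_apply,
    ← map_add]
  simp

theorem continuousOn_fderiv :
    ContinuousOn (fderiv ℝ (Function.uncurry f)) (Ω ×ˢ {0}ᶜ) :=
  hf.smooth.continuousOn_fderiv_of_isOpen hf.isOpen_slit (by simp)

theorem continuousOn_fderiv_fibre :
    ContinuousOn (fun z : V × V => fderiv ℝ (f z.1) z.2) (Ω ×ˢ {0}ᶜ) := by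
  have h : ContinuousOn (fun z : V × V => (fderiv ℝ (Function.uncurry f) z).comp
      (ContinuousLinearMap.inr ℝ V V)) (Ω ×ˢ {0}ᶜ) :=
    hf.continuousOn_fderiv.clm_comp continuousOn_const
  exact h.congr fun z hz => hf.fderiv_fibre hz.1 hz.2

variable [FiniteDimensional ℝ V]

/-- The structure is positive and continuous on the compact set of unit vectors over a small ball;
homogeneity extends the bounds to all vectors. -/
theorem exists_bounds {x₀ : V} (hx₀ : x₀ ∈ Ω) : ∃ R > 0, ∃ m > 0, ∃ M > 0,
    Metric.closedBall x₀ R ⊆ Ω ∧ ∀ x ∈ Metric.closedBall x₀ R, ∀ y,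
      m * ‖y‖ ≤ f x y ∧ f x y ≤ M * ‖y‖ := by
  have := FiniteDimensional.proper_real V
  obtain ⟨R, hR, hRΩ⟩ := Metric.nhds_basis_closedBall.mem_iff.1 (hf.isOpen.mem_nhds hx₀)
  have hK : IsCompact (Metric.closedBall x₀ R ×ˢ Metric.sphere (0 : V) 1) :=
    (isCompact_closedBall _ _).prod (isCompact_sphere _ _)
  have hs : ∀ y ∈ Metric.sphere (0 : V) 1, y ≠ 0 := by
    rintro y hy rfl
    simp at hy
  have hc : ContinuousOn (Function.uncurry f)
      (Metric.closedBall x₀ R ×ˢ Metric.sphere (0 : V) 1) :=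
    hf.smooth.continuousOn.mono (prod_mono hRΩ hs)
  have hpos : ∀ z ∈ Metric.closedBall x₀ R ×ˢ Metric.sphere (0 : V) 1,
      0 < Function.uncurry f z := fun z hz =>
    (hf.isMinkowski _ (hRΩ hz.1)).pos (hs _ hz.2)
  obtain ⟨C₁, h₁⟩ := hK.exists_bound_of_continuousOn hc
  obtain ⟨C₂, h₂⟩ := hK.exists_bound_of_continuousOn (hc.inv₀ fun z hz => (hpos z hz).ne')
  -- The maxima with `1` keep both constants positive even when the unit sphere is empty, that is in
  -- dimension zero.
  refine ⟨R, hR, (max C₂ 1)⁻¹, by positivity, max C₁ 1, by positivity, hRΩ, fun x hx y => ?_⟩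
  have hN := hf.isMinkowski x (hRΩ hx)
  by_cases hy : y = 0
  · simp [hy, hN.map_zero]
  have hy' : 0 < ‖y‖ := norm_pos_iff.2 hy
  have hu : ‖y‖⁻¹ • y ∈ Metric.sphere (0 : V) 1 := by
    simp [norm_smul, inv_mul_cancel₀ hy'.ne']
  have hfu : f x y = ‖y‖ * f x (‖y‖⁻¹ • y) := by
    rw [hN.homogeneous _ _ (inv_pos.2 hy'), mul_inv_cancel_left₀ hy'.ne']
  have hp := hpos (x, ‖y‖⁻¹ • y) ⟨hx, hu⟩
  have a₁ := h₁ (x, ‖y‖⁻¹ • y) ⟨hx, hu⟩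
  have a₂ := h₂ (x, ‖y‖⁻¹ • y) ⟨hx, hu⟩
  simp only [Function.uncurry, Pi.inv_apply] at hp a₁ a₂
  rw [Real.norm_of_nonneg hp.le] at a₁
  rw [Real.norm_of_nonneg (inv_pos.2 hp).le] at a₂
  rw [hfu]
  constructor
  · rw [mul_comm]
    gcongr
    rw [inv_le_comm₀ (by positivity) hp]
    exact a₂.trans (le_max_left _ _)
  · rw [mul_comm]
    gcongr
    exact a₁.trans (le_max_left _ _)

/-- Smoothness stops at the zero section; there the bound `f x y ≤ M ‖y‖` squeezes the values to
`0`. -/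
theorem continuousOn_uncurry : ContinuousOn (Function.uncurry f) (Ω ×ˢ univ) := by
  rintro ⟨x, y⟩ ⟨hx, -⟩
  apply ContinuousAt.continuousWithinAt
  by_cases hy : y = 0
  · subst hy
    obtain ⟨R, hR, m, hm, M, hM, hRΩ, hb⟩ := hf.exists_bounds hx
    have h0 : Function.uncurry f (x, 0) = 0 := (hf.isMinkowski x hx).map_zero
    rw [ContinuousAt, h0]
    have h1 : Tendsto (fun z : V × V => M * ‖z.2‖) (𝓝 (x, 0)) (𝓝 0) := by
      have : Continuous fun z : V × V => M * ‖z.2‖ := by fun_prop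
      simpa using this.tendsto (x, 0)
    have h2 : ∀ᶠ z : V × V in 𝓝 (x, 0), z.1 ∈ Metric.closedBall x R :=
      continuous_fst.continuousAt.eventually_mem (Metric.closedBall_mem_nhds x hR)
    refine tendsto_of_tendsto_of_tendsto_of_le_of_le' tendsto_const_nhds h1 ?_ ?_
    · filter_upwards [h2] with z hz using (hf.isMinkowski _ (hRΩ hz)).nonneg _
    · filter_upwards [h2] with z hz using (hb _ hz _).2
  · exact (hf.contDiffAt hx hy).continuousAt

/-- Unit vectors over a small ball form a compact set. -/
theorem exists_isCompact_unit {x₀ : V} (hx₀ : x₀ ∈ Ω) : ∃ R > 0, Metric.closedBall x₀ R ⊆ Ω ∧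
    IsCompact {z : V × V | z.1 ∈ Metric.closedBall x₀ R ∧ f z.1 z.2 = 1} := by
  have := FiniteDimensional.proper_real V
  obtain ⟨R, hR, m, hm, M, hM, hRΩ, hb⟩ := hf.exists_bounds hx₀
  refine ⟨R, hR, hRΩ, ?_⟩
  have hcl : IsClosed (Metric.closedBall x₀ R ×ˢ (univ : Set V) ∩
      Function.uncurry f ⁻¹' {1}) :=
    (hf.continuousOn_uncurry.mono (prod_mono hRΩ subset_rfl)).preimage_isClosed_of_isClosed
      (Metric.isClosed_closedBall.prod isClosed_univ) isClosed_singleton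
  have hK : IsCompact (Metric.closedBall x₀ R ×ˢ Metric.closedBall (0 : V) m⁻¹) :=
    (isCompact_closedBall _ _).prod (isCompact_closedBall _ _)
  have he : {z : V × V | z.1 ∈ Metric.closedBall x₀ R ∧ f z.1 z.2 = 1} =
      Metric.closedBall x₀ R ×ˢ (univ : Set V) ∩ Function.uncurry f ⁻¹' {1} := by
    ext z
    simp [Function.uncurry]
  rw [he]
  refine hK.of_isClosed_subset hcl ?_
  rintro ⟨x, w⟩ ⟨⟨hx, -⟩, hw⟩
  refine ⟨hx, ?_⟩
  have h1 : f x w = 1 := hw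
  have h2 := (hb x hx w).1
  rw [mem_closedBall_zero_iff, ← one_div, le_div_iff₀ hm]
  linarith

end IsLocalFinsler

end Local

end Finsler

/-! ### First variation of length in a chart. -/

namespace Finsler

section Variation

variable {V : Type*} [NormedAddCommGroup V] [NormedSpace ℝ V] [FiniteDimensional ℝ V]

namespace IsLocalFinsler

variable {Ω : Set V} {f : V → V → ℝ} (hf : IsLocalFinsler Ω f)
include hf

/-- First order expansion of a Finsler structure, uniform over the unit vectors. -/
theorem exists_uniform_expansion {x₀ : V} (hx₀ : x₀ ∈ Ω) : ∃ R > 0, ∃ C ≥ 0,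
    Metric.closedBall x₀ R ⊆ Ω ∧
    (∀ x ∈ Metric.closedBall x₀ R, ∀ w, f x w = 1 →
      ‖fderiv ℝ (Function.uncurry f) (x, w)‖ ≤ C) ∧
    ∀ η > 0, ∃ r > 0, ∀ x ∈ Metric.closedBall x₀ R, ∀ w, f x w = 1 → ∀ k : V × V, ‖k‖ < r →
      x + k.1 ∈ Ω ∧
      f (x + k.1) (w + k.2) ≤ 1 + fderiv ℝ (Function.uncurry f) (x, w) k + η * ‖k‖ := by
  obtain ⟨R, hR, hRΩ, hK⟩ := hf.exists_isCompact_unit hx₀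
  have hsub : {z : V × V | z.1 ∈ Metric.closedBall x₀ R ∧ f z.1 z.2 = 1} ⊆ Ω ×ˢ {0}ᶜ :=
    fun z hz => ⟨hRΩ hz.1, hf.ne_zero_of_unit (hRΩ hz.1) hz.2⟩
  obtain ⟨C, hC⟩ := hK.exists_bound_of_continuousOn (hf.continuousOn_fderiv.mono hsub)
  refine ⟨R, hR, max C 0, le_max_right _ _, hRΩ,
    fun x hx w hw => (hC (x, w) ⟨hx, hw⟩).trans (le_max_left _ _), fun η hη => ?_⟩
  have key : ∀ᶠ k : V × V in 𝓝 0,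
      ∀ z ∈ {z : V × V | z.1 ∈ Metric.closedBall x₀ R ∧ f z.1 z.2 = 1},
        z + k ∈ Ω ×ˢ ({0}ᶜ : Set V) ∧ (f z.1 z.2 = 1 → Function.uncurry f (z + k) ≤
          1 + fderiv ℝ (Function.uncurry f) z k + η * ‖k‖) := by
    refine hK.eventually_forall_of_forall_eventually fun z hz => ?_
    have hz' := hsub hz
    have ht : Tendsto (fun q : (V × V) × V × V => (q.2 + q.1, q.2)) (𝓝 (0, z)) (𝓝 (z, z)) := by
      have : Continuous fun q : (V × V) × V × V => (q.2 + q.1, q.2) := by fun_prop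
      simpa using this.tendsto (0, z)
    have ht1 : Tendsto (fun q : (V × V) × V × V => q.2 + q.1) (𝓝 (0, z)) (𝓝 z) :=
      (continuous_fst.tendsto _).comp ht
    have ht2 : Tendsto (fun q : (V × V) × V × V => q.2) (𝓝 (0, z)) (𝓝 z) :=
      continuous_snd.tendsto _
    -- Strict differentiability at `z` controls the increments from every base point near `z`;
    -- replacing the derivative at `z` by that at the base point costs another `η / 2`. Compactness
    -- then makes the estimate uniform.
    have hstrict := ((hf.contDiffAt hz'.1 hz'.2).hasStrictFDerivAt (by simp)).isLittleO
    have h1 := ht.eventually (hstrict.bound (half_pos hη))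
    have h2 : ∀ᶠ z' in 𝓝 z, ‖fderiv ℝ (Function.uncurry f) z' -
        fderiv ℝ (Function.uncurry f) z‖ < η / 2 := by
      have := (hf.continuousOn_fderiv.continuousAt (hf.isOpen_slit.mem_nhds hz'))
      simpa [dist_eq_norm] using Metric.continuousAt_iff'.1 this (η / 2) (half_pos hη)
    filter_upwards [h1, ht2.eventually h2, ht1.eventually (hf.isOpen_slit.mem_nhds hz')]
      with q hq1 hq2 hq3
    refine ⟨hq3, fun hq4 => ?_⟩
    have e4 : Function.uncurry f q.2 = 1 := hq4
    simp only [add_sub_cancel_left, e4] at hq1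
    have h5 := (le_abs_self _).trans hq1
    have h6 : (fderiv ℝ (Function.uncurry f) z - fderiv ℝ (Function.uncurry f) q.2) q.1 ≤
        η / 2 * ‖q.1‖ := by
      refine (Real.le_norm_self _).trans ((ContinuousLinearMap.le_opNorm _ _).trans ?_)
      rw [norm_sub_rev]
      gcongr
    rw [_root_.sub_apply] at h6
    linarith
  obtain ⟨r, hr, hball⟩ := Metric.eventually_nhds_iff.1 key
  refine ⟨r, hr, fun x hx w hw k hk => ?_⟩
  have h := hball (by simpa using hk) (x, w) ⟨hx, hw⟩
  exact ⟨h.1.1, h.2 hw⟩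

/-- The derivative of the norm at a unit vector `w` is close to the one at `v`, up to a multiple of
the defect `1 - ξ w`. -/
theorem exists_fderiv_close {x₀ v : V} (hx₀ : x₀ ∈ Ω) (hv : f x₀ v = 1) {η : ℝ} (hη : 0 < η) :
    ∃ C ≥ 0, ∀ᶠ x in 𝓝 x₀, ∀ w, f x w = 1 →
      ‖fderiv ℝ (f x) w - fderiv ℝ (f x₀) v‖ ≤ η + C * (1 - fderiv ℝ (f x₀) v w) := by
  have := FiniteDimensional.proper_real V
  set ξ := fderiv ℝ (f x₀) v with hξ
  have hN := hf.isMinkowski x₀ hx₀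
  have hv0 : v ≠ 0 := hf.ne_zero_of_unit hx₀ hv
  obtain ⟨R, hR, m, hm, M, hM, hRΩ, hb⟩ := hf.exists_bounds hx₀
  have hx₀R : x₀ ∈ Metric.closedBall x₀ R := Metric.mem_closedBall_self hR.le
  have hunit : ∀ x ∈ Metric.closedBall x₀ R, ∀ w, f x w = 1 →
      w ∈ Metric.closedBall (0 : V) m⁻¹ := by
    intro x hx w hw
    have := (hb x hx w).1
    rw [mem_closedBall_zero_iff, ← one_div, le_div_iff₀ hm]
    linarith
  have hcfib : ∀ {x w}, x ∈ Ω → w ≠ 0 →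
      ContinuousAt (fun z : V × V => fderiv ℝ (f z.1) z.2) (x, w) := fun hx hw =>
    hf.continuousOn_fderiv_fibre.continuousAt (hf.isOpen_slit.mem_nhds ⟨hx, hw⟩)
  have hcw : ContinuousOn (fun w => fderiv ℝ (f x₀) w - ξ) {0}ᶜ := fun w hw =>
    (ContinuousAt.sub (ContinuousAt.comp (f := fun w : V => (x₀, w)) (hcfib hx₀ hw)
      (by fun_prop)) continuousAt_const).continuousWithinAt
  -- near `v` the left side is small, away from `v` the defect is bounded below
  obtain ⟨C, hC0, hC⟩ : ∃ C ≥ 0, ∀ w, f x₀ w = 1 →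
      ‖fderiv ℝ (f x₀) w - ξ‖ < η + C * (1 - ξ w) := by
    have hnear : ∀ᶠ w in 𝓝 v, ‖fderiv ℝ (f x₀) w - ξ‖ < η := by
      have h1 : Tendsto (fun w => ‖fderiv ℝ (f x₀) w - ξ‖) (𝓝 v) (𝓝 ‖fderiv ℝ (f x₀) v - ξ‖) :=
        ((hcw.continuousAt (isOpen_compl_singleton.mem_nhds hv0)).norm)
      rw [hξ, sub_self, norm_zero] at h1
      exact h1.eventually_lt_const hη
    obtain ⟨U, hU, hUo, hvU⟩ := eventually_nhds_iff.1 hnear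
    have hcl : IsClosed {w | f x₀ w = 1} := by
      have : Continuous (f x₀) := continuousOn_univ.1
        (hf.continuousOn_uncurry.comp (f := fun w : V => (x₀, w)) (by fun_prop)
          fun w _ => ⟨hx₀, mem_univ _⟩)
      exact isClosed_eq this continuous_const
    have hS : IsCompact ({w | f x₀ w = 1} \ U) :=
      ((isCompact_closedBall (0 : V) m⁻¹).of_isClosed_subset hcl
        fun w hw => hunit x₀ hx₀R w hw).diff hUo
    have hS0 : {w | f x₀ w = 1} \ U ⊆ {0}ᶜ := fun w hw => hf.ne_zero_of_unit hx₀ hw.1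
    have hpos : ∀ w ∈ {w | f x₀ w = 1} \ U, 0 < 1 - ξ w := fun w hw =>
      sub_pos.2 (hN.fderiv_lt_one hv hw.1 fun h => hw.2 (h ▸ hvU))
    have hcq : ContinuousOn (fun w => (fderiv ℝ (f x₀) w - ξ)) ({w | f x₀ w = 1} \ U) :=
      hcw.mono hS0
    obtain ⟨C, hC⟩ := hS.exists_bound_of_continuousOn (f := fun w =>
      (1 - ξ w)⁻¹ • (fderiv ℝ (f x₀) w - ξ))
      (((continuousOn_const.sub ξ.continuous.continuousOn).inv₀ fun w hw => (hpos w hw).ne').smul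
        hcq)
    refine ⟨max C 0, le_max_right _ _, fun w hw => ?_⟩
    have hle : ξ w ≤ 1 := hw ▸ hN.fderiv_le_of_unit hv w
    by_cases hwU : w ∈ U
    · have := hU w hwU
      have h2 : 0 ≤ max C 0 * (1 - ξ w) := mul_nonneg (le_max_right _ _) (sub_nonneg.2 hle)
      linarith
    · have hp := hpos w ⟨hw, hwU⟩
      have h1 := hC w ⟨hw, hwU⟩
      rw [norm_smul, Real.norm_of_nonneg (inv_pos.2 hp).le, inv_mul_le_iff₀ hp] at h1
      have h2 : (1 - ξ w) * C ≤ max C 0 * (1 - ξ w) := by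
        rw [mul_comm]; gcongr; exact le_max_left _ _
      linarith
  refine ⟨C, hC0, ?_⟩
  -- The estimate passes from `x₀` to nearby points by compactness of a ball containing all unit
  -- vectors: near a pair `(x₀, w)` with `w` not a unit vector the condition is void, elsewhere the
  -- strict inequality persists.
  have key : ∀ᶠ x in 𝓝 x₀, ∀ w ∈ Metric.closedBall (0 : V) m⁻¹, f x w = 1 →
      ‖fderiv ℝ (f x) w - ξ‖ < η + C * (1 - ξ w) := by
    refine (isCompact_closedBall (0 : V) m⁻¹).eventually_forall_of_forall_eventually
      (P := fun x w => f x w = 1 → ‖fderiv ℝ (f x) w - ξ‖ < η + C * (1 - ξ w)) fun w _ => ?_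
    by_cases hw : f x₀ w = 1
    · have hw0 : w ≠ 0 := hf.ne_zero_of_unit hx₀ hw
      have h1 : ContinuousAt (fun z : V × V => ‖fderiv ℝ (f z.1) z.2 - ξ‖) (x₀, w) :=
        ((hcfib hx₀ hw0).sub continuousAt_const).norm
      have h2 : ContinuousAt (fun z : V × V => η + C * (1 - ξ z.2)) (x₀, w) := by fun_prop
      filter_upwards [h1.eventually_lt h2 (hC w hw)] with z hz _ using hz
    · have h1 : ContinuousAt (Function.uncurry f) (x₀, w) :=
        hf.continuousOn_uncurry.continuousAt ((hf.isOpen.prod isOpen_univ).mem_nhds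
          ⟨hx₀, mem_univ _⟩)
      filter_upwards [h1.eventually_ne hw] with z hz h using absurd h hz
  filter_upwards [key, Metric.closedBall_mem_nhds x₀ hR] with x hx hxR w hw
  exact (hx w (hunit x hxR w hw) hw).le

/-- First variation: moving the end of a short unit speed curve, whose average velocity is
near `v`, by a small vector `h` makes it longer by about `ξ h` at most. -/
theorem exists_variation {x₀ v : V} (hx₀ : x₀ ∈ Ω) (hv : f x₀ v = 1) {η : ℝ} (hη : 0 < η) :
    ∃ δ > 0, ∀ ε, 0 < ε → ε < δ → ∃ δ' > 0, ∀ (c : ℝ → V) (a b : ℝ) (P : Finset ℝ), b = a + ε →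
      ContinuousOn c (Icc a b) → (∀ x ∈ Icc a b, c x ∈ Metric.ball x₀ δ) →
      (∀ x ∈ Ioo a b, x ∉ P → DifferentiableAt ℝ c x ∧ f (c x) (deriv c x) = 1) →
      ‖c b - c a - ε • v‖ ≤ δ * ε → ∀ h : V, ‖h‖ < δ' →
      (∀ x ∈ Icc a b, c x + ((x - a) / ε) • h ∈ Ω) ∧
      ∫ x in a..b, f (c x + ((x - a) / ε) • h) (deriv c x + (1 / ε) • h) ≤
        ε + fderiv ℝ (f x₀) v h + η * ‖h‖ := by
  set ξ := fderiv ℝ (f x₀) v with hξ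
  obtain ⟨R₁, hR₁, m, hm, M, hM, hRΩ₁, hb⟩ := hf.exists_bounds hx₀
  obtain ⟨R₂, hR₂, C₁, hC₁, hRΩ₂, hbd, hexp⟩ := hf.exists_uniform_expansion hx₀
  obtain ⟨C₂, hC₂, hclose⟩ := hf.exists_fderiv_close hx₀ hv (show 0 < η / 4 by linarith)
  obtain ⟨R₃, hR₃, hball⟩ := Metric.eventually_nhds_iff.1 hclose
  obtain ⟨r, hr, hexp⟩ := hexp (η / 4) (by linarith)
  have hξv : ξ v = 1 := by
    rw [hξ, (hf.isMinkowski x₀ hx₀).fderiv_self (hf.ne_zero_of_unit hx₀ hv), hv]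
  set δ := min (min (min R₁ R₂) (min R₃ 1)) (min (η / (4 * (C₁ + 1)))
    (η / (4 * (C₂ * ‖ξ‖ + 1)))) with hδ
  have hδpos : 0 < δ := by
    have : 0 ≤ C₂ * ‖ξ‖ := by positivity
    refine lt_min (lt_min (lt_min hR₁ hR₂) (lt_min hR₃ one_pos)) (lt_min ?_ ?_) <;> positivity
  have hδ1 : δ ≤ R₁ := (min_le_left _ _).trans ((min_le_left _ _).trans (min_le_left _ _))
  have hδ2 : δ ≤ R₂ := (min_le_left _ _).trans ((min_le_left _ _).trans (min_le_right _ _))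
  have hδ3 : δ ≤ R₃ := (min_le_left _ _).trans ((min_le_right _ _).trans (min_le_left _ _))
  have hδ4 : δ ≤ 1 := (min_le_left _ _).trans ((min_le_right _ _).trans (min_le_right _ _))
  have hδ5 : C₁ * δ ≤ η / 4 := by
    have h1 : δ ≤ η / (4 * (C₁ + 1)) := (min_le_right _ _).trans (min_le_left _ _)
    rw [le_div_iff₀ (by positivity)] at h1
    nlinarith
  have hδ6 : C₂ * ‖ξ‖ * δ ≤ η / 4 := by
    have h0 : 0 ≤ C₂ * ‖ξ‖ := by positivity
    have h1 : δ ≤ η / (4 * (C₂ * ‖ξ‖ + 1)) := (min_le_right _ _).trans (min_le_right _ _)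
    rw [le_div_iff₀ (by positivity)] at h1
    nlinarith
  -- The variation field has derivative `h / ε`, so `‖h‖ < ε r` brings it within reach of the
  -- uniform expansion.
  refine ⟨δ, hδpos, fun ε hε hεδ => ⟨ε * r, by positivity, ?_⟩⟩
  rintro c a b P rfl hc hcδ hd havg h hh
  have hab : a ≤ a + ε := by linarith
  have hhr : ‖h‖ / ε < r := by rwa [div_lt_iff₀ hε, mul_comm]
  have hε1 : ε ≤ 1 := by linarith
  have hk : ∀ x ∈ Icc a (a + ε), ‖(((x - a) / ε) • h, (1 / ε) • h)‖ ≤ ‖h‖ / ε := by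
    intro x hx
    have h0 : 0 ≤ (x - a) / ε := div_nonneg (by linarith [hx.1]) hε.le
    have h1 : (x - a) / ε ≤ 1 := by rw [div_le_one hε]; linarith [hx.2]
    rw [Prod.norm_def]
    refine max_le ?_ ?_
    · simp only [norm_smul, Real.norm_of_nonneg h0]
      calc (x - a) / ε * ‖h‖ ≤ 1 * ‖h‖ := by gcongr
        _ ≤ ‖h‖ / ε := by rw [one_mul, le_div_iff₀ hε]; nlinarith [norm_nonneg h]
    · simp only [norm_smul, Real.norm_of_nonneg (one_div_pos.2 hε).le]
      apply le_of_eq; ring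
  have hx1 : ∀ x ∈ Icc a (a + ε), ‖((x - a) / ε) • h‖ ≤ ‖h‖ := by
    intro x hx
    have h0 : 0 ≤ (x - a) / ε := div_nonneg (by linarith [hx.1]) hε.le
    have h1 : (x - a) / ε ≤ 1 := by rw [div_le_one hε]; linarith [hx.2]
    rw [norm_smul, Real.norm_of_nonneg h0]
    exact mul_le_of_le_one_left (norm_nonneg _) h1
  have hcR₁ : ∀ x ∈ Icc a (a + ε), c x ∈ Metric.closedBall x₀ R₁ := fun x hx =>
    Metric.ball_subset_closedBall (Metric.ball_subset_ball hδ1 (hcδ x hx))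
  have hcR₂ : ∀ x ∈ Icc a (a + ε), c x ∈ Metric.closedBall x₀ R₂ := fun x hx =>
    Metric.ball_subset_closedBall (Metric.ball_subset_ball hδ2 (hcδ x hx))
  have hΩ : ∀ x ∈ Icc a (a + ε), c x + ((x - a) / ε) • h ∈ Ω := by
    intro x hx
    -- `v` scaled to unit length over `c x`
    have hpos := (hf.isMinkowski _ (hRΩ₁ (hcR₁ x hx))).pos (hf.ne_zero_of_unit hx₀ hv)
    have hu : f (c x) ((f (c x) v)⁻¹ • v) = 1 := by
      rw [(hf.isMinkowski _ (hRΩ₁ (hcR₁ x hx))).homogeneous _ _ (inv_pos.2 hpos),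
        inv_mul_cancel₀ hpos.ne']
    exact (hexp (c x) (hcR₂ x hx) _ hu (((x - a) / ε) • h, (1 / ε) • h)
      ((hk x hx).trans_lt hhr)).1
  refine ⟨hΩ, ?_⟩
  have hB : ∀ x ∈ Ioo a (a + ε), x ∉ P → ‖deriv c x‖ ≤ m⁻¹ := by
    intro x hx hxP
    have := (hb _ (hcR₁ x (Ioo_subset_Icc_self hx)) (deriv c x)).1
    rw [(hd x hx hxP).2] at this
    rw [← one_div, le_div_iff₀ hm]
    linarith
  have hint := intervalIntegrable_deriv hab P hB
  have hftc := integral_deriv_of_piecewise hab hc P (fun x hx hxP => (hd x hx hxP).1) hB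
  -- The bound for the integrand is affine in `ξ (deriv c x)`, so its integral sees the velocity
  -- only through `c b - c a`. Hence closeness of the average velocity to `v` suffices, and no
  -- pointwise closeness is needed.
  set A : ℝ := 1 + (1 / ε) * ξ h + (1 / ε) * ((η / 4 + C₂) * ‖h‖) + C₁ * ‖h‖ +
    η / 4 * (‖h‖ / ε) with hA
  set κ : ℝ := (1 / ε) * C₂ * ‖h‖ with hκ
  have hpt : ∀ x ∈ Ioo a (a + ε), x ∉ P →
      f (c x + ((x - a) / ε) • h) (deriv c x + (1 / ε) • h) ≤ A - κ * ξ (deriv c x) := by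
    intro x hx hxP
    have hxI := Ioo_subset_Icc_self hx
    obtain ⟨-, hu⟩ := hd x hx hxP
    have hcΩ := hRΩ₁ (hcR₁ x hxI)
    have h1 := (hexp (c x) (hcR₂ x hxI) _ hu (((x - a) / ε) • h, (1 / ε) • h)
      ((hk x hxI).trans_lt hhr)).2
    rw [hf.fderiv_apply hcΩ (hf.ne_zero_of_unit hcΩ hu)] at h1
    have h2 : fderiv ℝ (Function.uncurry f) (c x, deriv c x) (((x - a) / ε) • h, 0) ≤
        C₁ * ‖h‖ := by
      refine (Real.le_norm_self _).trans ((ContinuousLinearMap.le_opNorm _ _).trans ?_)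
      gcongr
      · exact hbd _ (hcR₂ x hxI) _ hu
      · rw [Prod.norm_def]
        simpa using hx1 x hxI
    have h3 : (fderiv ℝ (f (c x)) (deriv c x) - ξ) h ≤
        (η / 4 + C₂ * (1 - ξ (deriv c x))) * ‖h‖ := by
      refine (Real.le_norm_self _).trans ((ContinuousLinearMap.le_opNorm _ _).trans ?_)
      gcongr
      exact hball (Metric.ball_subset_ball hδ3 (hcδ x hxI)) _ hu
    rw [_root_.sub_apply] at h3
    have h4 : (1 / ε) * fderiv ℝ (f (c x)) (deriv c x) h ≤
        (1 / ε) * (ξ h + (η / 4 + C₂ * (1 - ξ (deriv c x))) * ‖h‖) := by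
      gcongr; linarith
    have h5 : η / 4 * ‖(((x - a) / ε) • h, (1 / ε) • h)‖ ≤ η / 4 * (‖h‖ / ε) := by
      have := hk x hxI
      gcongr
    rw [_root_.map_smul, smul_eq_mul] at h1
    have h6 : A - κ * ξ (deriv c x) = 1 + C₁ * ‖h‖ +
        (1 / ε) * (ξ h + (η / 4 + C₂ * (1 - ξ (deriv c x))) * ‖h‖) + η / 4 * (‖h‖ / ε) := by
      rw [hA, hκ]; ring
    rw [h6]
    linarith
  have hξint : IntervalIntegrable (fun x => ξ (deriv c x)) volume a (a + ε) :=
    ⟨ξ.integrable_comp hint.1, ξ.integrable_comp hint.2⟩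
  have hle : ∫ x in a..(a + ε), f (c x + ((x - a) / ε) • h) (deriv c x + (1 / ε) • h) ≤
      ∫ x in a..(a + ε), (A - κ * ξ (deriv c x)) := by
    have hg : IntervalIntegrable (fun x => A - κ * ξ (deriv c x)) volume a (a + ε) :=
      intervalIntegrable_const.sub (hξint.const_mul κ)
    rw [intervalIntegral.integral_of_le hab, intervalIntegral.integral_of_le hab]
    refine integral_mono_of_nonneg ?_ hg.1
      (ae_restrict_Ioc_of_forall_notMem P hpt)
    exact ae_restrict_Ioc_of_forall_notMem P fun x hx _ =>
      (hf.isMinkowski _ (hΩ x (Ioo_subset_Icc_self hx))).nonneg _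
  refine hle.trans ?_
  rw [intervalIntegral.integral_sub intervalIntegrable_const (hξint.const_mul κ),
    intervalIntegral.integral_const, intervalIntegral.integral_const_mul,
    ξ.intervalIntegral_comp_comm hint, hftc, smul_eq_mul, add_sub_cancel_left]
  have h7 : ε - ‖ξ‖ * (δ * ε) ≤ ξ (c (a + ε) - c a) := by
    have h8 : c (a + ε) - c a = (c (a + ε) - c a - ε • v) + ε • v := by abel
    rw [h8, map_add, _root_.map_smul, hξv, smul_eq_mul, mul_one]
    have h9 : |ξ (c (a + ε) - c a - ε • v)| ≤ ‖ξ‖ * (δ * ε) :=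
      (ξ.le_opNorm _).trans (by gcongr)
    linarith [neg_abs_le (ξ (c (a + ε) - c a - ε • v))]
  have hκ0 : 0 ≤ κ := by positivity
  have h10 := mul_le_mul_of_nonneg_left h7 hκ0
  have h11 : ε * A - κ * (ε - ‖ξ‖ * (δ * ε)) = ε + ξ h + η / 4 * ‖h‖ + (C₁ * ε) * ‖h‖ +
      η / 4 * ‖h‖ + (C₂ * ‖ξ‖ * δ) * ‖h‖ := by
    rw [hA, hκ]; field_simp; ring
  have h12 : (C₁ * ε) * ‖h‖ ≤ η / 4 * ‖h‖ := by
    gcongr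
    exact (mul_le_mul_of_nonneg_left hεδ.le hC₁).trans hδ5
  have h13 : (C₂ * ‖ξ‖ * δ) * ‖h‖ ≤ η / 4 * ‖h‖ := by gcongr
  linarith

end IsLocalFinsler

end Variation

end Finsler

/-! ### Finsler structures and velocities read in charts. -/

namespace Finsler

section Charts

variable {n : ℕ} {M : Type*} [TopologicalSpace M] [ChartedSpace (EuclideanSpace ℝ (Fin n)) M]

/-- The expression of a function on `TM` in the chart at `p₀`. -/
noncomputable def localExpr (F : TangentBundle (𝓡 n) M → ℝ) (p₀ : M)
    (x y : EuclideanSpace ℝ (Fin n)) : ℝ :=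
  F ⟨(extChartAt (𝓡 n) p₀).symm x,
    mfderiv 𝓘(ℝ, EuclideanSpace ℝ (Fin n)) (𝓡 n) (extChartAt (𝓡 n) p₀).symm x y⟩

/-- The derivative of the chart at `p₀`, on the tangent space at `p`. -/
noncomputable def chartDeriv (p₀ p : M) :
    TangentSpace (𝓡 n) p →L[ℝ] EuclideanSpace ℝ (Fin n) :=
  mfderiv (𝓡 n) 𝓘(ℝ, EuclideanSpace ℝ (Fin n)) (extChartAt (𝓡 n) p₀) p

variable [IsManifold (𝓡 n) ∞ M] {F : TangentBundle (𝓡 n) M → ℝ} {p₀ p : M}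

omit [IsManifold (𝓡 n) ∞ M] in
theorem extChartAt_target_mem_nhds_of_mem {x : EuclideanSpace ℝ (Fin n)}
    (hx : x ∈ (extChartAt (𝓡 n) p₀).target) : (extChartAt (𝓡 n) p₀).target ∈ 𝓝 x :=
  (isOpen_extChartAt_target p₀).mem_nhds hx

theorem isManifold_one : IsManifold (𝓡 n) 1 M :=
  IsManifold.of_le (n := ∞) (by exact_mod_cast le_top)

theorem hasMFDerivAt_chart (hp : p ∈ (extChartAt (𝓡 n) p₀).source) :
    HasMFDerivAt (𝓡 n) 𝓘(ℝ, EuclideanSpace ℝ (Fin n)) (extChartAt (𝓡 n) p₀) p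
      (chartDeriv p₀ p) := by
  have := isManifold_one (n := n) (M := M)
  rw [extChartAt_source] at hp
  exact (mdifferentiableAt_extChartAt hp).hasMFDerivAt

theorem mdifferentiableAt_chart_symm {x : EuclideanSpace ℝ (Fin n)}
    (hx : x ∈ (extChartAt (𝓡 n) p₀).target) :
    MDifferentiableAt 𝓘(ℝ, EuclideanSpace ℝ (Fin n)) (𝓡 n) (extChartAt (𝓡 n) p₀).symm x := by
  have := isManifold_one (n := n) (M := M)
  have h := mdifferentiableWithinAt_extChartAt_symm hx
  simpa [mdifferentiableWithinAt_univ] using h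

theorem chartDeriv_symm_apply {x : EuclideanSpace ℝ (Fin n)}
    (hx : x ∈ (extChartAt (𝓡 n) p₀).target) (y : EuclideanSpace ℝ (Fin n)) :
    chartDeriv p₀ ((extChartAt (𝓡 n) p₀).symm x)
      (mfderiv 𝓘(ℝ, EuclideanSpace ℝ (Fin n)) (𝓡 n) (extChartAt (𝓡 n) p₀).symm x y) = y := by
  have := isManifold_one (n := n) (M := M)
  have h := mfderiv_extChartAt_comp_mfderivWithin_extChartAt_symm hx
  simp only [modelWithCornersSelf_coe, range_id, mfderivWithin_univ] at h
  exact congrArg (fun T => T y) h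

theorem symm_chartDeriv_apply {x : EuclideanSpace ℝ (Fin n)}
    (hx : x ∈ (extChartAt (𝓡 n) p₀).target)
    (v : TangentSpace (𝓡 n) ((extChartAt (𝓡 n) p₀).symm x)) :
    mfderiv 𝓘(ℝ, EuclideanSpace ℝ (Fin n)) (𝓡 n) (extChartAt (𝓡 n) p₀).symm x
      (chartDeriv p₀ ((extChartAt (𝓡 n) p₀).symm x) v) = v := by
  have := isManifold_one (n := n) (M := M)
  have h := mfderivWithin_extChartAt_symm_comp_mfderiv_extChartAt hx
  simp only [modelWithCornersSelf_coe, range_id, mfderivWithin_univ] at h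
  exact congrArg (fun T => T v) h

theorem localExpr_chartDeriv (hp : p ∈ (extChartAt (𝓡 n) p₀).source)
    (v : TangentSpace (𝓡 n) p) :
    localExpr F p₀ (extChartAt (𝓡 n) p₀ p) (chartDeriv p₀ p v) = F ⟨p, v⟩ := by
  obtain ⟨x, hx, rfl⟩ : ∃ x ∈ (extChartAt (𝓡 n) p₀).target, (extChartAt (𝓡 n) p₀).symm x = p :=
    ⟨_, (extChartAt (𝓡 n) p₀).map_source hp, (extChartAt (𝓡 n) p₀).left_inv hp⟩
  rw [(extChartAt (𝓡 n) p₀).right_inv hx, localExpr, symm_chartDeriv_apply hx]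

theorem chartDeriv_bijective (hp : p ∈ (extChartAt (𝓡 n) p₀).source) :
    Function.Bijective (chartDeriv (n := n) p₀ p) := by
  obtain ⟨x, hx, rfl⟩ : ∃ x ∈ (extChartAt (𝓡 n) p₀).target, (extChartAt (𝓡 n) p₀).symm x = p :=
    ⟨_, (extChartAt (𝓡 n) p₀).map_source hp, (extChartAt (𝓡 n) p₀).left_inv hp⟩
  exact ⟨Function.LeftInverse.injective (symm_chartDeriv_apply hx),
    Function.RightInverse.surjective (chartDeriv_symm_apply hx)⟩

theorem fundamentalTensor_chart (hp : p ∈ (extChartAt (𝓡 n) p₀).source)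
    (y u v : TangentSpace (𝓡 n) p) :
    fundamentalTensor (fun w : TangentSpace (𝓡 n) p => F ⟨p, w⟩) y u v =
      fundamentalTensor (localExpr F p₀ (extChartAt (𝓡 n) p₀ p)) (chartDeriv p₀ p y)
        (chartDeriv p₀ p u) (chartDeriv p₀ p v) := by
  have h := fundamentalTensor_comp_linear (localExpr F p₀ (extChartAt (𝓡 n) p₀ p))
    (chartDeriv p₀ p).toLinearMap y u v
  rw [ContinuousLinearMap.coe_coe] at h
  rw [← h]
  congr 1
  funext w
  exact (localExpr_chartDeriv hp w).symm

theorem contMDiffOn_chart_symm :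
    ContMDiffOn 𝓘(ℝ, EuclideanSpace ℝ (Fin n)) (𝓡 n) ∞ (extChartAt (𝓡 n) p₀).symm
      (extChartAt (𝓡 n) p₀).target := contMDiffOn_extChartAt_symm p₀

/-- The local expression is `F` composed with the tangent map of the inverse chart. That map is
smooth and injective on fibres, so it carries nonzero vectors to nonzero vectors and pulls back
smoothness and positive definiteness. -/
theorem IsFinslerStructure.isLocalFinsler (hF : IsFinslerStructure F) (p₀ : M) :
    IsLocalFinsler (extChartAt (𝓡 n) p₀).target (localExpr F p₀) := by
  set E := EuclideanSpace ℝ (Fin n)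
  have hM := isManifold_one (n := n) (M := M)
  have hinj : ∀ x ∈ (extChartAt (𝓡 n) p₀).target, ∀ y : E, y ≠ 0 →
      mfderiv 𝓘(ℝ, E) (𝓡 n) (extChartAt (𝓡 n) p₀).symm x y ≠ 0 := by
    intro x hx y hy h
    have := chartDeriv_symm_apply hx y
    rw [h] at this
    exact hy (this.symm.trans (_root_.map_zero _))
  have hsm : ContDiffOn ℝ ∞ (Function.uncurry (localExpr F p₀))
      ((extChartAt (𝓡 n) p₀).target ×ˢ {0}ᶜ) := by
    have h1 : ContMDiffOn (𝓡 n).tangent (𝓡 n).tangent ∞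
        (tangentMapWithin 𝓘(ℝ, E) (𝓡 n) (extChartAt (𝓡 n) p₀).symm
          (extChartAt (𝓡 n) p₀).target) _ :=
      (contMDiffOn_chart_symm (p₀ := p₀)).contMDiffOn_tangentMapWithin (m := ∞) le_rfl
        (isOpen_extChartAt_target p₀).uniqueMDiffOn
    have h2 : ContMDiff 𝓘(ℝ, E × E) (𝓡 n).tangent ∞
        (fun z : E × E => (⟨z.1, z.2⟩ : TangentBundle (𝓡 n) E)) := by
      intro z
      rw [Bundle.contMDiffAt_totalSpace]
      refine ⟨contDiff_fst.contMDiff z, ?_⟩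
      simp
      exact contDiff_snd.contMDiff z
    have h3 := hF.smooth.comp (h1.comp h2.contMDiffOn (s := (extChartAt (𝓡 n) p₀).target ×ˢ {0}ᶜ)
      fun z hz => hz.1) fun z hz => ?_
    · rw [contMDiffOn_iff_contDiffOn] at h3
      refine h3.congr fun z hz => ?_
      simp only [Function.comp_apply, tangentMapWithin, Function.uncurry, localExpr]
      rw [mfderivWithin_of_mem_nhds (extChartAt_target_mem_nhds_of_mem hz.1)]
    · simp only [Function.comp_apply, tangentMapWithin, mem_preimage, mem_ofPred_eq]
      rw [mfderivWithin_of_mem_nhds (extChartAt_target_mem_nhds_of_mem hz.1)]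
      exact hinj _ hz.1 _ hz.2
  refine ⟨isOpen_extChartAt_target p₀, hsm, fun x hx => ?_⟩
  refine ⟨fun y => hF.nonneg _, ?_, fun y c hc => ?_, fun y hy u hu => ?_⟩
  · exact hsm.comp (f := fun y : E => (x, y)) (by fun_prop) fun y hy => ⟨hx, hy⟩
  · rw [localExpr, localExpr, ← hF.homogeneous _ _ c hc]
    congr 2
    exact _root_.map_smul _ c y
  · have h := fundamentalTensor_comp_linear
      (fun w : TangentSpace (𝓡 n) ((extChartAt (𝓡 n) p₀).symm x) => F ⟨_, w⟩)
      (mfderiv 𝓘(ℝ, E) (𝓡 n) (extChartAt (𝓡 n) p₀).symm x).toLinearMap y u u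
    change 0 < fundamentalTensor (fun w => F ⟨_, mfderiv 𝓘(ℝ, E) (𝓡 n)
      (extChartAt (𝓡 n) p₀).symm x w⟩) y u u
    exact (hF.posDef _ _ (hinj x hx y hy) _ (hinj x hx u hu)).trans_eq h.symm

theorem hasDerivWithinAt_chart_comp {γ : ℝ → M} {J : Set ℝ} {x : ℝ}
    (hγ : MDifferentiableWithinAt 𝓘(ℝ, ℝ) (𝓡 n) γ J x)
    (hx : γ x ∈ (extChartAt (𝓡 n) p₀).source) :
    HasDerivWithinAt (fun t => extChartAt (𝓡 n) p₀ (γ t))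
      (chartDeriv p₀ (γ x) (mfderivWithin 𝓘(ℝ, ℝ) (𝓡 n) γ J x (1 : ℝ))) J x := by
  have h := (hasMFDerivAt_chart hx).comp_hasMFDerivWithinAt x hγ.hasMFDerivWithinAt
  have h' : HasFDerivWithinAt (fun t => extChartAt (𝓡 n) p₀ (γ t))
      ((chartDeriv p₀ (γ x)).comp (mfderivWithin 𝓘(ℝ, ℝ) (𝓡 n) γ J x) :
        ℝ →L[ℝ] EuclideanSpace ℝ (Fin n)) J x := h.hasFDerivWithinAt
  exact h'.hasDerivWithinAt

theorem hasDerivAt_chart_comp {γ : ℝ → M} {x : ℝ}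
    (hγ : MDifferentiableAt 𝓘(ℝ, ℝ) (𝓡 n) γ x)
    (hx : γ x ∈ (extChartAt (𝓡 n) p₀).source) :
    HasDerivAt (fun t => extChartAt (𝓡 n) p₀ (γ t))
      (chartDeriv p₀ (γ x) (mfderiv 𝓘(ℝ, ℝ) (𝓡 n) γ x (1 : ℝ))) x := by
  have h := (hasMFDerivAt_chart hx).comp x hγ.hasMFDerivAt
  have h' : HasFDerivAt (fun t => extChartAt (𝓡 n) p₀ (γ t))
      ((chartDeriv p₀ (γ x)).comp (mfderiv 𝓘(ℝ, ℝ) (𝓡 n) γ x) :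
        ℝ →L[ℝ] EuclideanSpace ℝ (Fin n)) x := h.hasFDerivAt
  exact h'.hasDerivAt

theorem localExpr_deriv {γ : ℝ → M} {x : ℝ}
    (hγ : MDifferentiableAt 𝓘(ℝ, ℝ) (𝓡 n) γ x)
    (hx : γ x ∈ (extChartAt (𝓡 n) p₀).source) :
    localExpr F p₀ (extChartAt (𝓡 n) p₀ (γ x)) (deriv (fun t => extChartAt (𝓡 n) p₀ (γ t)) x) =
      F (velocity γ x) := by
  rw [(hasDerivAt_chart_comp hγ hx).deriv, localExpr_chartDeriv hx]
  rfl

theorem mdifferentiableAt_chart_symm_comp {c : ℝ → EuclideanSpace ℝ (Fin n)} {x : ℝ}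
    (hc : DifferentiableAt ℝ c x) (hx : c x ∈ (extChartAt (𝓡 n) p₀).target) :
    MDifferentiableAt 𝓘(ℝ, ℝ) (𝓡 n) (fun t => (extChartAt (𝓡 n) p₀).symm (c t)) x :=
  (mdifferentiableAt_chart_symm hx).comp x hc.mdifferentiableAt

theorem velocity_chart_symm_comp {c : ℝ → EuclideanSpace ℝ (Fin n)} {x : ℝ}
    (hc : DifferentiableAt ℝ c x) (hx : c x ∈ (extChartAt (𝓡 n) p₀).target) :
    F (velocity (fun t => (extChartAt (𝓡 n) p₀).symm (c t)) x) =
      localExpr F p₀ (c x) (deriv c x) := by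
  rw [← localExpr_deriv (F := F) (p₀ := p₀) (mdifferentiableAt_chart_symm_comp hc hx)
    ((extChartAt (𝓡 n) p₀).map_target hx), (extChartAt (𝓡 n) p₀).right_inv hx]
  congr 1
  refine Filter.EventuallyEq.deriv_eq ?_
  filter_upwards [hc.continuousAt (extChartAt_target_mem_nhds_of_mem hx)] with t ht
  exact (extChartAt (𝓡 n) p₀).right_inv ht

end Charts

end Finsler

/-! ### Piecewise smooth unit speed curves on the manifold: restriction, translation, concatenation.
-/

namespace Finsler

theorem exists_isolating_radius (P : Finset ℝ) (x : ℝ) :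
    ∃ ε > 0, ∀ y ∈ P, |y - x| < ε → y = x := by
  have h1 : ((P : Set ℝ) \ {x})ᶜ ∈ 𝓝 x :=
    (P.finite_toSet.subset sdiff_subset).isClosed.isOpen_compl.mem_nhds fun h => h.2 rfl
  obtain ⟨ε, hε, hb⟩ := Metric.mem_nhds_iff.1 h1
  refine ⟨ε, hε, fun y hy hyx => ?_⟩
  by_contra hne
  exact hb (show y ∈ Metric.ball x ε by rwa [Metric.mem_ball, Real.dist_eq]) ⟨hy, hne⟩

/-- The speed is continuous up to the ends of a `C¹` arc and equals `1` inside. -/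
theorem IsLocalFinsler.unit_derivWithin {V : Type*} [NormedAddCommGroup V] [NormedSpace ℝ V]
    [FiniteDimensional ℝ V] {Ω : Set V} {f : V → V → ℝ} (hf : IsLocalFinsler Ω f)
    {c : ℝ → V} {a b : ℝ} (hab : a < b) (hc : ContDiffOn ℝ 1 c (Icc a b))
    (hΩ : ∀ x ∈ Icc a b, c x ∈ Ω) (hu : ∀ x ∈ Ioo a b, f (c x) (deriv c x) = 1) :
    ∀ x ∈ Icc a b, f (c x) (derivWithin c (Icc a b) x) = 1 := by
  have h1 : ContinuousOn (derivWithin c (Icc a b)) (Icc a b) :=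
    hc.continuousOn_derivWithin (uniqueDiffOn_Icc hab) le_rfl
  have h2 : ContinuousOn (fun x => f (c x) (derivWithin c (Icc a b) x)) (Icc a b) :=
    hf.continuousOn_uncurry.comp (hc.continuousOn.prodMk h1) fun x hx => ⟨hΩ x hx, mem_univ _⟩
  have h3 : EqOn (fun x => f (c x) (derivWithin c (Icc a b) x)) (fun _ => 1) (Ioo a b) := by
    intro x hx
    simp only
    rw [derivWithin_of_mem_nhds (Icc_mem_nhds hx.1 hx.2), hu x hx]
  exact h3.of_subset_closure h2 continuousOn_const Ioo_subset_Icc_self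
    (closure_Ioo hab.ne).symm.subset

section Curves

variable {n : ℕ} {M : Type*} [TopologicalSpace M] [ChartedSpace (EuclideanSpace ℝ (Fin n)) M]

theorem IsPiecewiseSmooth.exists_right {γ : ℝ → M} {a b x : ℝ}
    (hγ : IsPiecewiseSmooth n γ a b) (ha : a ≤ x) (hb : x < b) :
    ∃ ε > 0, x + ε ≤ b ∧ ContMDiffOn 𝓘(ℝ, ℝ) (𝓡 n) ∞ γ (Icc x (x + ε)) := by
  obtain ⟨-, P, hP⟩ := hγ
  obtain ⟨ε, hε, h⟩ := exists_isolating_radius P x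
  have h1 : min ε (b - x) ≤ b - x := min_le_right _ _
  have h2 : min ε (b - x) ≤ ε := min_le_left _ _
  have h3 : 0 < min ε (b - x) := lt_min hε (by linarith)
  refine ⟨min ε (b - x), h3, by linarith, hP _ _ ha (by linarith) (by linarith) ?_⟩
  intro y hy hyI
  have := h y hy (by rw [abs_of_pos (by linarith [hyI.1])]; linarith [hyI.2])
  linarith [hyI.1]

theorem IsPiecewiseSmooth.exists_left {γ : ℝ → M} {a b x : ℝ}
    (hγ : IsPiecewiseSmooth n γ a b) (ha : a < x) (hb : x ≤ b) :
    ∃ ε > 0, a ≤ x - ε ∧ ContMDiffOn 𝓘(ℝ, ℝ) (𝓡 n) ∞ γ (Icc (x - ε) x) := by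
  obtain ⟨-, P, hP⟩ := hγ
  obtain ⟨ε, hε, h⟩ := exists_isolating_radius P x
  have h1 : min ε (x - a) ≤ x - a := min_le_right _ _
  have h2 : min ε (x - a) ≤ ε := min_le_left _ _
  have h3 : 0 < min ε (x - a) := lt_min hε (by linarith)
  refine ⟨min ε (x - a), h3, by linarith, hP _ _ (by linarith) (by linarith) hb ?_⟩
  intro y hy hyI
  have := h y hy (by rw [abs_of_neg (by linarith [hyI.2])]; linarith [hyI.1])
  linarith [hyI.2]

theorem IsPiecewiseSmooth.exists_finset {γ : ℝ → M} {a b : ℝ} (hγ : IsPiecewiseSmooth n γ a b) :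
    ∃ P : Finset ℝ, ∀ x ∈ Ioo a b, x ∉ P → MDifferentiableAt 𝓘(ℝ, ℝ) (𝓡 n) γ x := by
  obtain ⟨-, P, hP⟩ := hγ
  refine ⟨P, fun x hx hxP => ?_⟩
  obtain ⟨ε, hε, h⟩ := exists_isolating_radius P x
  have h3 : 0 < min ε (min (x - a) (b - x)) :=
    lt_min hε (lt_min (by linarith [hx.1]) (by linarith [hx.2]))
  have h4 : min ε (min (x - a) (b - x)) ≤ ε := min_le_left _ _
  have h5 : min ε (min (x - a) (b - x)) ≤ x - a := (min_le_right _ _).trans (min_le_left _ _)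
  have h6 : min ε (min (x - a) (b - x)) ≤ b - x := (min_le_right _ _).trans (min_le_right _ _)
  set r := min ε (min (x - a) (b - x))
  have h7 := hP (x - r) (x + r) (by linarith) (by linarith) (by linarith) fun y hy hyI => by
    have := h y hy (by rw [abs_lt]; constructor <;> linarith [hyI.1, hyI.2])
    exact hxP (this ▸ hy)
  exact (h7.contMDiffAt (Icc_mem_nhds (by linarith) (by linarith))).mdifferentiableAt (by simp)

theorem IsPiecewiseSmooth.mono {γ : ℝ → M} {a b a' b' : ℝ} (hγ : IsPiecewiseSmooth n γ a b)
    (ha : a ≤ a') (hb : b' ≤ b) : IsPiecewiseSmooth n γ a' b' := by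
  obtain ⟨hc, P, hP⟩ := hγ
  exact ⟨hc.mono (Icc_subset_Icc ha hb), P, fun c d h1 h2 h3 =>
    hP c d (ha.trans h1) h2 (h3.trans hb)⟩

theorem IsPiecewiseSmooth.comp_add {γ : ℝ → M} {a b τ : ℝ}
    (hγ : IsPiecewiseSmooth n γ (a + τ) (b + τ)) :
    IsPiecewiseSmooth n (fun x => γ (x + τ)) a b := by
  obtain ⟨hc, P, hP⟩ := hγ
  refine ⟨hc.comp (by fun_prop) fun x hx => ⟨by linarith [hx.1], by linarith [hx.2]⟩,
    P.image (fun x => x - τ), fun c d h1 h2 h3 h4 => ?_⟩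
  have h5 := hP (c + τ) (d + τ) (by linarith) (by linarith) (by linarith) fun y hy hyI =>
    h4 (y - τ) (Finset.mem_image_of_mem _ hy) ⟨by linarith [hyI.1], by linarith [hyI.2]⟩
  have h6 : ContMDiff 𝓘(ℝ, ℝ) 𝓘(ℝ, ℝ) ∞ (fun x : ℝ => x + τ) :=
    (contDiff_id.add contDiff_const).contMDiff
  exact h5.comp h6.contMDiffOn fun x hx => ⟨by linarith [hx.1], by linarith [hx.2]⟩

/-- The curve `γ₁` on `[0, ℓ]`, followed by `γ₂`. -/
noncomputable def concat (γ₁ γ₂ : ℝ → M) (ℓ : ℝ) (x : ℝ) : M :=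
  if x ≤ ℓ then γ₁ x else γ₂ (x - ℓ)

omit [TopologicalSpace M] [ChartedSpace (EuclideanSpace ℝ (Fin n)) M] in
theorem concat_of_le {γ₁ γ₂ : ℝ → M} {ℓ x : ℝ} (h : x ≤ ℓ) : concat γ₁ γ₂ ℓ x = γ₁ x :=
  if_pos h

omit [TopologicalSpace M] [ChartedSpace (EuclideanSpace ℝ (Fin n)) M] in
theorem concat_of_ge {γ₁ γ₂ : ℝ → M} {ℓ x : ℝ} (h0 : γ₁ ℓ = γ₂ 0) (h : ℓ ≤ x) :
    concat γ₁ γ₂ ℓ x = γ₂ (x - ℓ) := by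
  rcases h.eq_or_lt with rfl | h
  · rw [concat_of_le le_rfl, h0, sub_self]
  · exact if_neg h.not_ge

theorem IsPiecewiseSmooth.concat {γ₁ γ₂ : ℝ → M} {ℓ₁ ℓ₂ : ℝ} (h₁ : IsPiecewiseSmooth n γ₁ 0 ℓ₁)
    (h₂ : IsPiecewiseSmooth n γ₂ 0 ℓ₂) (hℓ₁ : 0 ≤ ℓ₁) (hℓ₂ : 0 ≤ ℓ₂) (h0 : γ₁ ℓ₁ = γ₂ 0) :
    IsPiecewiseSmooth n (concat γ₁ γ₂ ℓ₁) 0 (ℓ₁ + ℓ₂) := by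
  have h₂' : IsPiecewiseSmooth n (fun x => γ₂ (x + -ℓ₁)) ℓ₁ (ℓ₁ + ℓ₂) :=
    IsPiecewiseSmooth.comp_add (by simpa using h₂)
  obtain ⟨hc₁, P₁, hP₁⟩ := h₁
  obtain ⟨hc₂, P₂, hP₂⟩ := h₂'
  refine ⟨?_, insert ℓ₁ (P₁ ∪ P₂), fun c d hc hcd hd hP => ?_⟩
  · rw [← Icc_union_Icc_eq_Icc hℓ₁ (by linarith : ℓ₁ ≤ ℓ₁ + ℓ₂)]
    refine ContinuousOn.union_of_isClosed ?_ ?_ isClosed_Icc isClosed_Icc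
    · exact hc₁.congr fun x hx => concat_of_le hx.2
    · exact hc₂.congr fun x hx => concat_of_ge h0 hx.1
  · have hℓ := hP ℓ₁ (Finset.mem_insert_self _ _)
    rcases le_or_gt d ℓ₁ with hdℓ | hdℓ
    · refine (hP₁ c d hc hcd hdℓ fun x hx => hP x (by simp [hx])).congr fun x hx =>
        concat_of_le (hx.2.trans hdℓ)
    · have hcℓ : ℓ₁ ≤ c := by
        by_contra h
        exact hℓ ⟨not_le.1 h, hdℓ⟩
      exact (hP₂ c d hcℓ hcd hd fun x hx => hP x (by simp [hx])).congr fun x hx =>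
        concat_of_ge h0 (hcℓ.trans hx.1)

variable [IsManifold (𝓡 n) ∞ M] {F : TangentBundle (𝓡 n) M → ℝ}

/-- The two derivatives live in tangent spaces at base points that are equal only propositionally;
comparing them in one chart avoids a transport. -/
theorem velocity_congr {γ₁ γ₂ : ℝ → M} {x : ℝ} (h : γ₁ =ᶠ[𝓝 x] γ₂)
    (hγ : MDifferentiableAt 𝓘(ℝ, ℝ) (𝓡 n) γ₁ x) :
    F (velocity γ₁ x) = F (velocity γ₂ x) := by
  have hγ₂ := hγ.congr_of_eventuallyEq h.symm
  have hs : γ₁ x ∈ (extChartAt (𝓡 n) (γ₁ x)).source := mem_extChartAt_source _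
  rw [← localExpr_deriv (F := F) hγ hs, ← localExpr_deriv (F := F) hγ₂ (h.self_of_nhds ▸ hs),
    h.self_of_nhds]
  congr 1
  refine Filter.EventuallyEq.deriv_eq ?_
  filter_upwards [h] with t ht
  rw [ht]

omit [IsManifold (𝓡 n) ∞ M] in
theorem velocity_comp_add {γ : ℝ → M} {x τ : ℝ}
    (hγ : MDifferentiableAt 𝓘(ℝ, ℝ) (𝓡 n) γ (x + τ)) :
    velocity (n := n) (fun x => γ (x + τ)) x = velocity γ (x + τ) := by
  have h1 : HasDerivAt (fun x : ℝ => x + τ) 1 x := (hasDerivAt_id x).add_const τ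
  have h2 : HasMFDerivAt 𝓘(ℝ, ℝ) 𝓘(ℝ, ℝ) (fun x : ℝ => x + τ) x _ := h1.hasFDerivAt.hasMFDerivAt
  have h3 := (HasMFDerivAt.comp x hγ.hasMFDerivAt h2).mfderiv
  unfold velocity
  congr 1
  refine (congrArg (fun T => T (1 : ℝ)) h3).trans ?_
  refine congrArg (mfderiv 𝓘(ℝ, ℝ) (𝓡 n) γ (x + τ)) ?_
  exact (one_smul ℝ (1 : ℝ))

omit [IsManifold (𝓡 n) ∞ M] in
theorem mdifferentiableAt_comp_add_iff {γ : ℝ → M} {x τ : ℝ} :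
    MDifferentiableAt 𝓘(ℝ, ℝ) (𝓡 n) (fun x => γ (x + τ)) x ↔
      MDifferentiableAt 𝓘(ℝ, ℝ) (𝓡 n) γ (x + τ) := by
  have h1 : ∀ σ y : ℝ, MDifferentiableAt 𝓘(ℝ, ℝ) 𝓘(ℝ, ℝ) (fun x : ℝ => x + σ) y := fun σ y =>
    (differentiableAt_id.add_const σ).mdifferentiableAt
  constructor
  · intro h
    have h' : MDifferentiableAt 𝓘(ℝ, ℝ) (𝓡 n) (fun x => γ (x + τ)) (x + τ + -τ) := by simpa
    simpa [Function.comp_def] using h'.comp (x + τ) (h1 (-τ) (x + τ))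
  · intro h
    exact h.comp x (h1 τ x)

omit [IsManifold (𝓡 n) ∞ M] in
theorem IsUnitSpeed.comp_add {γ : ℝ → M} {a b τ : ℝ} (hγ : IsUnitSpeed F γ (a + τ) (b + τ)) :
    IsUnitSpeed F (fun x => γ (x + τ)) a b := by
  intro x hx h
  rw [mdifferentiableAt_comp_add_iff] at h
  rw [velocity_comp_add h]
  exact hγ _ ⟨by linarith [hx.1], by linarith [hx.2]⟩ h

/-- Along a smooth arc of unit speed, the one-sided velocities at the ends are unit vectors, too. -/
theorem IsFinslerStructure.unit_derivWithin (hF : IsFinslerStructure F) {γ : ℝ → M} {a b : ℝ}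
    {p₀ : M} (hab : a < b) (hγ : ContMDiffOn 𝓘(ℝ, ℝ) (𝓡 n) ∞ γ (Icc a b))
    (hu : IsUnitSpeed F γ a b) (hs : ∀ x ∈ Icc a b, γ x ∈ (extChartAt (𝓡 n) p₀).source) :
    ContDiffOn ℝ ∞ (fun x => extChartAt (𝓡 n) p₀ (γ x)) (Icc a b) ∧
    ∀ x ∈ Icc a b, localExpr F p₀ (extChartAt (𝓡 n) p₀ (γ x))
      (derivWithin (fun x => extChartAt (𝓡 n) p₀ (γ x)) (Icc a b) x) = 1 := by
  have hc : ContDiffOn ℝ ∞ (fun x => extChartAt (𝓡 n) p₀ (γ x)) (Icc a b) := by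
    rw [← contMDiffOn_iff_contDiffOn]
    exact (contMDiffOn_extChartAt (n := ∞)).comp hγ fun x hx => by
      simpa using hs x hx
  refine ⟨hc, ?_⟩
  refine (hF.isLocalFinsler p₀).unit_derivWithin hab (hc.of_le (by simp))
    (fun x hx => (extChartAt (𝓡 n) p₀).map_source (hs x hx)) fun x hx => ?_
  have hd := (hγ.contMDiffAt (Icc_mem_nhds hx.1 hx.2)).mdifferentiableAt (by simp)
  rw [localExpr_deriv hd (hs x (Ioo_subset_Icc_self hx))]
  exact hu x hx hd

/-- Piecewise smooth unit speed curves on `[0, ℓ]`. -/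
structure IsUnitCurve (F : TangentBundle (𝓡 n) M → ℝ) (γ : ℝ → M) (ℓ : ℝ) : Prop where
  nonneg : 0 ≤ ℓ
  piecewiseSmooth : IsPiecewiseSmooth n γ 0 ℓ
  unitSpeed : IsUnitSpeed F γ 0 ℓ

omit [IsManifold (𝓡 n) ∞ M] in
theorem IsShortest.isUnitCurve {K : Set M} {q : M} {γ : ℝ → M} {ℓ : ℝ}
    (h : IsShortest F K q γ ℓ) : IsUnitCurve F γ ℓ :=
  ⟨h.nonneg, h.piecewiseSmooth, h.unitSpeed⟩

omit [IsManifold (𝓡 n) ∞ M] in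
theorem IsUnitCurve.segment {γ : ℝ → M} {ℓ u v : ℝ} (h : IsUnitCurve F γ ℓ) (hu : 0 ≤ u)
    (huv : u ≤ v) (hv : v ≤ ℓ) : IsUnitCurve F (fun x => γ (x + u)) (v - u) := by
  refine ⟨by linarith, ?_, ?_⟩
  · exact IsPiecewiseSmooth.comp_add (h.piecewiseSmooth.mono (by linarith) (by linarith))
  · exact IsUnitSpeed.comp_add fun x hx => h.unitSpeed x ⟨by linarith [hx.1], by linarith [hx.2]⟩

omit [IsManifold (𝓡 n) ∞ M] in
theorem IsUnitCurve.length_eq {γ : ℝ → M} {ℓ u v : ℝ} (h : IsUnitCurve F γ ℓ) (hu : 0 ≤ u)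
    (huv : u ≤ v) (hv : v ≤ ℓ) : length F γ u v = v - u := by
  obtain ⟨P, hP⟩ := h.piecewiseSmooth.exists_finset
  have h1 : ∫ x in u..v, F (velocity γ x) = ∫ x in u..v, (1 : ℝ) := by
    rw [intervalIntegral.integral_of_le huv, intervalIntegral.integral_of_le huv]
    refine integral_congr_ae (ae_restrict_Ioc_of_forall_notMem P fun x hx hxP => ?_)
    have hx' : x ∈ Ioo 0 ℓ := ⟨by linarith [hx.1], by linarith [hx.2]⟩
    exact h.unitSpeed x hx' (hP x hx' hxP)
  rw [length, h1]
  simp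

theorem IsUnitCurve.concat (hF : IsFinslerStructure F) {γ₁ γ₂ : ℝ → M} {ℓ₁ ℓ₂ : ℝ}
    (h₁ : IsUnitCurve F γ₁ ℓ₁) (h₂ : IsUnitCurve F γ₂ ℓ₂) (h0 : γ₁ ℓ₁ = γ₂ 0) :
    IsUnitCurve F (concat γ₁ γ₂ ℓ₁) (ℓ₁ + ℓ₂) := by
  refine ⟨add_nonneg h₁.nonneg h₂.nonneg,
    h₁.piecewiseSmooth.concat h₂.piecewiseSmooth h₁.nonneg h₂.nonneg h0, fun x hx hd => ?_⟩
  rcases lt_trichotomy x ℓ₁ with hxℓ | rfl | hxℓ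
  · have he : Finsler.concat γ₁ γ₂ ℓ₁ =ᶠ[𝓝 x] γ₁ := by
      filter_upwards [gt_mem_nhds hxℓ] with y hy using concat_of_le hy.le
    rw [velocity_congr (F := F) he hd]
    exact h₁.unitSpeed x ⟨hx.1, hxℓ⟩ (hd.congr_of_eventuallyEq he.symm)
  -- At the junction something must be shown only if the concatenation happens to be differentiable
  -- there. Its derivative is then the left derivative of `γ₁`, a unit vector by continuity.
  · obtain ⟨ε, hε, hε0, hsm⟩ := h₁.piecewiseSmooth.exists_left hx.1 le_rfl
    set p₀ := Finsler.concat γ₁ γ₂ x x with hp₀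
    have hp₁ : γ₁ x = p₀ := (concat_of_le le_rfl).symm
    have hs : γ₁ x ∈ (extChartAt (𝓡 n) p₀).source := hp₁ ▸ mem_extChartAt_source _
    have hsd : Finsler.concat γ₁ γ₂ x x ∈ (extChartAt (𝓡 n) p₀).source :=
      mem_extChartAt_source _
    have hcw : ∀ᶠ y in 𝓝[Icc (x - ε) x] x, γ₁ y ∈ (extChartAt (𝓡 n) p₀).source :=
      hsm.continuousOn x ⟨by linarith, le_rfl⟩ ((isOpen_extChartAt_source p₀).mem_nhds hs)
    obtain ⟨r, hr, hball⟩ := Metric.mem_nhdsWithin_iff.1 hcw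
    have hm0 : 0 < min ε (r / 2) := lt_min hε (by linarith)
    have hm1 : min ε (r / 2) ≤ ε := min_le_left _ _
    have hm2 : min ε (r / 2) ≤ r / 2 := min_le_right _ _
    set m := min ε (r / 2)
    have hlt : x - m < x := by linarith
    obtain ⟨hc, hunit⟩ := hF.unit_derivWithin (p₀ := p₀) hlt
      (hsm.mono (Icc_subset_Icc (by linarith) le_rfl))
      (fun y hy => h₁.unitSpeed y ⟨by linarith [hy.1], hy.2⟩) (fun y hy => hball
        ⟨by rw [Metric.mem_ball, Real.dist_eq, abs_lt]; constructor <;> linarith [hy.1, hy.2],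
          by linarith [hy.1], hy.2⟩)
    have hx' : x ∈ Icc (x - m) x := ⟨hlt.le, le_rfl⟩
    have h3 := hunit x hx'
    have h4 : derivWithin (fun y => extChartAt (𝓡 n) p₀ (γ₁ y)) (Icc (x - m) x) x =
        deriv (fun y => extChartAt (𝓡 n) p₀ (Finsler.concat γ₁ γ₂ x y)) x := by
      have h5 := hasDerivAt_chart_comp (p₀ := p₀) hd hsd
      have h6 := h5.hasDerivWithinAt (s := Icc (x - m) x)
      rw [h5.deriv]
      refine HasDerivWithinAt.derivWithin ?_ (uniqueDiffOn_Icc hlt x hx')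
      exact h6.congr (fun y hy => by rw [concat_of_le hy.2]) (by rw [concat_of_le le_rfl])
    rw [h4, hp₁] at h3
    rw [← localExpr_deriv (F := F) (p₀ := p₀) hd hsd]
    exact h3
  · have he : Finsler.concat γ₁ γ₂ ℓ₁ =ᶠ[𝓝 x] fun y => γ₂ (y + -ℓ₁) := by
      filter_upwards [lt_mem_nhds hxℓ] with y hy using concat_of_ge h0 hy.le
    rw [velocity_congr (F := F) he hd]
    refine IsUnitSpeed.comp_add (a := ℓ₁) (b := ℓ₁ + ℓ₂) ?_ x ⟨hxℓ, hx.2⟩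
      (hd.congr_of_eventuallyEq he.symm)
    simpa using h₂.unitSpeed

end Curves

end Finsler

/-! ### The distance, shortest curves and the cut locus. -/

namespace Finsler

section Distance

variable {n : ℕ} {M : Type*} [TopologicalSpace M] [ChartedSpace (EuclideanSpace ℝ (Fin n)) M]
  [IsManifold (𝓡 n) ∞ M] {F : TangentBundle (𝓡 n) M → ℝ}

/-- Piecewise smooth curves in a vector space, with breakpoints in `P`. -/
def PiecewiseContDiff {V : Type*} [NormedAddCommGroup V] [NormedSpace ℝ V] (c : ℝ → V)
    (P : Finset ℝ) (a b : ℝ) : Prop :=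
  ContinuousOn c (Icc a b) ∧ ∀ a' b' : ℝ, a ≤ a' → a' < b' → b' ≤ b →
    (∀ x ∈ P, x ∉ Ioo a' b') → ContDiffOn ℝ ∞ c (Icc a' b')

theorem length_nonneg (hF : IsFinslerStructure F) (γ : ℝ → M) {a b : ℝ} (hab : a ≤ b) :
    0 ≤ length F γ a b :=
  intervalIntegral.integral_nonneg hab fun _ _ => hF.nonneg _

theorem fdist_nonneg (hF : IsFinslerStructure F) (p q : M) : 0 ≤ fdist F p q := by
  refine Real.sInf_nonneg ?_
  rintro _ ⟨a, b, γ, hab, -, -, -, rfl⟩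
  exact length_nonneg hF γ hab

theorem fdist_le_length (hF : IsFinslerStructure F) {γ : ℝ → M} {a b : ℝ} (hab : a ≤ b)
    (hγ : IsPiecewiseSmooth n γ a b) : fdist F (γ a) (γ b) ≤ length F γ a b := by
  refine csInf_le ⟨0, ?_⟩ ⟨a, b, γ, hab, hγ, rfl, rfl, rfl⟩
  rintro _ ⟨a, b, γ, hab, -, -, -, rfl⟩
  exact length_nonneg hF γ hab

theorem IsUnitCurve.fdist_le (hF : IsFinslerStructure F) {γ : ℝ → M} {ℓ u v : ℝ}
    (h : IsUnitCurve F γ ℓ) (hu : 0 ≤ u) (huv : u ≤ v) (hv : v ≤ ℓ) :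
    fdist F (γ u) (γ v) ≤ v - u :=
  (fdist_le_length hF huv (h.piecewiseSmooth.mono hu hv)).trans_eq (h.length_eq hu huv hv)

theorem fdist_self (hF : IsFinslerStructure F) (p : M) : fdist F p p = 0 := by
  have hp : IsPiecewiseSmooth n (fun _ : ℝ => p) 0 0 :=
    ⟨continuousOn_const, ∅, fun _ _ _ _ _ _ => contMDiffOn_const⟩
  have h := fdist_le_length hF le_rfl hp
  rw [length, intervalIntegral.integral_same] at h
  exact h.antisymm (fdist_nonneg hF p p)

omit [IsManifold (𝓡 n) ∞ M] in
@[simp]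
theorem fdistFrom_singleton (p q : M) : fdistFrom F {p} q = fdist F p q := by
  simp [fdistFrom]

theorem fdistFrom_nonneg (hF : IsFinslerStructure F) (K : Set M) (q : M) :
    0 ≤ fdistFrom F K q := by
  refine Real.sInf_nonneg ?_
  rintro _ ⟨a, -, rfl⟩
  exact fdist_nonneg hF a q

theorem fdistFrom_le (hF : IsFinslerStructure F) {K : Set M} {a : M} (ha : a ∈ K) (q : M) :
    fdistFrom F K q ≤ fdist F a q := by
  refine csInf_le ⟨0, ?_⟩ ⟨a, ha, rfl⟩
  rintro _ ⟨a, -, rfl⟩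
  exact fdist_nonneg hF a q

omit [IsManifold (𝓡 n) ∞ M] in
theorem le_fdistFrom {K : Set M} (hK : K.Nonempty) {q : M} {L : ℝ}
    (h : ∀ a ∈ K, L ≤ fdist F a q) : L ≤ fdistFrom F K q := by
  refine le_csInf (hK.image _) ?_
  rintro _ ⟨a, ha, rfl⟩
  exact h a ha

omit [IsManifold (𝓡 n) ∞ M] in
theorem IsShortest.length_eq_fdistFrom {K : Set M} {q : M} {γ : ℝ → M} {ℓ : ℝ}
    (h : IsShortest F K q γ ℓ) : ℓ = fdistFrom F K q := by
  rw [← h.length_eq, h.isUnitCurve.length_eq le_rfl h.nonneg le_rfl, sub_zero]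

omit [IsManifold (𝓡 n) ∞ M] in
theorem IsUnitCurve.isShortest {K : Set M} {γ : ℝ → M} {ℓ : ℝ} (h : IsUnitCurve F γ ℓ)
    (h0 : γ 0 ∈ K) {q : M} (hq : γ ℓ = q) (hℓ : ℓ = fdistFrom F K q) : IsShortest F K q γ ℓ :=
  ⟨h.nonneg, h.piecewiseSmooth, h.unitSpeed, h0, hq, by
    rw [h.length_eq le_rfl h.nonneg le_rfl, sub_zero, hℓ]⟩

/-- Any two points are joined by a shortest unit speed curve. -/
def HasShortestCurves (F : TangentBundle (𝓡 n) M → ℝ) : Prop :=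
  ∀ p q : M, ∃ (γ : ℝ → M) (ℓ : ℝ), IsShortest F {p} q γ ℓ

omit [IsManifold (𝓡 n) ∞ M] in
theorem HasShortestCurves.exists_unitCurve (hmin : HasShortestCurves F) (p q : M) :
    ∃ γ : ℝ → M, IsUnitCurve F γ (fdist F p q) ∧ γ 0 = p ∧ γ (fdist F p q) = q := by
  obtain ⟨γ, ℓ, h⟩ := hmin p q
  have hℓ := h.length_eq_fdistFrom
  rw [fdistFrom_singleton] at hℓ
  exact ⟨γ, hℓ ▸ h.isUnitCurve, h.source, hℓ ▸ h.target⟩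

/-- Concatenate minimizers. Their existence also ensures that the infimum defining `fdist` is never
the default value `0` of an empty set. -/
theorem fdist_triangle (hF : IsFinslerStructure F) (hmin : HasShortestCurves F) (p q r : M) :
    fdist F p r ≤ fdist F p q + fdist F q r := by
  obtain ⟨γ₁, h₁, h₁0, h₁ℓ⟩ := hmin.exists_unitCurve p q
  obtain ⟨γ₂, h₂, h₂0, h₂ℓ⟩ := hmin.exists_unitCurve q r
  have h0 : γ₁ (fdist F p q) = γ₂ 0 := h₁ℓ.trans h₂0.symm
  have h := (h₁.concat hF h₂ h0).fdist_le hF le_rfl (h₁.concat hF h₂ h0).nonneg le_rfl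
  rw [concat_of_le h₁.nonneg, concat_of_ge h0 (by linarith [h₂.nonneg]), add_sub_cancel_left, h₁0,
    h₂ℓ, sub_zero] at h
  exact h

theorem fdistFrom_triangle (hF : IsFinslerStructure F) (hmin : HasShortestCurves F) {K : Set M}
    (hK : K.Nonempty) (p q : M) : fdistFrom F K q ≤ fdistFrom F K p + fdist F p q := by
  rw [← sub_le_iff_le_add]
  refine le_fdistFrom hK fun a ha => ?_
  have h1 := fdistFrom_le hF ha q
  have h2 := fdist_triangle hF hmin a p q
  linarith

/-- The length of a curve in a chart bounds the distance of its ends. -/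
theorem fdist_le_integral (hF : IsFinslerStructure F) {p₀ : M}
    {c : ℝ → EuclideanSpace ℝ (Fin n)} {P : Finset ℝ} {a b : ℝ} (hab : a ≤ b)
    (hc : PiecewiseContDiff c P a b) (hs : ∀ x ∈ Icc a b, c x ∈ (extChartAt (𝓡 n) p₀).target) :
    fdist F ((extChartAt (𝓡 n) p₀).symm (c a)) ((extChartAt (𝓡 n) p₀).symm (c b)) ≤
      ∫ x in a..b, localExpr F p₀ (c x) (deriv c x) := by
  have hps' : IsPiecewiseSmooth n c a b := ⟨hc.1, P, fun a' b' h1 h2 h3 h4 =>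
    (hc.2 a' b' h1 h2 h3 h4).contMDiffOn⟩
  have hps : IsPiecewiseSmooth n (fun x => (extChartAt (𝓡 n) p₀).symm (c x)) a b := by
    refine ⟨(continuousOn_extChartAt_symm p₀).comp hc.1 hs, P, fun a' b' h1 h2 h3 h4 => ?_⟩
    exact (contMDiffOn_chart_symm (p₀ := p₀)).comp (hc.2 a' b' h1 h2 h3 h4).contMDiffOn
      fun x hx => hs x ⟨h1.trans hx.1, hx.2.trans h3⟩
  refine (fdist_le_length hF hab hps).trans_eq ?_
  obtain ⟨Q, hQ⟩ := hps'.exists_finset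
  rw [length, intervalIntegral.integral_of_le hab, intervalIntegral.integral_of_le hab]
  refine integral_congr_ae (ae_restrict_Ioc_of_forall_notMem Q fun x hx hxQ => ?_)
  exact velocity_chart_symm_comp (hQ x hx hxQ).differentiableAt (hs x (Ioo_subset_Icc_self hx))

/-- The straight segment in the chart is an admissible curve, and its speed is at most `C ‖y - x‖`.
-/
theorem exists_fdist_le_mul (hF : IsFinslerStructure F) {p₀ : M}
    {x₀ : EuclideanSpace ℝ (Fin n)} (hx₀ : x₀ ∈ (extChartAt (𝓡 n) p₀).target) :
    ∃ R > 0, ∃ C > 0, Metric.closedBall x₀ R ⊆ (extChartAt (𝓡 n) p₀).target ∧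
      ∀ x ∈ Metric.closedBall x₀ R, ∀ y ∈ Metric.closedBall x₀ R,
        fdist F ((extChartAt (𝓡 n) p₀).symm x) ((extChartAt (𝓡 n) p₀).symm y) ≤ C * ‖y - x‖ := by
  obtain ⟨R, hR, m, hm, C, hC, hRΩ, hb⟩ := (hF.isLocalFinsler p₀).exists_bounds hx₀
  refine ⟨R, hR, C, hC, hRΩ, fun x hx y hy => ?_⟩
  have hmem : ∀ t ∈ Icc (0 : ℝ) 1, x + t • (y - x) ∈ Metric.closedBall x₀ R := fun t ht =>
    (convex_closedBall x₀ R).add_smul_sub_mem hx hy ht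
  have hd : ∀ t : ℝ, HasDerivAt (fun t : ℝ => x + t • (y - x)) (y - x) t := fun t => by
    simpa using ((hasDerivAt_id t).smul_const (y - x)).const_add x
  have hc : PiecewiseContDiff (fun t : ℝ => x + t • (y - x)) ∅ 0 1 :=
    ⟨by fun_prop, fun _ _ _ _ _ _ => by fun_prop⟩
  have h := fdist_le_integral hF (p₀ := p₀) zero_le_one hc fun t ht => hRΩ (hmem t ht)
  simp only [zero_smul, add_zero, one_smul, add_sub_cancel] at h
  refine h.trans ?_
  have h2 : ∀ t ∈ uIoc (0 : ℝ) 1, ‖localExpr F p₀ (x + t • (y - x))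
      (deriv (fun t : ℝ => x + t • (y - x)) t)‖ ≤ C * ‖y - x‖ := by
    intro t ht
    rw [uIoc_of_le zero_le_one] at ht
    rw [(hd t).deriv, Real.norm_of_nonneg (show 0 ≤ localExpr F p₀ _ _ from hF.nonneg _)]
    exact (hb _ (hmem t (Ioc_subset_Icc_self ht)) _).2
  have h3 := intervalIntegral.norm_integral_le_of_norm_le_const h2
  rw [sub_zero, abs_one, mul_one] at h3
  exact (Real.le_norm_self _).trans h3

theorem exists_fdist_eventually_le (hF : IsFinslerStructure F) (p : M) :
    ∃ C > 0, ∀ᶠ q in 𝓝 p,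
      fdist F p q ≤ C * ‖extChartAt (𝓡 n) p q - extChartAt (𝓡 n) p p‖ ∧
      fdist F q p ≤ C * ‖extChartAt (𝓡 n) p q - extChartAt (𝓡 n) p p‖ := by
  obtain ⟨R, hR, C, hC, hRΩ, h⟩ := exists_fdist_le_mul hF (mem_extChartAt_target (I := 𝓡 n) p)
  refine ⟨C, hC, ?_⟩
  have h1 : ∀ᶠ q in 𝓝 p, extChartAt (𝓡 n) p q ∈ Metric.closedBall (extChartAt (𝓡 n) p p) R :=
    continuousAt_extChartAt p (Metric.closedBall_mem_nhds _ hR)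
  filter_upwards [h1, extChartAt_source_mem_nhds (I := 𝓡 n) p] with q hq hqs
  have h2 := h _ (Metric.mem_closedBall_self hR.le) _ hq
  have h3 := h _ hq _ (Metric.mem_closedBall_self hR.le)
  rw [extChartAt_to_inv, (extChartAt (𝓡 n) p).left_inv hqs] at h2 h3
  rw [norm_sub_rev] at h3
  exact ⟨h2, h3⟩

theorem tendsto_fdist_left_right (hF : IsFinslerStructure F) (p : M) :
    Tendsto (fun q => fdist F p q + fdist F q p) (𝓝 p) (𝓝 0) := by
  obtain ⟨C, hC, h⟩ := exists_fdist_eventually_le hF p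
  have h1 : Tendsto (fun q => 2 * (C * ‖extChartAt (𝓡 n) p q - extChartAt (𝓡 n) p p‖)) (𝓝 p)
      (𝓝 0) := by
    have h2 : ContinuousAt
        (fun q => 2 * (C * ‖extChartAt (𝓡 n) p q - extChartAt (𝓡 n) p p‖)) p :=
      (((continuousAt_extChartAt p).sub continuousAt_const).norm.const_mul C).const_mul 2
    simpa [ContinuousAt] using h2
  refine tendsto_of_tendsto_of_tendsto_of_le_of_le' tendsto_const_nhds h1 ?_ ?_
  · exact Eventually.of_forall fun q => add_nonneg (fdist_nonneg hF _ _) (fdist_nonneg hF _ _)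
  · filter_upwards [h] with q hq
    linarith [hq.1, hq.2]

/-- The distance is not symmetric, so continuity is deduced from a Lipschitz bound by the
symmetrized distance, which tends to `0` by comparison with a chart. -/
theorem continuous_of_abs_sub_le (hF : IsFinslerStructure F) {g : M → ℝ}
    (hg : ∀ p q, |g q - g p| ≤ fdist F p q + fdist F q p) : Continuous g := by
  rw [continuous_iff_continuousAt]
  intro p
  rw [ContinuousAt, tendsto_iff_norm_sub_tendsto_zero]
  exact squeeze_zero (fun _ => norm_nonneg _) (fun q => hg p q) (tendsto_fdist_left_right hF p)

theorem continuous_fdistFrom (hF : IsFinslerStructure F) (hmin : HasShortestCurves F) {K : Set M}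
    (hK : K.Nonempty) : Continuous (fdistFrom F K) := by
  refine continuous_of_abs_sub_le hF fun p q => ?_
  rw [abs_le]
  constructor <;> linarith [fdistFrom_triangle hF hmin hK p q, fdistFrom_triangle hF hmin hK q p,
    fdist_nonneg hF p q, fdist_nonneg hF q p]

theorem continuous_fdist_left (hF : IsFinslerStructure F) (hmin : HasShortestCurves F) (r : M) :
    Continuous fun p => fdist F p r := by
  refine continuous_of_abs_sub_le hF fun p q => ?_
  rw [abs_le]
  constructor <;> linarith [fdist_triangle hF hmin p q r, fdist_triangle hF hmin q p r,
    fdist_nonneg hF p q, fdist_nonneg hF q p]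

/-- By compactness and continuity of `fdist` in its first argument, some point of `K` is nearest to
`q`; a shortest curve from that point is shortest from `K`. -/
theorem exists_isShortest (hF : IsFinslerStructure F) (hmin : HasShortestCurves F) {K : Set M}
    (hK : IsCompact K) (hne : K.Nonempty) (q : M) :
    ∃ γ : ℝ → M, IsShortest F K q γ (fdistFrom F K q) := by
  obtain ⟨a, ha, hmina⟩ := hK.exists_isMinOn hne (continuous_fdist_left hF hmin q).continuousOn
  have he : fdist F a q = fdistFrom F K q :=
    (le_fdistFrom hne fun b hb => hmina hb).antisymm (fdistFrom_le hF ha q)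
  obtain ⟨γ, h, h0, hℓ⟩ := hmin.exists_unitCurve a q
  rw [he] at h hℓ
  exact ⟨γ, h.isShortest (h0 ▸ ha) hℓ rfl⟩

/-- Along a unit speed curve on which `fdistFrom F K` grows by its whole length, it grows at unit
speed. -/
theorem IsUnitCurve.fdistFrom_eq (hF : IsFinslerStructure F) (hmin : HasShortestCurves F)
    {K : Set M} (hK : K.Nonempty) {γ : ℝ → M} {ℓ : ℝ} (h : IsUnitCurve F γ ℓ)
    (hℓ : fdistFrom F K (γ ℓ) = fdistFrom F K (γ 0) + ℓ) {u : ℝ} (hu : u ∈ Icc 0 ℓ) :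
    fdistFrom F K (γ u) = fdistFrom F K (γ 0) + u := by
  have h1 := h.fdist_le hF le_rfl hu.1 hu.2
  have h2 := h.fdist_le hF hu.1 hu.2 le_rfl
  have h3 := fdistFrom_triangle hF hmin hK (γ 0) (γ u)
  have h4 := fdistFrom_triangle hF hmin hK (γ u) (γ ℓ)
  linarith

/-- The increase of the distance from `K` bounds `fdist` from below and the length bounds it from
above; the two agree, so the curve minimizes between any two of its points. -/
theorem IsUnitCurve.fdist_eq (hF : IsFinslerStructure F) (hmin : HasShortestCurves F)
    {K : Set M} (hK : K.Nonempty) {γ : ℝ → M} {ℓ : ℝ} (h : IsUnitCurve F γ ℓ)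
    (hℓ : fdistFrom F K (γ ℓ) = fdistFrom F K (γ 0) + ℓ) {u v : ℝ} (hu : 0 ≤ u) (huv : u ≤ v)
    (hv : v ≤ ℓ) : fdist F (γ u) (γ v) = v - u := by
  have h1 := h.fdistFrom_eq hF hmin hK hℓ ⟨hu, huv.trans hv⟩
  have h2 := h.fdistFrom_eq hF hmin hK hℓ ⟨hu.trans huv, hv⟩
  have h3 := h.fdist_le hF hu huv hv
  have h4 := fdistFrom_triangle hF hmin hK (γ u) (γ v)
  linarith

theorem fdistFrom_of_mem (hF : IsFinslerStructure F) {K : Set M} {q : M} (hq : q ∈ K) :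
    fdistFrom F K q = 0 :=
  ((fdistFrom_le hF hq q).trans_eq (fdist_self hF q)).antisymm (fdistFrom_nonneg hF K q)

theorem IsShortest.fdistFrom_target (hF : IsFinslerStructure F) {K : Set M} {q : M} {γ : ℝ → M}
    {ℓ : ℝ} (h : IsShortest F K q γ ℓ) :
    fdistFrom F K (γ ℓ) = fdistFrom F K (γ 0) + ℓ := by
  rw [h.target, fdistFrom_of_mem hF h.source, zero_add]
  exact h.length_eq_fdistFrom.symm

theorem IsShortest.fdistFrom_eq (hF : IsFinslerStructure F) (hmin : HasShortestCurves F)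
    {K : Set M} {q : M} {γ : ℝ → M} {ℓ : ℝ} (h : IsShortest F K q γ ℓ) {u : ℝ}
    (hu : u ∈ Icc 0 ℓ) : fdistFrom F K (γ u) = u := by
  rw [h.isUnitCurve.fdistFrom_eq hF hmin ⟨_, h.source⟩ (h.fdistFrom_target hF) hu,
    fdistFrom_of_mem hF h.source, zero_add]

theorem IsShortest.concat (hF : IsFinslerStructure F) {K : Set M} {z q : M} {γ₁ γ₂ : ℝ → M}
    {ℓ₁ ℓ₂ : ℝ} (h₁ : IsShortest F K z γ₁ ℓ₁) (h₂ : IsUnitCurve F γ₂ ℓ₂) (h0 : γ₂ 0 = z)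
    (hq : γ₂ ℓ₂ = q) (hℓ : fdistFrom F K q = fdistFrom F K z + ℓ₂) :
    IsShortest F K q (concat γ₁ γ₂ ℓ₁) (ℓ₁ + ℓ₂) := by
  have h0' : γ₁ ℓ₁ = γ₂ 0 := h₁.target.trans h0.symm
  refine (h₁.isUnitCurve.concat hF h₂ h0').isShortest ?_ ?_ ?_
  · rw [concat_of_le h₁.nonneg]
    exact h₁.source
  · rw [concat_of_ge h0' (by linarith [h₂.nonneg]), add_sub_cancel_left, hq]
  · rw [hℓ, ← h₁.length_eq_fdistFrom]

omit [IsManifold (𝓡 n) ∞ M] in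
theorem notMem_cutLocus_iff {K : Set M} {q : M} : q ∉ cutLocus F K ↔ ∀ (ℓ : ℝ) (γ₁ γ₂ : ℝ → M),
    IsShortest F K q γ₁ ℓ → IsShortest F K q γ₂ ℓ → EqOn γ₁ γ₂ (Icc 0 ℓ) := by
  simp only [cutLocus, mem_ofPred_eq, not_exists, not_and, not_not]

/-- Off the cut locus, the points between `K` and `q` lie on the shortest curve. -/
theorem IsShortest.eq_of_between (hF : IsFinslerStructure F) (hmin : HasShortestCurves F)
    {K : Set M} (hK : IsCompact K) {q z : M} {γ : ℝ → M} {ℓ : ℝ} (h : IsShortest F K q γ ℓ)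
    (hcut : q ∉ cutLocus F K) (hz : fdistFrom F K z + fdist F z q = fdistFrom F K q) :
    z = γ (fdistFrom F K z) := by
  obtain ⟨γ₁, h₁⟩ := exists_isShortest hF hmin hK ⟨_, h.source⟩ z
  obtain ⟨γ₂, h₂, h₂0, h₂ℓ⟩ := hmin.exists_unitCurve z q
  -- A shortest curve to `z` continued by one from `z` to `q` is again shortest from `K` to `q`, so
  -- it must coincide with `γ`.
  have h₃ := h₁.concat hF h₂ h₂0 h₂ℓ hz.symm
  have hℓ : fdistFrom F K z + fdist F z q = ℓ := hz.trans h.length_eq_fdistFrom.symm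
  rw [hℓ] at h₃
  have h4 := notMem_cutLocus_iff.1 hcut ℓ _ _ h₃ h
    (x := fdistFrom F K z) ⟨h₁.nonneg, by linarith [h₂.nonneg]⟩
  rw [← h4, concat_of_le le_rfl, h₁.target]

/-- If `z` lies between `K` and `q`, and `q` is not in the cut locus of `K`, then it is not in the
cut locus of `z` either. -/
theorem notMem_cutLocus_singleton (hF : IsFinslerStructure F) (hmin : HasShortestCurves F)
    {K : Set M} (hK : IsCompact K) (hne : K.Nonempty) {q z : M}
    (hcut : q ∉ cutLocus F K) (hz : fdistFrom F K z + fdist F z q = fdistFrom F K q) :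
    q ∉ cutLocus F {z} := by
  rw [notMem_cutLocus_iff] at hcut ⊢
  intro ℓ γ₁ γ₂ h₁ h₂ u hu
  obtain ⟨γ, h⟩ := exists_isShortest hF hmin hK hne z
  have hℓ : ℓ = fdist F z q := by rw [h₁.length_eq_fdistFrom, fdistFrom_singleton]
  -- Prefixing one and the same shortest curve from `K` to `z` makes both curves shortest from `K`
  -- to `q`, where uniqueness is known.
  have e₁ := h.concat hF h₁.isUnitCurve h₁.source h₁.target (by rw [hℓ, hz])
  have e₂ := h.concat hF h₂.isUnitCurve h₂.source h₂.target (by rw [hℓ, hz])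
  have h3 := hcut _ _ _ e₁ e₂ (x := fdistFrom F K z + u)
    ⟨by linarith [h.nonneg, hu.1], by linarith [hu.2]⟩
  rwa [concat_of_ge (h.target.trans (Eq.symm h₁.source)) (by linarith [hu.1]),
    concat_of_ge (h.target.trans (Eq.symm h₂.source)) (by linarith [hu.1]),
    add_sub_cancel_left] at h3

end Distance

end Finsler

/-! ### Differentiability of the distance off the cut locus. -/

namespace Finsler

section Differentiability

variable {n : ℕ} {M : Type*} [TopologicalSpace M] [ChartedSpace (EuclideanSpace ℝ (Fin n)) M]
  [IsManifold (𝓡 n) ∞ M] {F : TangentBundle (𝓡 n) M → ℝ}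

theorem IsUnitCurve.exists_chart {γ : ℝ → M} {ℓ a b : ℝ} {p₀ : M} (h : IsUnitCurve F γ ℓ)
    (ha : 0 ≤ a) (hb : b ≤ ℓ) (hs : ∀ x ∈ Icc a b, γ x ∈ (extChartAt (𝓡 n) p₀).source) :
    ∃ P : Finset ℝ, PiecewiseContDiff (fun x => extChartAt (𝓡 n) p₀ (γ x)) P a b ∧
      ∀ x ∈ Ioo a b, x ∉ P → DifferentiableAt ℝ (fun x => extChartAt (𝓡 n) p₀ (γ x)) x ∧
        localExpr F p₀ (extChartAt (𝓡 n) p₀ (γ x))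
          (deriv (fun x => extChartAt (𝓡 n) p₀ (γ x)) x) = 1 := by
  obtain ⟨Q, hQ⟩ := h.piecewiseSmooth.exists_finset
  obtain ⟨hc, P, hP⟩ := h.piecewiseSmooth
  refine ⟨P ∪ Q, ⟨(continuousOn_extChartAt p₀).comp (hc.mono (Icc_subset_Icc ha hb)) hs,
    fun a' b' h1 h2 h3 h4 => ?_⟩, fun x hx hxP => ?_⟩
  · rw [← contMDiffOn_iff_contDiffOn]
    refine (contMDiffOn_extChartAt (n := ∞)).comp (hP a' b' (ha.trans h1) h2 (h3.trans hb)
      fun x hx => h4 x (Finset.mem_union_left _ hx)) fun x hx => ?_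
    simpa using hs x ⟨h1.trans hx.1, hx.2.trans h3⟩
  · have hx' : x ∈ Ioo 0 ℓ := ⟨ha.trans_lt hx.1, hx.2.trans_le hb⟩
    have hd := hQ x hx' fun h => hxP (Finset.mem_union_right _ h)
    have hs' := hs x (Ioo_subset_Icc_self hx)
    refine ⟨(hasDerivAt_chart_comp hd hs').differentiableAt, ?_⟩
    rw [localExpr_deriv hd hs']
    exact h.unitSpeed x hx' hd

/-- The end of a unit speed curve which ends near `x₀` stays near `x₀`. -/
theorem exists_forall_end_mem_ball [T2Space M] (hF : IsFinslerStructure F) {p₀ : M}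
    {x₀ : EuclideanSpace ℝ (Fin n)} (hx₀ : x₀ ∈ (extChartAt (𝓡 n) p₀).target) {δ : ℝ}
    (hδ : 0 < δ) : ∃ ε > 0, ∀ (γ : ℝ → M) (ℓ : ℝ), IsUnitCurve F γ ℓ →
      γ ℓ ∈ (extChartAt (𝓡 n) p₀).source → extChartAt (𝓡 n) p₀ (γ ℓ) ∈ Metric.ball x₀ ε →
      ∀ u ∈ Icc 0 ℓ, ℓ - ε ≤ u → γ u ∈ (extChartAt (𝓡 n) p₀).source ∧
        extChartAt (𝓡 n) p₀ (γ u) ∈ Metric.ball x₀ δ := by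
  obtain ⟨R, hR, m, hm, C, hC, hRΩ, hb⟩ := (hF.isLocalFinsler p₀).exists_bounds hx₀
  set φ := extChartAt (𝓡 n) p₀ with hφ
  set δ₁ := min δ R with hδ₁
  have hδ₁0 : 0 < δ₁ := lt_min hδ hR
  have hδ₁R : δ₁ ≤ R := min_le_right _ _
  set ε := min (δ₁ / 2) (m * (δ₁ / 3)) with hε
  have hε1 : ε ≤ δ₁ / 2 := min_le_left _ _
  have hε2 : ε ≤ m * (δ₁ / 3) := min_le_right _ _
  refine ⟨ε, lt_min (by positivity) (by positivity), fun γ ℓ h hs hend u hu hul => ?_⟩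
  set O := φ.source ∩ φ ⁻¹' Metric.ball x₀ δ₁ with hO
  have hOo : IsOpen O := (continuousOn_extChartAt p₀).isOpen_inter_preimage
    (isOpen_extChartAt_source p₀) Metric.isOpen_ball
  suffices hu : γ u ∈ O from ⟨hu.1, Metric.ball_subset_ball (min_le_left _ _) hu.2⟩
  by_contra hbad
  have hγc : ContinuousOn γ (Icc u ℓ) := h.piecewiseSmooth.1.mono (Icc_subset_Icc hu.1 le_rfl)
  have hScl : IsClosed (Icc u ℓ ∩ γ ⁻¹' Oᶜ) :=
    hγc.preimage_isClosed_of_isClosed isClosed_Icc hOo.isClosed_compl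
  -- `t` is the last time at which the curve is outside `O`; the contradiction will be that `γ t`
  -- lies in `O`.
  obtain ⟨t, ⟨⟨htI, htO⟩, htmax⟩⟩ :=
    (isCompact_Icc.of_isClosed_subset hScl inter_subset_left).exists_isGreatest
      ⟨u, ⟨le_rfl, hu.2⟩, hbad⟩
  have hendO : γ ℓ ∈ O := ⟨hs, Metric.ball_subset_ball (by linarith) hend⟩
  have htℓ : t < ℓ := htI.2.lt_of_ne fun he => htO (he ▸ hendO)
  have hafter : ∀ x ∈ Ioc t ℓ, γ x ∈ O := fun x hx => by
    by_contra hxO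
    exact hx.1.not_ge (htmax ⟨⟨htI.1.trans hx.1.le, hx.2⟩, hxO⟩)
  have hsubR : Metric.closedBall x₀ δ₁ ⊆ φ.target :=
    (Metric.closedBall_subset_closedBall hδ₁R).trans hRΩ
  -- Here the Hausdorff property enters: the compact image of the closed ball is closed, so the
  -- limit point `γ t` still lies in the domain of the chart.
  have hKc : IsCompact (φ.symm '' Metric.closedBall x₀ δ₁) :=
    (isCompact_closedBall _ _).image_of_continuousOn
      ((continuousOn_extChartAt_symm p₀).mono hsubR)
  have htK : γ t ∈ φ.symm '' Metric.closedBall x₀ δ₁ := by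
    rw [← hKc.isClosed.closure_eq]
    refine ContinuousWithinAt.mem_closure (s := Ioc t ℓ) ((hγc t htI).mono fun x hx =>
      ⟨htI.1.trans hx.1.le, hx.2⟩) ?_ fun x hx => ?_
    · rw [closure_Ioc htℓ.ne]
      exact ⟨le_rfl, htℓ.le⟩
    · exact ⟨φ (γ x), Metric.ball_subset_closedBall (hafter x hx).2,
        φ.left_inv (hafter x hx).1⟩
  obtain ⟨y, hy, hyt⟩ := htK
  have hts : γ t ∈ φ.source := hyt ▸ φ.map_target (hsubR hy)
  have hall : ∀ x ∈ Icc t ℓ, γ x ∈ φ.source ∧ φ (γ x) ∈ Metric.closedBall x₀ R := by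
    intro x hx
    rcases hx.1.eq_or_lt with rfl | hlt
    · refine ⟨hts, ?_⟩
      rw [← hyt, φ.right_inv (hsubR hy)]
      exact Metric.closedBall_subset_closedBall hδ₁R hy
    · have := hafter x ⟨hlt, hx.2⟩
      exact ⟨this.1, Metric.ball_subset_closedBall (Metric.ball_subset_ball hδ₁R this.2)⟩
  obtain ⟨P, hP, hPd⟩ := h.exists_chart (p₀ := p₀) (hu.1.trans htI.1) le_rfl
    fun x hx => (hall x hx).1
  have hlip := norm_sub_le_of_piecewise (B := m⁻¹) htℓ.le hP.1 P (fun x hx hxP => (hPd x hx hxP).1)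
    fun x hx hxP => by
      have := (hb _ (hall x (Ioo_subset_Icc_self hx)).2
        (deriv (fun x => extChartAt (𝓡 n) p₀ (γ x)) x)).1
      rw [(hPd x hx hxP).2] at this
      rw [← one_div, le_div_iff₀ hm]
      linarith
  refine htO ⟨hts, ?_⟩
  -- After time `t` the coordinates move by at most `ε / m ≤ δ₁ / 3`, and the end is within `δ₁ / 2`
  -- of `x₀`; the sum is less than `δ₁`.
  have h1 : m⁻¹ * (ℓ - t) ≤ δ₁ / 3 := by
    rw [inv_mul_le_iff₀ hm]
    linarith [htI.1]
  have h2 : dist (φ (γ ℓ)) x₀ < δ₁ / 2 := (Metric.mem_ball.1 hend).trans_le hε1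
  rw [mem_preimage, Metric.mem_ball]
  rw [← dist_eq_norm, dist_comm] at hlip
  calc dist (φ (γ t)) x₀ ≤ dist (φ (γ t)) (φ (γ ℓ)) + dist (φ (γ ℓ)) x₀ := dist_triangle _ _ _
    _ < δ₁ := by linarith

/-- First variation of the distance from the initial point of a short shortest curve. -/
theorem exists_fdist_variation (hF : IsFinslerStructure F) {p₀ : M}
    {x₀ v : EuclideanSpace ℝ (Fin n)} (hx₀ : x₀ ∈ (extChartAt (𝓡 n) p₀).target)
    (hv : localExpr F p₀ x₀ v = 1) {η : ℝ} (hη : 0 < η) :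
    ∃ δ > 0, ∀ ε, 0 < ε → ε < δ → ∃ δ' > 0, ∀ (γ : ℝ → M) (ℓ : ℝ), IsUnitCurve F γ ℓ → ε ≤ ℓ →
      (∀ u ∈ Icc (ℓ - ε) ℓ, γ u ∈ (extChartAt (𝓡 n) p₀).source ∧
        extChartAt (𝓡 n) p₀ (γ u) ∈ Metric.ball x₀ δ) →
      ‖extChartAt (𝓡 n) p₀ (γ ℓ) - extChartAt (𝓡 n) p₀ (γ (ℓ - ε)) - ε • v‖ ≤ δ * ε →
      ∀ h : EuclideanSpace ℝ (Fin n), ‖h‖ < δ' →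
      fdist F (γ (ℓ - ε)) ((extChartAt (𝓡 n) p₀).symm (extChartAt (𝓡 n) p₀ (γ ℓ) + h)) ≤
        ε + fderiv ℝ (localExpr F p₀ x₀) v h + η * ‖h‖ := by
  obtain ⟨δ, hδ, hvar⟩ := (hF.isLocalFinsler p₀).exists_variation hx₀ hv hη
  refine ⟨δ, hδ, fun ε hε hεδ => ?_⟩
  obtain ⟨δ', hδ', hvar⟩ := hvar ε hε hεδ
  refine ⟨δ', hδ', fun γ ℓ hγ hεℓ hs havg h hh => ?_⟩
  obtain ⟨P, hP, hPd⟩ := hγ.exists_chart (p₀ := p₀) (a := ℓ - ε) (by linarith) le_rfl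
    fun x hx => (hs x hx).1
  obtain ⟨hΩ, hint⟩ := hvar _ _ _ P (by ring) hP.1 (fun x hx => (hs x hx).2) hPd havg h hh
  refine le_trans ?_ hint
  set c := fun x => extChartAt (𝓡 n) p₀ (γ x) with hc
  -- The variation grows linearly from `0` at the start of the last arc to `h` at its end, so it is
  -- an admissible curve from `γ (ℓ - ε)` to the displaced end.
  have hP' : PiecewiseContDiff (fun x => c x + ((x - (ℓ - ε)) / ε) • h) P (ℓ - ε) ℓ :=
    ⟨hP.1.add (by fun_prop), fun a' b' h1 h2 h3 h4 => (hP.2 a' b' h1 h2 h3 h4).add (by fun_prop)⟩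
  have hle := fdist_le_integral hF (p₀ := p₀) (by linarith) hP' hΩ
  simp only [sub_self, zero_div, zero_smul, add_zero, sub_sub_cancel, div_self hε.ne',
    one_smul, hc] at hle
  rw [(extChartAt (𝓡 n) p₀).left_inv (hs _ ⟨le_rfl, by linarith⟩).1] at hle
  refine hle.trans_eq ?_
  rw [intervalIntegral.integral_of_le (by linarith), intervalIntegral.integral_of_le (by linarith)]
  refine integral_congr_ae (ae_restrict_Ioc_of_forall_notMem P fun x hx hxP => ?_)
  have hd : HasDerivAt (fun x => c x + ((x - (ℓ - ε)) / ε) • h) (deriv c x + (1 / ε) • h) x :=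
    (hPd x hx hxP).1.hasDerivAt.add
      ((((hasDerivAt_id x).sub_const _).div_const ε).smul_const h)
  simp only
  rw [← hd.deriv]

/-- `v` is the final velocity of the shortest curve `γ` to `p`. Displacing the end of its last arc
of length `ε` bounds the distance to nearby points from above. Displacing the ends of shortest
curves to nearby points back to `p` gives the lower bound; this requires their last arcs to have
average velocity near `v`, which follows from uniqueness of `γ` and compactness. The positive
distance leaves room for the last arc. -/
theorem exists_hasFDerivAt_fdistFrom [T2Space M] (hF : IsFinslerStructure F)
    (hmin : HasShortestCurves F) {K : Set M} (hK : IsCompact K) (hne : K.Nonempty) {p₀ p : M}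
    (hp : p ∈ (extChartAt (𝓡 n) p₀).source) (hcut : p ∉ cutLocus F K)
    (hpos : 0 < fdistFrom F K p) : ∃ v : EuclideanSpace ℝ (Fin n),
      localExpr F p₀ (extChartAt (𝓡 n) p₀ p) v = 1 ∧
      HasFDerivAt (fun x => fdistFrom F K ((extChartAt (𝓡 n) p₀).symm x))
        (fderiv ℝ (localExpr F p₀ (extChartAt (𝓡 n) p₀ p)) v) (extChartAt (𝓡 n) p₀ p) := by
  set φ := extChartAt (𝓡 n) p₀ with hφ
  set x₀ := φ p with hx₀
  have hx₀t : x₀ ∈ φ.target := φ.map_source hp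
  have hsymm : φ.symm x₀ = p := φ.left_inv hp
  set ρ := fdistFrom F K with hρ
  have hρc : Continuous ρ := continuous_fdistFrom hF hmin hne
  obtain ⟨γ, hγ⟩ := exists_isShortest hF hmin hK hne p
  set L := fdistFrom F K p with hL
  have hγu := hγ.isUnitCurve
  have hγL : γ L = p := hγ.target
  set c := fun x => φ (γ x) with hc
  -- the final velocity of the shortest curve
  obtain ⟨ε₀, hε₀, hend₀⟩ := exists_forall_end_mem_ball hF hx₀t one_pos
  obtain ⟨ε₁, hε₁, hε₁L, hsm⟩ := hγ.piecewiseSmooth.exists_left hpos le_rfl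
  set e := min ε₀ ε₁ with he
  have he0 : 0 < e := lt_min hε₀ hε₁
  have he1 : e ≤ ε₀ := min_le_left _ _
  have he2 : e ≤ ε₁ := min_le_right _ _
  have hlt : L - e < L := by linarith
  obtain ⟨hcsm, hunit⟩ := hF.unit_derivWithin (p₀ := p₀) hlt
    (hsm.mono (Icc_subset_Icc (by linarith) le_rfl))
    (fun x hx => hγ.unitSpeed x ⟨by linarith [hx.1], hx.2⟩)
    (fun x hx => (hend₀ γ L hγu (by rw [hγL]; exact hp)
      (by rw [hγL]; exact Metric.mem_ball_self hε₀) x ⟨by linarith [hx.1], hx.2⟩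
        (by linarith [hx.1])).1)
  have hLmem : L ∈ Icc (L - e) L := ⟨hlt.le, le_rfl⟩
  set v := derivWithin c (Icc (L - e) L) L with hv
  have hv1 : localExpr F p₀ x₀ v = 1 := by
    have := hunit L hLmem
    rwa [hγL] at this
  have hcd : HasDerivWithinAt c v (Icc (L - e) L) L :=
    ((hcsm.differentiableOn (by simp)) L hLmem).hasDerivWithinAt
  refine ⟨v, hv1, ?_⟩
  rw [hasFDerivAt_iff_isLittleO_nhds_zero, Asymptotics.isLittleO_iff]
  intro η hη
  set ξ := fderiv ℝ (localExpr F p₀ x₀) v with hξ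
  obtain ⟨δ, hδ, hvar⟩ := exists_fdist_variation hF hx₀t hv1 hη
  obtain ⟨R, hR, C, hC, hRΩ, hdist⟩ := exists_fdist_le_mul hF hx₀t
  obtain ⟨ε₂, hε₂, hend⟩ := exists_forall_end_mem_ball hF hx₀t (lt_min hδ hR)
  obtain ⟨ε₃, hε₃, hder⟩ := Metric.mem_nhdsWithin_iff.1
    ((hasDerivWithinAt_iff_isLittleO.1 hcd).def (half_pos hδ))
  obtain ⟨ε, hε, hεlt⟩ := exists_between (lt_min (lt_min hδ hε₂) (lt_min hε₃ he0))
  have hεδ : ε < δ := hεlt.trans_le ((min_le_left _ _).trans (min_le_left _ _))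
  have hεε₂ : ε < ε₂ := hεlt.trans_le ((min_le_left _ _).trans (min_le_right _ _))
  have hεε₃ : ε < ε₃ := hεlt.trans_le ((min_le_right _ _).trans (min_le_left _ _))
  have hεe : ε < e := hεlt.trans_le ((min_le_right _ _).trans (min_le_right _ _))
  have hεL : ε < L := by linarith
  obtain ⟨δ', hδ', hvar⟩ := hvar ε hε hεδ
  have hends : ∀ (σ : ℝ → M) (ℓ : ℝ), IsUnitCurve F σ ℓ → ε ≤ ℓ → σ ℓ ∈ φ.source →
      φ (σ ℓ) ∈ Metric.ball x₀ ε₂ → ∀ u ∈ Icc (ℓ - ε) ℓ, σ u ∈ φ.source ∧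
        φ (σ u) ∈ Metric.ball x₀ (min δ R) := fun σ ℓ hσ hℓ h1 h2 u hu =>
    hend σ ℓ hσ h1 h2 u ⟨by linarith [hu.1], hu.2⟩ (by linarith [hu.1])
  set z₀ := c (L - ε) with hz₀
  have havg₀ : ‖x₀ - z₀ - ε • v‖ ≤ δ / 2 * ε := by
    have h1 : L - ε ∈ Metric.ball L ε₃ ∩ Icc (L - e) L :=
      ⟨by rw [Metric.mem_ball, Real.dist_eq, abs_lt]; constructor <;> linarith,
        by linarith, by linarith⟩
    have h2 : ‖c (L - ε) - c L - (L - ε - L) • v‖ ≤ δ / 2 * ‖L - ε - L‖ := hder h1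
    have h3 : c (L - ε) - c L - (L - ε - L) • v = -(x₀ - z₀ - ε • v) := by
      have : c L = x₀ := by rw [hc, hx₀]; exact congrArg φ hγL
      rw [this, hz₀]
      module
    rw [h3, norm_neg, sub_sub_cancel_left, norm_neg, Real.norm_of_nonneg hε.le] at h2
    exact h2
  have hγends := hends γ L hγu hεL.le (by rw [hγL]; exact hp)
    (by rw [hγL]; exact Metric.mem_ball_self hε₂)
  have hLε : L - ε ∈ Icc 0 L := ⟨by linarith, by linarith⟩
  -- starting points of the last parts of shortest curves to nearby points
  obtain ⟨κ, hκ, hκle⟩ : ∃ κ > 0, ∀ x ∈ Metric.closedBall x₀ R, δ / 4 * ε ≤ dist x z₀ →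
      κ ≤ |ρ (φ.symm x) + fdist F (φ.symm x) p - L| + |fdist F (φ.symm x) p - ε| := by
    have hT : IsCompact (Metric.closedBall x₀ R ∩ {x | δ / 4 * ε ≤ dist x z₀}) :=
      (isCompact_closedBall _ _).inter_right
        (isClosed_le continuous_const (continuous_id.dist continuous_const))
    have hsc : ContinuousOn φ.symm (Metric.closedBall x₀ R ∩ {x | δ / 4 * ε ≤ dist x z₀}) :=
      (continuousOn_extChartAt_symm p₀).mono (inter_subset_left.trans hRΩ)
    have h1 := hρc.comp_continuousOn hsc
    have h2 := (continuous_fdist_left hF hmin p).comp_continuousOn hsc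
    have h0 : ∀ x ∈ Metric.closedBall x₀ R ∩ {x | δ / 4 * ε ≤ dist x z₀},
        0 < |ρ (φ.symm x) + fdist F (φ.symm x) p - L| + |fdist F (φ.symm x) p - ε| := by
      intro x hx
      refine (add_nonneg (abs_nonneg _) (abs_nonneg _)).lt_of_ne' fun h0 => ?_
      have h3 := (add_eq_zero_iff_of_nonneg (abs_nonneg _) (abs_nonneg _)).1 h0
      have h4 : ρ (φ.symm x) + fdist F (φ.symm x) p - L = 0 := abs_eq_zero.1 h3.1
      have h5 : fdist F (φ.symm x) p - ε = 0 := abs_eq_zero.1 h3.2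
      -- If both defects vanish, the point lies between `K` and `p` at distance `L - ε` from `K`, so
      -- by uniqueness it is `γ (L - ε)`, contrary to its distance from `z₀`.
      have h6 := hγ.eq_of_between hF hmin hK hcut (z := φ.symm x) (by linarith)
      have h7 : fdistFrom F K (φ.symm x) = L - ε := by linarith
      rw [h7] at h6
      have h8 : x = z₀ := by
        rw [hz₀, hc]
        simp only
        rw [← h6, φ.right_inv (hRΩ hx.1)]
      have h9 : δ / 4 * ε ≤ dist x z₀ := hx.2
      rw [h8, dist_self] at h9
      have : 0 < δ / 4 * ε := by positivity
      linarith
    obtain ⟨κ, hκ, h⟩ := hT.exists_forall_le'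
      (((h1.add h2).sub (continuousOn_const (c := L))).abs.add
        (h2.sub (continuousOn_const (c := ε))).abs) h0
    exact ⟨κ, hκ, fun x hx hxz => h x ⟨hx, hxz⟩⟩
  have hcont : ContinuousAt (fun h => ρ (φ.symm (x₀ + h))) 0 := by
    have h1 : ContinuousAt φ.symm (x₀ + 0) := by
      rw [add_zero]
      exact continuousAt_extChartAt_symm'' hx₀t
    exact hρc.continuousAt.comp (ContinuousAt.comp (f := fun h => x₀ + h) h1 (by fun_prop))
  have hcont' : ∀ᶠ h in 𝓝 (0 : EuclideanSpace ℝ (Fin n)), ε < ρ (φ.symm (x₀ + h)) := by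
    refine hcont.eventually_const_lt ?_
    simp only [add_zero, hsymm]
    exact hεL
  have hsmall : ∀ r > 0, ∀ᶠ h in 𝓝 (0 : EuclideanSpace ℝ (Fin n)), ‖h‖ < r := fun r hr => by
    filter_upwards [Metric.ball_mem_nhds (0 : EuclideanSpace ℝ (Fin n)) hr] with h hh
    simpa using hh
  filter_upwards [hcont', hsmall δ' hδ', hsmall R hR, hsmall ε₂ hε₂,
    hsmall (δ / 4 * ε) (by positivity), hsmall (κ / (3 * C)) (by positivity)]
    with h hρh hhδ' hhR hhε₂ hhδ hhκ
  have hxR : x₀ + h ∈ Metric.closedBall x₀ R := by simpa using hhR.le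
  have hxt : x₀ + h ∈ φ.target := hRΩ hxR
  set q := φ.symm (x₀ + h) with hq
  have hqs : q ∈ φ.source := φ.map_target hxt
  have hφq : φ q = x₀ + h := φ.right_inv hxt
  rw [hsymm, Real.norm_eq_abs, abs_le]
  constructor
  -- Lower bound: the last arc of a shortest curve `σ` to `q` is displaced by `-h`, so that it ends
  -- at `p`.
  · obtain ⟨σ, hσ⟩ := exists_isShortest hF hmin hK hne q
    set ℓ := fdistFrom F K q with hℓ
    have hσq : σ ℓ = q := hσ.target
    have hσends := hends σ ℓ hσ.isUnitCurve hρh.le (by rw [hσq]; exact hqs)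
      (by rw [hσq, hφq]; simpa using hhε₂)
    set z := σ (ℓ - ε) with hz
    have hℓε : ℓ - ε ∈ Icc 0 ℓ := ⟨by linarith [show ε < ℓ from hρh], by linarith⟩
    have hρz : ρ z = ℓ - ε := hσ.fdistFrom_eq hF hmin hℓε
    have hdz : fdist F z q = ε := by
      have := hσ.isUnitCurve.fdist_eq hF hmin hne (hσ.fdistFrom_target hF) hℓε.1 hℓε.2 le_rfl
      rw [hσq] at this
      rw [this]; ring
    obtain ⟨hzs, hzb⟩ := hσends (ℓ - ε) ⟨le_rfl, by linarith⟩
    have hpq : fdist F p q ≤ C * ‖h‖ := by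
      have := hdist x₀ (Metric.mem_closedBall_self hR.le) (x₀ + h) hxR
      rwa [hsymm, add_sub_cancel_left] at this
    have hqp : fdist F q p ≤ C * ‖h‖ := by
      have := hdist (x₀ + h) hxR x₀ (Metric.mem_closedBall_self hR.le)
      rwa [hsymm, sub_add_cancel_left, norm_neg] at this
    -- Far from `z₀` the two defects add up to at least `κ`, while the triangle inequality bounds
    -- them by `2 C ‖h‖` and `C ‖h‖`, and `3 C ‖h‖ < κ`.
    have hzclose : dist (φ z) z₀ < δ / 4 * ε := by
      by_contra! hfar
      have h1 := hκle (φ z) (Metric.ball_subset_closedBall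
        (Metric.ball_subset_ball (min_le_right _ _) hzb)) hfar
      rw [φ.left_inv hzs, hρz] at h1
      have h2 := fdist_triangle hF hmin z q p
      have h3 := fdist_triangle hF hmin z p q
      have h4 := fdistFrom_triangle hF hmin hne p q
      have h5 := fdistFrom_triangle hF hmin hne q p
      have h6 : |fdist F z p - ε| ≤ C * ‖h‖ := by rw [abs_le]; constructor <;> linarith
      have h7 : |ℓ - ε + fdist F z p - L| ≤ 2 * (C * ‖h‖) := by
        rw [abs_le]; constructor <;> linarith
      rw [lt_div_iff₀ (by positivity)] at hhκ
      linarith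
    have hle := hvar σ ℓ hσ.isUnitCurve hρh.le (fun u hu => ⟨(hσends u hu).1,
      Metric.ball_subset_ball (min_le_left _ _) (hσends u hu).2⟩) ?_ (-h) (by rwa [norm_neg])
    · rw [← hz, hσq, hφq, add_neg_cancel_right, hsymm, norm_neg, map_neg] at hle
      have h1 := fdistFrom_triangle hF hmin hne z p
      change -(η * ‖h‖) ≤ ℓ - L - ξ h
      linarith
    · rw [hσq, hφq, ← hz]
      have h1 : x₀ + h - φ z - ε • v = h + (x₀ - z₀ - ε • v) + (z₀ - φ z) := by abel
      rw [h1]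
      rw [dist_comm, dist_eq_norm] at hzclose
      refine (norm_add₃_le).trans ?_
      linarith
  -- Upper bound: the last arc of `γ` itself is displaced by `h`.
  · have hle := hvar γ L hγu hεL.le (fun u hu => ⟨(hγends u hu).1,
      Metric.ball_subset_ball (min_le_left _ _) (hγends u hu).2⟩) ?_ h hhδ'
    · rw [hγL] at hle
      have h1 := fdistFrom_triangle hF hmin hne (γ (L - ε)) q
      have h2 : fdistFrom F K (γ (L - ε)) = L - ε := hγ.fdistFrom_eq hF hmin hLε
      have h3 : fdist F (γ (L - ε)) q ≤ ε + ξ h + η * ‖h‖ := hle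
      change ρ q - L - ξ h ≤ η * ‖h‖
      linarith
    · rw [hγL]
      refine (havg₀.trans ?_)
      have : 0 ≤ δ / 2 * ε := by positivity
      linarith

end Differentiability

end Finsler

/-! ### Tangent hyperplanes of level sets at points of differentiability. -/

namespace Finsler

section LevelSets

/-- Every vector in the kernel of the derivative at a regular point is tangent to the level set. -/
theorem exists_curve_in_levelSet {V : Type*} [NormedAddCommGroup V] [NormedSpace ℝ V] {g : V → ℝ}
    {ξ : V →L[ℝ] ℝ} {x₀ u w : V} (hg : HasFDerivAt g ξ x₀) (hc : ∀ᶠ x in 𝓝 x₀, ContinuousAt g x)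
    (hu : ξ u = 0) (hw : 0 < ξ w) :
    ∃ c : ℝ → V, HasDerivAt c u 0 ∧ c 0 = x₀ ∧ ∀ᶠ t in 𝓝 0, g (c t) = g x₀ := by
  -- The function is only differentiable at `x₀` and continuous nearby, so the implicit function
  -- theorem does not apply. Instead, at `x₀ + t u ± ε |t| w` the linear term `± ε |t| ξ w`
  -- dominates the error, and the intermediate value theorem finds a point of the level between.
  have hex : ∀ ε > 0, ∀ᶠ t in 𝓝 (0 : ℝ),
      ∃ θ : ℝ, |θ| ≤ ε * |t| ∧ g (x₀ + t • u + θ • w) = g x₀ := by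
    intro ε hε
    set B := ‖u‖ + ε * ‖w‖ + 1 with hB
    have hB0 : 0 < B := by positivity
    have hη : 0 < ε * ξ w / B := by positivity
    obtain ⟨r₁, hr₁, h₁⟩ := Metric.eventually_nhds_iff.1
      ((hasFDerivAt_iff_isLittleO_nhds_zero.1 hg).def hη)
    obtain ⟨r₂, hr₂, h₂⟩ := Metric.eventually_nhds_iff.1 hc
    have hr : 0 < min r₁ r₂ / B := div_pos (lt_min hr₁ hr₂) hB0
    filter_upwards [Metric.ball_mem_nhds (0 : ℝ) hr] with t ht
    rw [mem_ball_zero_iff, Real.norm_eq_abs, lt_div_iff₀ hB0] at ht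
    have hk : ∀ θ : ℝ, |θ| ≤ ε * |t| → ‖t • u + θ • w‖ ≤ |t| * B := by
      intro θ hθ
      calc ‖t • u + θ • w‖ ≤ |t| * ‖u‖ + |θ| * ‖w‖ := by
            refine (norm_add_le _ _).trans_eq ?_
            rw [norm_smul, norm_smul, Real.norm_eq_abs, Real.norm_eq_abs]
        _ ≤ |t| * ‖u‖ + ε * |t| * ‖w‖ := by gcongr
        _ ≤ |t| * B := by rw [hB]; linarith [abs_nonneg t]
    have hk' : ∀ θ : ℝ, |θ| ≤ ε * |t| → |g (x₀ + t • u + θ • w) - g x₀ - θ * ξ w| ≤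
        ε * |t| * ξ w := by
      intro θ hθ
      have h3 := h₁ (y := t • u + θ • w) (by
        rw [dist_zero_right]
        exact (hk θ hθ).trans_lt (ht.trans_le (min_le_left _ _)))
      rw [← add_assoc, map_add, _root_.map_smul, _root_.map_smul, hu, smul_zero, zero_add,
        smul_eq_mul, Real.norm_eq_abs] at h3
      refine h3.trans ?_
      calc ε * ξ w / B * ‖t • u + θ • w‖ ≤ ε * ξ w / B * (|t| * B) := by
            gcongr
            exact hk θ hθ
        _ = ε * |t| * ξ w := by field_simp
    have hε0 : 0 ≤ ε * |t| := by positivity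
    have hcont : ContinuousOn (fun θ : ℝ => g (x₀ + t • u + θ • w))
        (Icc (-(ε * |t|)) (ε * |t|)) := by
      intro θ hθ
      have h3 : ContinuousAt g (x₀ + t • u + θ • w) := h₂ (by
        rw [add_assoc, dist_self_add_left]
        exact (hk θ (abs_le.2 hθ)).trans_lt (ht.trans_le (min_le_right _ _)))
      exact (ContinuousAt.comp (f := fun θ : ℝ => x₀ + t • u + θ • w) h3
        (by fun_prop)).continuousWithinAt
    have h4 := intermediate_value_Icc (by linarith) hcont
    have h5 := hk' (ε * |t|) (by rw [abs_of_nonneg hε0])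
    have h6 := hk' (-(ε * |t|)) (by rw [abs_neg, abs_of_nonneg hε0])
    rw [abs_le] at h5 h6
    obtain ⟨θ, hθ, hθg⟩ := h4 (show g x₀ ∈ _ from ⟨by linarith, by linarith⟩)
    exact ⟨θ, abs_le.2 hθ, hθg⟩
  -- A correction `θ t` minimal up to `t ^ 2` beats the corrections found for every `ε` at once, so
  -- a single choice is `o(t)`. The slack `t ^ 2` is needed since the infimum may not be attained.
  have hchoice : ∀ t : ℝ, ∃ θ : ℝ, (∃ θ' : ℝ, g (x₀ + t • u + θ' • w) = g x₀) →
      g (x₀ + t • u + θ • w) = g x₀ ∧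
        ∀ θ' : ℝ, g (x₀ + t • u + θ' • w) = g x₀ → |θ| ≤ |θ'| + t ^ 2 := by
    intro t
    rcases eq_or_ne t 0 with rfl | ht
    · refine ⟨0, fun _ => ⟨by simp, fun θ' _ => ?_⟩⟩
      rw [abs_zero]
      positivity
    by_cases h : ∃ θ' : ℝ, g (x₀ + t • u + θ' • w) = g x₀
    · set Z : Set ℝ := {a | ∃ θ' : ℝ, g (x₀ + t • u + θ' • w) = g x₀ ∧ a = |θ'|} with hZ
      have hne : Z.Nonempty := ⟨_, h.choose, h.choose_spec, rfl⟩
      have hbd : BddBelow Z := ⟨0, by rintro _ ⟨θ, -, rfl⟩; exact abs_nonneg _⟩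
      have ht2 : 0 < t ^ 2 := by positivity
      obtain ⟨_, ⟨θ, hθ, rfl⟩, hlt⟩ := exists_lt_of_csInf_lt hne (lt_add_of_pos_right (sInf Z) ht2)
      refine ⟨θ, fun _ => ⟨hθ, fun θ' hθ' => ?_⟩⟩
      have := csInf_le hbd ⟨θ', hθ', rfl⟩
      linarith
    · exact ⟨0, fun h' => absurd h' h⟩
  choose θ hθ using hchoice
  have hθ0 : θ 0 = 0 := by
    have := (hθ 0 ⟨0, by simp⟩).2 0 (by simp)
    simpa using this
  have hθd : HasDerivAt θ 0 0 := by
    rw [hasDerivAt_iff_isLittleO_nhds_zero, Asymptotics.isLittleO_iff]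
    intro η hη
    filter_upwards [hex (η / 2) (half_pos hη), Metric.ball_mem_nhds (0 : ℝ) (half_pos hη)]
      with t ⟨θ', hθ', hgθ'⟩ ht
    rw [mem_ball_zero_iff, Real.norm_eq_abs] at ht
    have h1 := (hθ t ⟨θ', hgθ'⟩).2 θ' hgθ'
    rw [zero_add, hθ0, sub_zero, smul_zero, sub_zero, Real.norm_eq_abs, Real.norm_eq_abs]
    have h2 : t ^ 2 ≤ η / 2 * |t| := by
      rw [← sq_abs, sq]
      gcongr
    linarith
  refine ⟨fun t => x₀ + t • u + θ t • w, ?_, by simp [hθ0], ?_⟩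
  · have h1 := (((hasDerivAt_id (0 : ℝ)).smul_const u).const_add x₀).add (hθd.smul_const w)
    exact h1.congr_deriv (by simp)
  · filter_upwards [hex 1 one_pos] with t ⟨θ', _, hgθ'⟩
    exact (hθ t ⟨θ', hgθ'⟩).1

variable {n : ℕ} {M : Type*} [TopologicalSpace M] [ChartedSpace (EuclideanSpace ℝ (Fin n)) M]

/-- The tangent vectors at `p` which are mapped to the kernel of `ξ` by the chart at `p₀`. -/
noncomputable def chartKer (p₀ p : M) (ξ : EuclideanSpace ℝ (Fin n) →L[ℝ] ℝ) :
    Submodule ℝ (TangentSpace (𝓡 n) p) :=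
  LinearMap.ker (ξ.toLinearMap ∘ₗ (chartDeriv p₀ p).toLinearMap)

theorem mem_chartKer {p₀ p : M} {ξ : EuclideanSpace ℝ (Fin n) →L[ℝ] ℝ}
    {v : TangentSpace (𝓡 n) p} : v ∈ chartKer p₀ p ξ ↔ ξ (chartDeriv p₀ p v) = 0 :=
  LinearMap.mem_ker

variable [IsManifold (𝓡 n) ∞ M]

theorem tangentBundle_ext {p₀ : M} {z z' : TangentBundle (𝓡 n) M} (h : z.1 = z'.1)
    (hs : z.1 ∈ (extChartAt (𝓡 n) p₀).source)
    (hd : chartDeriv p₀ z.1 z.2 = chartDeriv p₀ z'.1 z'.2) : z = z' := by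
  obtain ⟨p, v⟩ := z
  obtain ⟨p', v'⟩ := z'
  obtain rfl : p = p' := h
  congr 1
  exact (chartDeriv_bijective hs).1 hd

/-- The chain rule along a curve in the level puts its velocity in the kernel; conversely,
`exists_curve_in_levelSet` realizes each kernel vector in the chart. -/
theorem mem_tangentVectors_levelSet {g : M → ℝ} (hg : Continuous g) {p₀ p : M}
    (hp : p ∈ (extChartAt (𝓡 n) p₀).source) {ξ : EuclideanSpace ℝ (Fin n) →L[ℝ] ℝ}
    (hξ : HasFDerivAt (fun x => g ((extChartAt (𝓡 n) p₀).symm x)) ξ (extChartAt (𝓡 n) p₀ p))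
    {w : EuclideanSpace ℝ (Fin n)} (hw : 0 < ξ w) (v : TangentSpace (𝓡 n) p) :
    v ∈ tangentVectors (g ⁻¹' {g p}) p ↔ ξ (chartDeriv p₀ p v) = 0 := by
  set φ := extChartAt (𝓡 n) p₀ with hφ
  constructor
  · rintro ⟨c, hc, hcS, hv⟩
    have h0 : c 0 = p := congrArg Bundle.TotalSpace.proj hv
    have h0s : c 0 ∈ φ.source := h0 ▸ hp
    have h1 := hasDerivAt_chart_comp (p₀ := p₀) hc h0s
    have h2 : chartDeriv p₀ (c 0) (mfderiv 𝓘(ℝ, ℝ) (𝓡 n) c 0 (1 : ℝ)) = chartDeriv p₀ p v :=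
      congrArg (fun z : TangentBundle (𝓡 n) M => chartDeriv p₀ z.1 z.2) hv
    rw [h2] at h1
    have h0' : HasFDerivAt (fun x => g (φ.symm x)) ξ (φ (c 0)) := by rw [h0]; exact hξ
    have h3 : HasDerivAt (fun t => g (φ.symm (φ (c t)))) (ξ (chartDeriv p₀ p v)) 0 :=
      HasFDerivAt.comp_hasDerivAt (l := fun x => g (φ.symm x)) (f := fun t => φ (c t)) (0 : ℝ)
        h0' h1
    have h4 : (fun t => g (φ.symm (φ (c t)))) =ᶠ[𝓝 0] fun _ => g p := by
      filter_upwards [hcS, hc.continuousAt ((isOpen_extChartAt_source p₀).mem_nhds h0s)]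
        with t ht hts
      rw [φ.left_inv hts]
      exact ht
    exact h3.unique ((hasDerivAt_const (0 : ℝ) (g p)).congr_of_eventuallyEq h4)
  · intro hv
    have ht := φ.map_source hp
    have hcont : ∀ᶠ x in 𝓝 (φ p), ContinuousAt (fun x => g (φ.symm x)) x := by
      filter_upwards [extChartAt_target_mem_nhds_of_mem ht] with x hx
      exact hg.continuousAt.comp (continuousAt_extChartAt_symm'' hx)
    obtain ⟨c, hc, hc0, hcS⟩ := exists_curve_in_levelSet hξ hcont hv hw
    have hct : c 0 ∈ φ.target := hc0 ▸ ht
    have hmd := mdifferentiableAt_chart_symm_comp (p₀ := p₀) hc.differentiableAt hct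
    have hb : φ.symm (c 0) = p := by rw [hc0, φ.left_inv hp]
    refine ⟨fun t => φ.symm (c t), hmd, ?_, ?_⟩
    · filter_upwards [hcS] with t ht
      rw [φ.left_inv hp] at ht
      exact ht
    · refine tangentBundle_ext (p₀ := p₀) hb (φ.map_target hct) ?_
      have h1 := hasDerivAt_chart_comp (p₀ := p₀) hmd (φ.map_target hct)
      have h2 : HasDerivAt (fun t => φ (φ.symm (c t))) (chartDeriv p₀ p v) 0 := by
        refine hc.congr_of_eventuallyEq ?_
        filter_upwards [hc.continuousAt (extChartAt_target_mem_nhds_of_mem hct)] with t ht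
        exact φ.right_inv ht
      exact h1.unique h2

/-- The chart derivative is bijective, so the pulled back functional is nonzero and its kernel has
codimension one. -/
theorem hasTangentHyperplane_levelSet {g : M → ℝ} (hg : Continuous g) {p₀ p : M}
    (hp : p ∈ (extChartAt (𝓡 n) p₀).source) {ξ : EuclideanSpace ℝ (Fin n) →L[ℝ] ℝ}
    (hξ : HasFDerivAt (fun x => g ((extChartAt (𝓡 n) p₀).symm x)) ξ (extChartAt (𝓡 n) p₀ p))
    {w : EuclideanSpace ℝ (Fin n)} (hw : 0 < ξ w) :
    HasTangentHyperplane (g ⁻¹' {g p}) p (chartKer p₀ p ξ) := by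
  constructor
  · have : FiniteDimensional ℝ (TangentSpace (𝓡 n) p) :=
      inferInstanceAs (FiniteDimensional ℝ (EuclideanSpace ℝ (Fin n)))
    have hne : ξ.toLinearMap ∘ₗ (chartDeriv p₀ p).toLinearMap ≠ 0 := by
      intro h
      obtain ⟨v, hv⟩ := (chartDeriv_bijective hp).2 w
      have h1 : ξ (chartDeriv p₀ p v) = 0 := congrArg (fun T => T v) h
      rw [hv] at h1
      exact hw.ne' h1
    have h2 := Module.Dual.finrank_ker_add_one_of_ne_zero hne
    rw [chartKer, h2]
    exact (finrank_euclideanSpace_fin (𝕜 := ℝ) (n := n))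
  · ext v
    rw [mem_tangentVectors_levelSet hg hp hξ hw, SetLike.mem_coe, mem_chartKer]

end LevelSets

end Finsler

/-! ### Legendre transformation and smoothness of solutions of the Euler-Lagrange equation. -/

namespace Finsler

section Regularity

/-- Integral curves of `C^k` vector fields are `C^{k+1}`. -/
theorem contDiffOn_of_hasDerivWithinAt_comp {W : Type*} [NormedAddCommGroup W] [NormedSpace ℝ W]
    {Z : ℝ → W} {H : W → W} {J : Set ℝ} {U : Set W} (hJ : UniqueDiffOn ℝ J) {k : ℕ}
    (hH : ContDiffOn ℝ k H U) (hZU : MapsTo Z J U)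
    (hZ : ∀ u ∈ J, HasDerivWithinAt Z (H (Z u)) J u) : ContDiffOn ℝ k Z J := by
  suffices ∀ j : ℕ, j ≤ k → ContDiffOn ℝ j Z J from this k le_rfl
  intro j
  induction j with
  | zero =>
    intro _
    exact contDiffOn_zero.2 fun u hu => (hZ u hu).continuousWithinAt
  | succ j ih =>
    intro hj
    push_cast
    rw [contDiffOn_succ_iff_derivWithin hJ]
    refine ⟨fun u hu => (hZ u hu).differentiableWithinAt, fun h => by simp at h, ?_⟩
    have h1 : ContDiffOn ℝ j (H ∘ Z) J :=
      (hH.of_le (by exact_mod_cast (Nat.le_succ j).trans hj)).comp (ih ((Nat.le_succ j).trans hj))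
        hZU
    exact h1.congr fun u hu => (hZ u hu).derivWithin (hJ u hu)

variable {V : Type*} [NormedAddCommGroup V] [NormedSpace ℝ V] [FiniteDimensional ℝ V]

namespace IsLocalFinsler

variable {Ω : Set V} {f : V → V → ℝ} (hf : IsLocalFinsler Ω f)
include hf

omit [FiniteDimensional ℝ V] in
theorem contDiffOn_fderiv : ContDiffOn ℝ ∞ (fderiv ℝ (Function.uncurry f)) (Ω ×ˢ {0}ᶜ) :=
  hf.smooth.fderiv_of_isOpen hf.isOpen_slit (by simp)

omit [FiniteDimensional ℝ V] in
theorem contDiffOn_fderiv_fibre :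
    ContDiffOn ℝ ∞ (fun z : V × V => fderiv ℝ (f z.1) z.2) (Ω ×ˢ {0}ᶜ) := by
  have h : ContDiffOn ℝ ∞ (fun z : V × V => (fderiv ℝ (Function.uncurry f) z).comp
      (ContinuousLinearMap.inr ℝ V V)) (Ω ×ˢ {0}ᶜ) :=
    hf.contDiffOn_fderiv.clm_comp contDiffOn_const
  exact h.congr fun z hz => hf.fderiv_fibre hz.1 hz.2

/-- The Legendre transformation is a local diffeomorphism. -/
theorem exists_legendre_inverse {x₀ w₀ : V} (hx₀ : x₀ ∈ Ω) (hw₀ : w₀ ≠ 0) :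
    ∃ Ψ : V × (V →L[ℝ] ℝ) → V × V,
      ContDiffAt ℝ ∞ Ψ (x₀, f x₀ w₀ • fderiv ℝ (f x₀) w₀) ∧
      ∀ᶠ z in 𝓝 (x₀, w₀), Ψ (z.1, f z.1 z.2 • fderiv ℝ (f z.1) z.2) = z := by
  set lam : V × V → (V →L[ℝ] ℝ) := fun z => f z.1 z.2 • fderiv ℝ (f z.1) z.2 with hlam
  set Φ : V × V → V × (V →L[ℝ] ℝ) := fun z => (z.1, lam z) with hΦ
  have hmem := hf.isOpen_slit.mem_nhds (show (x₀, w₀) ∈ Ω ×ˢ ({0}ᶜ : Set V) from ⟨hx₀, hw₀⟩)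
  have hlams : ContDiffAt ℝ ∞ lam (x₀, w₀) :=
    (hf.smooth.smul hf.contDiffOn_fderiv_fibre).contDiffAt hmem
  have hΦs : ContDiffAt ℝ ∞ Φ (x₀, w₀) := contDiffAt_fst.prodMk hlams
  have hlamd := (hlams.differentiableAt (by simp)).hasFDerivAt
  set lam' := fderiv ℝ lam (x₀, w₀) with hlam'
  have hΦd : HasFDerivAt Φ ((ContinuousLinearMap.fst ℝ V V).prod lam') (x₀, w₀) :=
    hasFDerivAt_fst.prodMk hlamd
  -- The fibre derivative of the Legendre map `f df` is the fundamental tensor; positive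
  -- definiteness therefore makes the full derivative, which is the identity on base points,
  -- injective.
  have hquad : ∀ b : V, fundamentalTensor (f x₀) w₀ b b = lam' (0, b) b := by
    intro b
    have h0 : HasDerivAt (fun t : ℝ => (x₀, w₀ + t • b)) (0, b) 0 := by
      have h1 : HasDerivAt (fun t : ℝ => w₀ + t • b) b 0 := by
        simpa using ((hasDerivAt_id (0 : ℝ)).smul_const b).const_add w₀
      exact (hasDerivAt_const _ _).prodMk h1
    have hne : ∀ᶠ t in 𝓝 (0 : ℝ), w₀ + t • b ≠ 0 := by
      have : ContinuousAt (fun t : ℝ => w₀ + t • b) 0 := by fun_prop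
      exact this.eventually_ne (by simpa using hw₀)
    have h1 : (fun t : ℝ => deriv (fun s : ℝ => f x₀ (w₀ + t • b + s • b) ^ 2) 0) =ᶠ[𝓝 0]
        fun t => 2 * lam (x₀, w₀ + t • b) b := by
      filter_upwards [hne] with t ht
      have h2 : HasDerivAt (fun s : ℝ => w₀ + t • b + s • b) b 0 := by
        simpa using ((hasDerivAt_id (0 : ℝ)).smul_const b).const_add (w₀ + t • b)
      have h3 : HasFDerivAt (f x₀) (fderiv ℝ (f x₀) (w₀ + t • b)) (w₀ + t • b + (0 : ℝ) • b) := by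
        rw [zero_smul, add_zero]
        exact (hf.isMinkowski x₀ hx₀).hasFDerivAt ht
      have h5 := ((h3.comp_hasDerivAt (0 : ℝ) h2).pow 2).deriv
      simp only [Function.comp_def, Pi.pow_def] at h5
      rw [h5, zero_smul, add_zero, hlam]
      simp
      ring
    have h2 : HasFDerivAt lam lam' (x₀, w₀ + (0 : ℝ) • b) := by
      rw [zero_smul, add_zero]; exact hlamd
    have h3 : HasDerivAt (fun t : ℝ => lam (x₀, w₀ + t • b)) (lam' (0, b)) 0 :=
      HasFDerivAt.comp_hasDerivAt (f := fun t : ℝ => (x₀, w₀ + t • b)) (0 : ℝ) h2 h0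
    have h4 : HasDerivAt (fun t : ℝ => 2 * lam (x₀, w₀ + t • b) b) (2 * lam' (0, b) b) 0 := by
      have := h3.clm_apply (hasDerivAt_const (0 : ℝ) b)
      simpa using this.const_mul 2
    unfold fundamentalTensor
    rw [h1.deriv_eq, h4.deriv]
    ring
  have hinj : Function.Injective ((ContinuousLinearMap.fst ℝ V V).prod lam') := by
    rw [injective_iff_map_eq_zero]
    rintro ⟨a, b⟩ hab
    have ha : a = 0 := congrArg Prod.fst hab
    subst ha
    have hb : lam' (0, b) = 0 := congrArg Prod.snd hab
    by_contra hne
    have hb0 : b ≠ 0 := fun h => hne (by rw [h]; rfl)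
    have h1 := (hf.isMinkowski x₀ hx₀).posDef w₀ hw₀ b hb0
    rw [hquad, hb] at h1
    simp at h1
  have hdim : Module.finrank ℝ (V × V) = Module.finrank ℝ (V × (V →L[ℝ] ℝ)) := by
    rw [Module.finrank_prod, Module.finrank_prod,
      ← (LinearMap.toContinuousLinearMap (𝕜 := ℝ) (E := V) (F' := ℝ)).finrank_eq]
    congr 1
    exact (Subspace.dual_finrank_eq (K := ℝ) (V := V)).symm
  let e : (V × V) ≃L[ℝ] V × (V →L[ℝ] ℝ) :=
    (LinearEquiv.ofInjectiveOfFinrankEq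
      ((ContinuousLinearMap.fst ℝ V V).prod lam').toLinearMap hinj hdim).toContinuousLinearEquiv
  have he : HasFDerivAt Φ (e : V × V →L[ℝ] V × (V →L[ℝ] ℝ)) (x₀, w₀) := by
    refine hΦd.congr_fderiv ?_
    ext z <;> rfl
  have := FiniteDimensional.complete ℝ (V × V)
  refine ⟨hΦs.localInverse he (by simp), hΦs.to_localInverse he (by simp), ?_⟩
  have h1 := hΦs.mem_toOpenPartialHomeomorph_source he (by simp)
  filter_upwards [(hΦs.toOpenPartialHomeomorph Φ he (by simp)).open_source.mem_nhds h1] with z hz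
  exact (hΦs.toOpenPartialHomeomorph Φ he (by simp)).left_inv hz

/-- Unit speed solutions of the Euler-Lagrange equation are smooth. -/
theorem contDiffOn_of_euler {c w : ℝ → V} {a b : ℝ} (hab : a < b)
    (hΩ : ∀ u ∈ Icc a b, c u ∈ Ω) (hunit : ∀ u ∈ Icc a b, f (c u) (w u) = 1)
    (hw : ContinuousOn w (Icc a b)) (hc : ∀ u ∈ Icc a b, HasDerivWithinAt c (w u) (Icc a b) u)
    (hE : ∀ u ∈ Icc a b, HasDerivWithinAt (fun u => fderiv ℝ (f (c u)) (w u))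
      ((fderiv ℝ (Function.uncurry f) (c u, w u)).comp (ContinuousLinearMap.inl ℝ V V))
      (Icc a b) u) : ContDiffOn ℝ ∞ c (Icc a b) := by
  rw [contDiffOn_infty]
  intro k u₀ hu₀
  have hx₀ := hΩ u₀ hu₀
  have hw₀ := hf.ne_zero_of_unit hx₀ (hunit u₀ hu₀)
  obtain ⟨Ψ, hΨ, hΨinv⟩ := hf.exists_legendre_inverse hx₀ hw₀
  rw [hunit u₀ hu₀, one_smul] at hΨ
  -- In position and momentum the equation is first order, `Z' = H(Z)`. At unit speed the Legendre
  -- transform `f df` is just `df`, so `Ψ` recovers the velocity from `Z` and `H` is smooth near `Z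
  -- u₀`.
  set Z : ℝ → V × (V →L[ℝ] ℝ) := fun u => (c u, fderiv ℝ (f (c u)) (w u)) with hZdef
  set H : V × (V →L[ℝ] ℝ) → V × (V →L[ℝ] ℝ) := fun z => ((Ψ z).2,
    (fderiv ℝ (Function.uncurry f) (Ψ z)).comp (ContinuousLinearMap.inl ℝ V V)) with hHdef
  have hΨ0 : Ψ (Z u₀) = (c u₀, w u₀) := by
    have := hΨinv.self_of_nhds
    simp only [hunit u₀ hu₀, one_smul] at this
    exact this
  have hmem := hf.isOpen_slit.mem_nhds
    (show (c u₀, w u₀) ∈ Ω ×ˢ ({0}ᶜ : Set V) from ⟨hx₀, hw₀⟩)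
  have hH : ContDiffAt ℝ ∞ H (Z u₀) := by
    have h1 : ContDiffAt ℝ ∞ (fun z => fderiv ℝ (Function.uncurry f) (Ψ z)) (Z u₀) := by
      refine ContDiffAt.comp (Z u₀) ?_ hΨ
      rw [hΨ0]
      exact hf.contDiffOn_fderiv.contDiffAt hmem
    exact hΨ.snd.prodMk (h1.clm_comp contDiffAt_const)
  obtain ⟨U, hU, hHU⟩ := (hH.of_le (by exact_mod_cast le_top : (k : WithTop ℕ∞) ≤ ∞)).contDiffOn
    (m := k) le_rfl (by simp)
  have hZ : ∀ u ∈ Icc a b, HasDerivWithinAt Z (w u, (fderiv ℝ (Function.uncurry f)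
      (c u, w u)).comp (ContinuousLinearMap.inl ℝ V V)) (Icc a b) u := fun u hu =>
    (hc u hu).prodMk (hE u hu)
  have hcw : ContinuousWithinAt (fun u => (c u, w u)) (Icc a b) u₀ :=
    (hc u₀ hu₀).continuousWithinAt.prodMk (hw u₀ hu₀)
  obtain ⟨r, hr, hball⟩ := Metric.mem_nhdsWithin_iff.1
    (inter_mem ((hZ u₀ hu₀).continuousWithinAt hU) (hcw hΨinv))
  set J := Icc (max a (u₀ - r / 2)) (min b (u₀ + r / 2)) with hJ
  have hJlt : max a (u₀ - r / 2) < min b (u₀ + r / 2) :=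
    max_lt (lt_min hab (by linarith [hu₀.1])) (lt_min (by linarith [hu₀.2]) (by linarith))
  have hJsub : J ⊆ Icc a b := Icc_subset_Icc (le_max_left _ _) (min_le_left _ _)
  have hJball : J ⊆ Metric.ball u₀ r ∩ Icc a b := fun u hu => by
    refine ⟨?_, hJsub hu⟩
    have h1 := (le_max_right _ _).trans hu.1
    have h2 := hu.2.trans (min_le_right _ _)
    rw [Metric.mem_ball, Real.dist_eq, abs_lt]
    constructor <;> linarith
  have hJZ : ∀ u ∈ J, HasDerivWithinAt Z (H (Z u)) J u := by
    intro u hu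
    have h1 : Ψ (c u, f (c u) (w u) • fderiv ℝ (f (c u)) (w u)) = (c u, w u) :=
      (hball (hJball hu)).2
    rw [hunit u (hJsub hu), one_smul] at h1
    have h2 := (hZ u (hJsub hu)).mono hJsub
    simp only [hHdef, hZdef, h1]
    exact h2
  have hZk := contDiffOn_of_hasDerivWithinAt_comp (uniqueDiffOn_Icc hJlt) hHU
    (fun u hu => (hball (hJball hu)).1) hJZ
  have hu₀J : u₀ ∈ J := ⟨max_le hu₀.1 (by linarith), le_min hu₀.2 (by linarith)⟩
  have hck : ContDiffWithinAt ℝ k c J u₀ := (hZk u₀ hu₀J).fst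
  refine hck.mono_of_mem_nhdsWithin ?_
  refine Metric.mem_nhdsWithin_iff.2 ⟨r / 2, half_pos hr, fun u hu => ?_⟩
  have h1 := hu.1
  rw [Metric.mem_ball, Real.dist_eq, abs_lt] at h1
  exact ⟨max_le hu.2.1 (by linarith), le_min hu.2.2 (by linarith)⟩

end IsLocalFinsler

end Regularity

end Finsler

/-! ### Rays: velocity dual to the derivative of the distance, Euler-Lagrange equation, smoothness.
-/

namespace Finsler

section Rays

/-- Dividing by `τ > 0` gives `A ≤ B`, dividing by `τ < 0` gives the reverse. It extracts an
equality from a minimizing property. -/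
theorem eq_of_hasDerivAt_of_le {D : ℝ → ℝ} {A B : ℝ} (hD : HasDerivAt D A 0)
    (h : ∀ η > 0, ∀ᶠ τ in 𝓝 (0 : ℝ), D τ ≤ D 0 + τ * B + η * |τ|) : A = B := by
  have key : ∀ η > 0, |A - B| ≤ 2 * η := by
    intro η hη
    have h1 := (hasDerivAt_iff_isLittleO_nhds_zero.1 hD).def hη
    obtain ⟨r, hr, hball⟩ := Metric.eventually_nhds_iff.1 (h1.and (h η hη))
    have h2 := hball (y := r / 2) (by
      rw [dist_zero_right, Real.norm_eq_abs, abs_of_pos (by linarith)]; linarith)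
    have h3 := hball (y := -(r / 2)) (by
      rw [dist_zero_right, Real.norm_eq_abs, abs_neg, abs_of_pos (by linarith)]; linarith)
    simp only [zero_add, smul_eq_mul, Real.norm_eq_abs, abs_neg, abs_of_pos (half_pos hr),
      abs_le] at h2 h3
    obtain ⟨⟨h21, -⟩, h22⟩ := h2
    obtain ⟨⟨h31, -⟩, h32⟩ := h3
    rw [abs_le]
    constructor <;> nlinarith
  by_contra hne
  have h1 : 0 < |A - B| := abs_pos.2 (sub_ne_zero.2 hne)
  have := key (|A - B| / 4) (by positivity)
  linarith

/-- Void, as the point is away from the closed interval. It allows derivatives on two adjacent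
intervals to be united at every point, not only at the common end. -/
theorem hasDerivWithinAt_Icc_of_notMem {V : Type*} [NormedAddCommGroup V] [NormedSpace ℝ V]
    {c : ℝ → V} {v : V} {a b x : ℝ} (hx : x ∉ Icc a b) : HasDerivWithinAt c v (Icc a b) x := by
  have h : 𝓝[Icc a b] x = ⊥ := by
    rw [← notMem_closure_iff_nhdsWithin_eq_bot, isClosed_Icc.closure_eq]
    exact hx
  rw [hasDerivWithinAt_iff_isLittleO, h, Asymptotics.isLittleO_iff]
  exact fun _ _ => Filter.eventually_bot

variable {n : ℕ} {M : Type*} [TopologicalSpace M] [ChartedSpace (EuclideanSpace ℝ (Fin n)) M]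
  [IsManifold (𝓡 n) ∞ M] {F : TangentBundle (𝓡 n) M → ℝ}

/-- Where `g` is differentiable with derivative dual to the unit vector `v`, the smooth unit speed
arcs along which `g` grows at unit speed have velocity `v`. -/
theorem IsFinslerStructure.hasDerivWithinAt_of_smooth (hF : IsFinslerStructure F) {g : M → ℝ}
    {γ : ℝ → M} {a b C : ℝ} {p₀ : M} (hab : a < b)
    (hγ : ContMDiffOn 𝓘(ℝ, ℝ) (𝓡 n) ∞ γ (Icc a b)) (hu : IsUnitSpeed F γ a b)
    (hs : ∀ x ∈ Icc a b, γ x ∈ (extChartAt (𝓡 n) p₀).source)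
    (hg : ∀ x ∈ Icc a b, g (γ x) = C + x) {v : ℝ → EuclideanSpace ℝ (Fin n)}
    (hv : ∀ x ∈ Icc a b, localExpr F p₀ (extChartAt (𝓡 n) p₀ (γ x)) (v x) = 1 ∧
      HasFDerivAt (fun x => g ((extChartAt (𝓡 n) p₀).symm x))
        (fderiv ℝ (localExpr F p₀ (extChartAt (𝓡 n) p₀ (γ x))) (v x))
        (extChartAt (𝓡 n) p₀ (γ x))) :
    (∀ x ∈ Icc a b, HasDerivWithinAt (fun x => extChartAt (𝓡 n) p₀ (γ x)) (v x) (Icc a b) x) ∧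
      ContinuousOn v (Icc a b) := by
  obtain ⟨hc, hunit⟩ := hF.unit_derivWithin hab hγ hu hs
  set φ := extChartAt (𝓡 n) p₀ with hφ
  set c := fun x => φ (γ x) with hcdef
  have huniq := uniqueDiffOn_Icc hab
  have hd : ∀ x ∈ Icc a b, HasDerivWithinAt c (derivWithin c (Icc a b) x) (Icc a b) x :=
    fun x hx => ((hc.differentiableOn (by simp)) x hx).hasDerivWithinAt
  have heq : ∀ x ∈ Icc a b, derivWithin c (Icc a b) x = v x := by
    intro x hx
    obtain ⟨hv1, hvd⟩ := hv x hx
    have h1 : HasDerivWithinAt (fun y => g (φ.symm (c y)))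
        (fderiv ℝ (localExpr F p₀ (φ (γ x))) (v x) (derivWithin c (Icc a b) x)) (Icc a b) x :=
      HasFDerivAt.comp_hasDerivWithinAt (l := fun y => g (φ.symm y)) (f := c) x hvd (hd x hx)
    have h2 : HasDerivWithinAt (fun y => g (φ.symm (c y))) 1 (Icc a b) x := by
      refine (((hasDerivAt_id x).const_add C).hasDerivWithinAt).congr (fun y hy => ?_) ?_
      · simp only [hcdef, φ.left_inv (hs y hy), hg y hy, id]
      · simp only [hcdef, φ.left_inv (hs x hx), hg x hx, id]
    -- Differentiating `g (γ x) = C + x` shows that the dual of `v x` takes the value `1` on the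
    -- unit velocity; the equality case of the fundamental inequality identifies the two.
    have h3 := (huniq x hx).eq_deriv _ h1 h2
    exact ((hF.isLocalFinsler p₀).isMinkowski _ (φ.map_source (hs x hx))).eq_of_fderiv_eq_one hv1
      (hunit x hx) h3
  refine ⟨fun x hx => heq x hx ▸ hd x hx, ?_⟩
  exact (hc.continuousOn_derivWithin huniq (by simp)).congr fun x hx => (heq x hx).symm

/-- The Euler-Lagrange equation in integrated form. -/
theorem IsUnitCurve.euler_lagrange (hF : IsFinslerStructure F) (hmin : HasShortestCurves F)
    {K : Set M} (hne : K.Nonempty) {γ : ℝ → M} {ℓ a b : ℝ} {p₀ : M} (h : IsUnitCurve F γ ℓ)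
    (ha : 0 ≤ a) (hab : a ≤ b) (hb : b ≤ ℓ)
    (hs : ∀ x ∈ Icc a b, γ x ∈ (extChartAt (𝓡 n) p₀).source)
    {R : ℝ} {x₀ : EuclideanSpace ℝ (Fin n)}
    (hR : ∀ x ∈ Icc a b, extChartAt (𝓡 n) p₀ (γ x) ∈ Metric.closedBall x₀ R)
    (hexp : ∀ η > 0, ∃ r > 0, ∀ x ∈ Metric.closedBall x₀ R, ∀ w, localExpr F p₀ x w = 1 →
      ∀ k : EuclideanSpace ℝ (Fin n) × EuclideanSpace ℝ (Fin n), ‖k‖ < r →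
      x + k.1 ∈ (extChartAt (𝓡 n) p₀).target ∧ localExpr F p₀ (x + k.1) (w + k.2) ≤
        1 + fderiv ℝ (Function.uncurry (localExpr F p₀)) (x, w) k + η * ‖k‖)
    (hρ : fdistFrom F K (γ b) = fdistFrom F K (γ a) + (b - a))
    {v : ℝ → EuclideanSpace ℝ (Fin n)}
    (hv : ∀ x ∈ Icc a b, localExpr F p₀ (extChartAt (𝓡 n) p₀ (γ x)) (v x) = 1 ∧
      HasFDerivAt (fun x => fdistFrom F K ((extChartAt (𝓡 n) p₀).symm x))
        (fderiv ℝ (localExpr F p₀ (extChartAt (𝓡 n) p₀ (γ x))) (v x))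
        (extChartAt (𝓡 n) p₀ (γ x)))
    (hcd : ∀ x ∈ Icc a b,
      HasDerivWithinAt (fun x => extChartAt (𝓡 n) p₀ (γ x)) (v x) (Icc a b) x)
    {G : ℝ → EuclideanSpace ℝ (Fin n) →L[ℝ] ℝ} (hGc : ContinuousOn G (Icc a b))
    (hG : ∀ x ∈ Icc a b, G x = (fderiv ℝ (Function.uncurry (localExpr F p₀))
      (extChartAt (𝓡 n) p₀ (γ x), v x)).comp (ContinuousLinearMap.inl ℝ _ _)) :
    fderiv ℝ (localExpr F p₀ (extChartAt (𝓡 n) p₀ (γ b))) (v b) -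
      fderiv ℝ (localExpr F p₀ (extChartAt (𝓡 n) p₀ (γ a))) (v a) = ∫ x in a..b, G x := by
  set φ := extChartAt (𝓡 n) p₀ with hφ
  set c := fun x => φ (γ x) with hcdef
  have hGi : IntervalIntegrable G volume a b :=
    (hGc.mono (uIcc_of_le hab).subset).intervalIntegrable
  ext e
  rw [ContinuousLinearMap.intervalIntegral_apply hGi, _root_.sub_apply]
  have hGe : IntervalIntegrable (fun x => G x e) volume a b :=
    ((hGc.clm_apply continuousOn_const).mono (uIcc_of_le hab).subset).intervalIntegrable
  set g := fun x => fdistFrom F K (φ.symm x) with hg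
  have haI : a ∈ Icc a b := ⟨le_rfl, hab⟩
  have hbI : b ∈ Icc a b := ⟨hab, le_rfl⟩
  have hgd : ∀ x ∈ Icc a b, HasDerivAt (fun τ : ℝ => g (c x + τ • e))
      (fderiv ℝ (localExpr F p₀ (φ (γ x))) (v x) e) 0 := by
    intro x hx
    have h1 : HasDerivAt (fun τ : ℝ => c x + τ • e) e 0 := by
      simpa using ((hasDerivAt_id (0 : ℝ)).smul_const e).const_add (c x)
    have h2 : HasFDerivAt g (fderiv ℝ (localExpr F p₀ (φ (γ x))) (v x)) (c x + (0 : ℝ) • e) := by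
      rw [zero_smul, add_zero]
      exact (hv x hx).2
    exact HasFDerivAt.comp_hasDerivAt (f := fun τ : ℝ => c x + τ • e) (0 : ℝ) h2 h1
  -- The arc is translated by `τ e` in the chart. The increase of the distance from `K` between the
  -- translated ends is at most the translated length, with equality at `τ = 0`, so the two
  -- derivatives in `τ` agree. Translation leaves the velocity unchanged, so no derivative of `v` is
  -- required.
  refine eq_of_hasDerivAt_of_le ((hgd b hbI).sub (hgd a haI)) fun η hη => ?_
  have hη' : 0 < η / ((‖e‖ + 1) * (b - a + 1)) := by
    have : 0 ≤ b - a := by linarith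
    positivity
  obtain ⟨r, hr, hexp⟩ := hexp _ hη'
  obtain ⟨P, hP, hPd⟩ := h.exists_chart (p₀ := p₀) ha hb hs
  have hr' : 0 < r / (‖e‖ + 1) := by positivity
  filter_upwards [Metric.ball_mem_nhds (0 : ℝ) hr'] with τ hτ
  rw [mem_ball_zero_iff, Real.norm_eq_abs, lt_div_iff₀ (by positivity)] at hτ
  have hk : ‖((τ • e, 0) : EuclideanSpace ℝ (Fin n) × EuclideanSpace ℝ (Fin n))‖ ≤
      |τ| * (‖e‖ + 1) := by
    rw [Prod.norm_def, norm_zero, max_eq_left (norm_nonneg _), norm_smul, Real.norm_eq_abs]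
    gcongr
    linarith
  have hex : ∀ x ∈ Icc a b, c x + τ • e ∈ φ.target ∧ localExpr F p₀ (c x + τ • e) (v x) ≤
      1 + τ * G x e + η / (b - a + 1) * |τ| := by
    intro x hx
    obtain ⟨h1, h2⟩ := hexp _ (hR x hx) _ (hv x hx).1 (τ • e, 0) (hk.trans_lt hτ)
    refine ⟨h1, ?_⟩
    rw [add_zero] at h2
    refine h2.trans ?_
    have h3 : fderiv ℝ (Function.uncurry (localExpr F p₀)) (φ (γ x), v x) (τ • e, 0) =
        τ * G x e := by
      rw [hG x hx, ContinuousLinearMap.comp_apply, ContinuousLinearMap.inl_apply, ← smul_eq_mul,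
        ← _root_.map_smul, Prod.smul_mk, smul_zero]
    rw [h3]
    have h4 : η / ((‖e‖ + 1) * (b - a + 1)) * (|τ| * (‖e‖ + 1)) = η / (b - a + 1) * |τ| := by
      have h5 : ‖e‖ + 1 ≠ 0 := by positivity
      have h6 : b - a + 1 ≠ 0 := by linarith
      field_simp
    have h5 := mul_le_mul_of_nonneg_left hk hη'.le
    rw [h4] at h5
    linarith
  have hPτ : PiecewiseContDiff (fun x => c x + τ • e) P a b :=
    ⟨hP.1.add continuousOn_const, fun a' b' h1 h2 h3 h4 =>
      (hP.2 a' b' h1 h2 h3 h4).add contDiffOn_const⟩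
  have hle := fdist_le_integral hF (p₀ := p₀) hab hPτ fun x hx => (hex x hx).1
  have htri := fdistFrom_triangle hF hmin hne (φ.symm (c a + τ • e)) (φ.symm (c b + τ • e))
  have hint : ∫ x in a..b, localExpr F p₀ (c x + τ • e) (deriv (fun x => c x + τ • e) x) ≤
      ∫ x in a..b, (1 + τ * G x e + η / (b - a + 1) * |τ|) := by
    have hgi : IntervalIntegrable (fun x => 1 + τ * G x e + η / (b - a + 1) * |τ|) volume a b :=
      (intervalIntegrable_const.add (hGe.const_mul τ)).add intervalIntegrable_const
    rw [intervalIntegral.integral_of_le hab, intervalIntegral.integral_of_le hab]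
    refine integral_mono_of_nonneg (Eventually.of_forall fun x => hF.nonneg _) hgi.1
      (ae_restrict_Ioc_of_forall_notMem ∅ fun x hx _ => ?_)
    have hxI := Ioo_subset_Icc_self hx
    have h1 : HasDerivAt (fun x => c x + τ • e) (v x) x :=
      ((hcd x hxI).hasDerivAt (Icc_mem_nhds hx.1 hx.2)).add_const _
    simp only [h1.deriv]
    exact (hex x hxI).2
  have hval : ∫ x in a..b, (1 + τ * G x e + η / (b - a + 1) * |τ|) =
      (b - a) + τ * (∫ x in a..b, G x e) + (b - a) * (η / (b - a + 1) * |τ|) := by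
    rw [intervalIntegral.integral_add (intervalIntegrable_const.add (hGe.const_mul τ))
      intervalIntegrable_const, intervalIntegral.integral_add intervalIntegrable_const
      (hGe.const_mul τ), intervalIntegral.integral_const, intervalIntegral.integral_const,
      intervalIntegral.integral_const_mul, smul_eq_mul, smul_eq_mul, mul_one]
  have hbound : (b - a) * (η / (b - a + 1) * |τ|) ≤ η * |τ| := by
    have h6 : 0 < b - a + 1 := by linarith
    rw [← mul_assoc]
    gcongr
    rw [mul_div_assoc', div_le_iff₀ h6]
    nlinarith
  have h0 : g (c b + (0 : ℝ) • e) - g (c a + (0 : ℝ) • e) = b - a := by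
    simp only [zero_smul, add_zero, hg, hcdef, φ.left_inv (hs b hbI), φ.left_inv (hs a haI), hρ]
    ring
  simp only [Pi.sub_apply, h0]
  simp only [hg]
  linarith

/-- Along a unit speed curve on which the distance from `K` grows at unit speed, off the cut locus
of `K`: the velocity is dual to the derivative of the distance, and the curve is smooth. -/
theorem IsUnitCurve.exists_ray_velocity [T2Space M] (hF : IsFinslerStructure F)
    (hmin : HasShortestCurves F) {K : Set M} (hK : IsCompact K) (hne : K.Nonempty) {γ : ℝ → M}
    {ℓ : ℝ} (h : IsUnitCurve F γ ℓ) (hℓ : 0 < ℓ)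
    (hρ : fdistFrom F K (γ ℓ) = fdistFrom F K (γ 0) + ℓ)
    (hcut : ∀ u ∈ Icc 0 ℓ, γ u ∉ cutLocus F K) (hpos : ∀ u ∈ Icc 0 ℓ, 0 < fdistFrom F K (γ u))
    {p₀ : M} {u₀ : ℝ} (hu₀ : u₀ ∈ Icc 0 ℓ) (hs₀ : γ u₀ ∈ (extChartAt (𝓡 n) p₀).source) :
    ∃ v : EuclideanSpace ℝ (Fin n), localExpr F p₀ (extChartAt (𝓡 n) p₀ (γ u₀)) v = 1 ∧
      HasFDerivAt (fun x => fdistFrom F K ((extChartAt (𝓡 n) p₀).symm x))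
        (fderiv ℝ (localExpr F p₀ (extChartAt (𝓡 n) p₀ (γ u₀))) v)
        (extChartAt (𝓡 n) p₀ (γ u₀)) ∧
      HasDerivWithinAt (fun u => extChartAt (𝓡 n) p₀ (γ u)) v (Icc 0 ℓ) u₀ ∧
      ContDiffWithinAt ℝ ∞ (fun u => extChartAt (𝓡 n) p₀ (γ u)) (Icc 0 ℓ) u₀ := by
  set φ := extChartAt (𝓡 n) p₀ with hφ
  set c := fun u => φ (γ u) with hc
  have hf := hF.isLocalFinsler p₀
  obtain ⟨R, hR, -, -, hRΩ, -, hexp⟩ := hf.exists_uniform_expansion (φ.map_source hs₀)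
  have hgrow : ∀ u ∈ Icc 0 ℓ, fdistFrom F K (γ u) = fdistFrom F K (γ 0) + u := fun u hu =>
    h.fdistFrom_eq hF hmin hne hρ hu
  have hex : ∀ u, ∃ v : EuclideanSpace ℝ (Fin n), u ∈ Icc 0 ℓ → γ u ∈ φ.source →
      localExpr F p₀ (φ (γ u)) v = 1 ∧ HasFDerivAt (fun x => fdistFrom F K (φ.symm x))
        (fderiv ℝ (localExpr F p₀ (φ (γ u))) v) (φ (γ u)) := by
    intro u
    by_cases hu : u ∈ Icc 0 ℓ ∧ γ u ∈ φ.source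
    · obtain ⟨v, hv⟩ := exists_hasFDerivAt_fdistFrom hF hmin hK hne hu.2 (hcut u hu.1)
        (hpos u hu.1)
      exact ⟨v, fun _ _ => hv⟩
    · exact ⟨0, fun h1 h2 => absurd ⟨h1, h2⟩ hu⟩
  choose v hv using hex
  -- a neighbourhood of `u₀` on which the curve stays in the chart, with at most one corner
  have hnear : {u | γ u ∈ φ.source ∧ φ (γ u) ∈ Metric.closedBall (φ (γ u₀)) R} ∈
      𝓝[Icc 0 ℓ] u₀ := by
    have h1 := h.piecewiseSmooth.1 u₀ hu₀
    exact inter_mem (h1 ((isOpen_extChartAt_source p₀).mem_nhds hs₀))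
      (((continuousAt_extChartAt' hs₀).comp_continuousWithinAt h1)
        (Metric.closedBall_mem_nhds _ hR))
  obtain ⟨r₁, hr₁, hball⟩ := Metric.mem_nhdsWithin_iff.1 hnear
  obtain ⟨a, ha0, hau, haR, hasm⟩ : ∃ a, 0 ≤ a ∧ a ≤ u₀ ∧ u₀ - a < r₁ ∧ ((a < u₀ ∧
      ContMDiffOn 𝓘(ℝ, ℝ) (𝓡 n) ∞ γ (Icc a u₀)) ∨ (a = u₀ ∧ u₀ = 0)) := by
    rcases hu₀.1.eq_or_lt with h0 | h0
    · exact ⟨u₀, hu₀.1, le_rfl, by linarith, Or.inr ⟨rfl, h0.symm⟩⟩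
    · obtain ⟨ε, hε, hε0, hsm⟩ := h.piecewiseSmooth.exists_left h0 hu₀.2
      have h1 : min ε (r₁ / 2) ≤ ε := min_le_left _ _
      have h2 : min ε (r₁ / 2) ≤ r₁ / 2 := min_le_right _ _
      have h3 : 0 < min ε (r₁ / 2) := lt_min hε (by linarith)
      exact ⟨u₀ - min ε (r₁ / 2), by linarith, by linarith, by linarith,
        Or.inl ⟨by linarith, hsm.mono (Icc_subset_Icc (by linarith) le_rfl)⟩⟩
  obtain ⟨b, hbℓ, hub, hbR, hbsm⟩ : ∃ b, b ≤ ℓ ∧ u₀ ≤ b ∧ b - u₀ < r₁ ∧ ((u₀ < b ∧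
      ContMDiffOn 𝓘(ℝ, ℝ) (𝓡 n) ∞ γ (Icc u₀ b)) ∨ (b = u₀ ∧ u₀ = ℓ)) := by
    rcases hu₀.2.eq_or_lt with h0 | h0
    · exact ⟨u₀, hu₀.2, le_rfl, by linarith, Or.inr ⟨rfl, h0⟩⟩
    · obtain ⟨ε, hε, hε0, hsm⟩ := h.piecewiseSmooth.exists_right hu₀.1 h0
      have h1 : min ε (r₁ / 2) ≤ ε := min_le_left _ _
      have h2 : min ε (r₁ / 2) ≤ r₁ / 2 := min_le_right _ _
      have h3 : 0 < min ε (r₁ / 2) := lt_min hε (by linarith)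
      exact ⟨u₀ + min ε (r₁ / 2), by linarith, by linarith, by linarith,
        Or.inl ⟨by linarith, hsm.mono (Icc_subset_Icc le_rfl (by linarith))⟩⟩
  have hab : a < b := by
    rcases hasm with ⟨h1, -⟩ | ⟨h1, h2⟩
    · linarith
    · rcases hbsm with ⟨h3, -⟩ | ⟨h3, h4⟩ <;> linarith
  have hsubℓ : Icc a b ⊆ Icc 0 ℓ := Icc_subset_Icc ha0 hbℓ
  have hin : ∀ u ∈ Icc a b, γ u ∈ φ.source ∧ φ (γ u) ∈ Metric.closedBall (φ (γ u₀)) R := by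
    intro u hu
    refine hball ⟨?_, hsubℓ hu⟩
    rw [Metric.mem_ball, Real.dist_eq, abs_lt]
    constructor <;> linarith [hu.1, hu.2]
  have hvI : ∀ u ∈ Icc a b, localExpr F p₀ (φ (γ u)) (v u) = 1 ∧
      HasFDerivAt (fun x => fdistFrom F K (φ.symm x))
        (fderiv ℝ (localExpr F p₀ (φ (γ u))) (v u)) (φ (γ u)) := fun u hu =>
    hv u (hsubℓ hu) (hin u hu).1
  -- The vector `v u` is fixed by the derivative of the distance at `γ u`, so the one-sided
  -- velocities on both sides of `u₀` are the same `v u₀` and there is no corner. The case `a' = b'`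
  -- serves an endpoint `u₀` of the whole interval.
  have hpiece : ∀ a' b', a ≤ a' → a' ≤ b' → b' ≤ b → ((a' < b' ∧
      ContMDiffOn 𝓘(ℝ, ℝ) (𝓡 n) ∞ γ (Icc a' b')) ∨ a' = b') →
      (∀ u, HasDerivWithinAt c (v u) (Icc a' b') u) ∧ ContinuousOn v (Icc a' b') := by
    rintro a' b' h1 h2 h3 (⟨hlt, hsm⟩ | rfl)
    · have hsub : Icc a' b' ⊆ Icc a b := Icc_subset_Icc h1 h3
      obtain ⟨h4, h5⟩ := hF.hasDerivWithinAt_of_smooth (p₀ := p₀) (g := fdistFrom F K)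
        (v := v) hlt hsm
        (fun x hx => h.unitSpeed x ⟨by linarith [hx.1], by linarith [hx.2]⟩)
        (fun x hx => (hin x (hsub hx)).1) (fun x hx => hgrow x (hsubℓ (hsub hx)))
        fun x hx => hvI x (hsub hx)
      refine ⟨fun u => ?_, h5⟩
      by_cases hu : u ∈ Icc a' b'
      · exact h4 u hu
      · exact hasDerivWithinAt_Icc_of_notMem hu
    · rw [Icc_self]
      refine ⟨fun u => ?_, continuousOn_singleton _ _⟩
      by_cases hu : u = a'
      · subst hu
        rw [hasDerivWithinAt_iff_isLittleO, nhdsWithin_singleton]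
        simp
      · rw [← Icc_self]
        exact hasDerivWithinAt_Icc_of_notMem (by simpa using hu)
  obtain ⟨hdl, hcl⟩ := hpiece a u₀ le_rfl hau hub (hasm.imp id fun h => h.1)
  obtain ⟨hdr, hcr⟩ := hpiece u₀ b hau hub le_rfl (hbsm.imp id fun h => h.1.symm)
  have hcd : ∀ u ∈ Icc a b, HasDerivWithinAt c (v u) (Icc a b) u := fun u _ => by
    rw [← Icc_union_Icc_eq_Icc hau hub]
    exact (hdl u).union (hdr u)
  have hvc : ContinuousOn v (Icc a b) := by
    rw [← Icc_union_Icc_eq_Icc hau hub]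
    exact hcl.union_of_isClosed hcr isClosed_Icc isClosed_Icc
  have hcc : ContinuousOn c (Icc a b) := fun u hu => (hcd u hu).continuousWithinAt
  have hcΩ : ∀ u ∈ Icc a b, c u ∈ φ.target := fun u hu => φ.map_source (hin u hu).1
  set G : ℝ → EuclideanSpace ℝ (Fin n) →L[ℝ] ℝ := fun u =>
    (fderiv ℝ (Function.uncurry (localExpr F p₀)) (c u, v u)).comp
      (ContinuousLinearMap.inl ℝ _ _) with hG
  have hGc : ContinuousOn G (Icc a b) := by
    refine ContinuousOn.clm_comp ?_ continuousOn_const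
    exact hf.continuousOn_fderiv.comp (hcc.prodMk hvc) fun u hu =>
      ⟨hcΩ u hu, hf.ne_zero_of_unit (hcΩ u hu) (hvI u hu).1⟩
  set ξ : ℝ → EuclideanSpace ℝ (Fin n) →L[ℝ] ℝ := fun u =>
    fderiv ℝ (localExpr F p₀ (c u)) (v u) with hξ
  have hEL : ∀ u ∈ Icc a b, ξ u - ξ a = ∫ x in a..u, G x := by
    intro u hu
    have hsub : Icc a u ⊆ Icc a b := Icc_subset_Icc le_rfl hu.2
    refine h.euler_lagrange hF hmin hne (x₀ := φ (γ u₀)) (R := R) ha0 hu.1 (hu.2.trans hbℓ)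
      (fun x hx => (hin x (hsub hx)).1) (fun x hx => (hin x (hsub hx)).2) hexp ?_
      (fun x hx => hvI x (hsub hx)) (fun x hx => (hcd x (hsub hx)).mono hsub) (hGc.mono hsub)
      fun x hx => rfl
    rw [hgrow u (hsubℓ hu), hgrow a (hsubℓ ⟨le_rfl, hab.le⟩)]
    ring
  have hξd : ∀ u ∈ Icc a b, HasDerivWithinAt ξ (G u) (Icc a b) u := by
    intro u hu
    -- A continuous extension of `G` to the line, so that the fundamental theorem of calculus also
    -- applies at the ends.
    set G' := IccExtend hab.le ((Icc a b).domRestrict G) with hG'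
    have hG'c : Continuous G' := (continuousOn_iff_continuous_domRestrict.1 hGc).Icc_extend'
    have hGG' : EqOn G' G (Icc a b) := fun x hx => IccExtend_of_mem hab.le _ hx
    have h1 : HasDerivAt (fun x => ∫ y in a..x, G' y) (G' u) u :=
      (hG'c.integral_hasStrictDerivAt a u).hasDerivAt
    rw [hGG' hu] at h1
    have h2 : ∀ x ∈ Icc a b, ξ x = ξ a + ∫ y in a..x, G' y := by
      intro x hx
      rw [← sub_eq_iff_eq_add', hEL x hx]
      refine intervalIntegral.integral_congr fun y hy => ?_
      rw [uIcc_of_le hx.1] at hy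
      exact (hGG' ⟨hy.1, hy.2.trans hx.2⟩).symm
    exact (h1.const_add (ξ a)).hasDerivWithinAt.congr h2 (h2 u hu)
  have hsm := hf.contDiffOn_of_euler hab hcΩ (fun u hu => (hvI u hu).1) hvc hcd hξd
  have hu₀I : u₀ ∈ Icc a b := ⟨hau, hub⟩
  have hnhds : Icc a b ∈ 𝓝[Icc 0 ℓ] u₀ := by
    have hal : ∀ᶠ u in 𝓝[Icc 0 ℓ] u₀, a ≤ u := by
      rcases hasm with ⟨h1, -⟩ | ⟨h1, h2⟩
      · filter_upwards [mem_nhdsWithin_of_mem_nhds (lt_mem_nhds h1)] with u hu using hu.le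
      · filter_upwards [self_mem_nhdsWithin] with u hu
        linarith [hu.1]
    have hbl : ∀ᶠ u in 𝓝[Icc 0 ℓ] u₀, u ≤ b := by
      rcases hbsm with ⟨h1, -⟩ | ⟨h1, h2⟩
      · filter_upwards [mem_nhdsWithin_of_mem_nhds (gt_mem_nhds h1)] with u hu using hu.le
      · filter_upwards [self_mem_nhdsWithin] with u hu
        linarith [hu.2]
    filter_upwards [hal, hbl] with u h1 h2 using ⟨h1, h2⟩
  exact ⟨v u₀, (hvI u₀ hu₀I).1, (hvI u₀ hu₀I).2, (hcd u₀ hu₀I).mono_of_mem_nhdsWithin hnhds,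
    (hsm u₀ hu₀I).mono_of_mem_nhdsWithin hnhds⟩

end Rays

end Finsler

/-! ### Wavefronts, envelopes and orthogonality of rays. -/

namespace Finsler

section Wavefronts

variable {n : ℕ} {M : Type*} [TopologicalSpace M] [ChartedSpace (EuclideanSpace ℝ (Fin n)) M]
  [IsManifold (𝓡 n) ∞ M] {F : TangentBundle (𝓡 n) M → ℝ}

omit [IsManifold (𝓡 n) ∞ M] in
-- For empty `K` the infimum has the default value `0`.
theorem nonempty_of_fdistFrom_pos {K : Set M} {q : M} (h : 0 < fdistFrom F K q) : K.Nonempty := by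
  rw [nonempty_iff_ne_empty]
  rintro rfl
  simp [fdistFrom] at h

/-- A point at distance at least `t₀` from `K` is reached by a unit speed curve which starts on the
level `t₀` and along which the distance from `K` grows at unit speed. -/
theorem exists_unitCurve_from_level (hF : IsFinslerStructure F) (hmin : HasShortestCurves F)
    {K : Set M} (hK : IsCompact K) (hne : K.Nonempty) {t₀ : ℝ} (ht₀ : 0 ≤ t₀) {p : M}
    (hp : t₀ ≤ fdistFrom F K p) : ∃ γ : ℝ → M, IsUnitCurve F γ (fdistFrom F K p - t₀) ∧
      fdistFrom F K (γ 0) = t₀ ∧ γ (fdistFrom F K p - t₀) = p := by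
  obtain ⟨γ, h⟩ := exists_isShortest hF hmin hK hne p
  refine ⟨_, h.isUnitCurve.segment ht₀ hp le_rfl, ?_, ?_⟩
  · rw [zero_add]
    exact h.fdistFrom_eq hF hmin ⟨ht₀, hp⟩
  · rw [sub_add_cancel]
    exact h.target

theorem sub_le_fdist_of_level (hF : IsFinslerStructure F) (hmin : HasShortestCurves F)
    {K : Set M} (hne : K.Nonempty) {t₀ : ℝ} {p q : M} (hq : q ∈ fdistFrom F K ⁻¹' {t₀}) :
    fdistFrom F K p - t₀ ≤ fdist F q p := by
  have h := fdistFrom_triangle hF hmin hne q p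
  rw [mem_preimage, mem_singleton_iff] at hq
  linarith

theorem exists_fdist_eq_of_level (hF : IsFinslerStructure F) (hmin : HasShortestCurves F)
    {K : Set M} (hK : IsCompact K) (hne : K.Nonempty) {t₀ : ℝ} (ht₀ : 0 ≤ t₀) {p : M}
    (hp : t₀ ≤ fdistFrom F K p) :
    ∃ q ∈ fdistFrom F K ⁻¹' {t₀}, fdist F q p = fdistFrom F K p - t₀ := by
  obtain ⟨γ, h, h0, hℓ⟩ := exists_unitCurve_from_level hF hmin hK hne ht₀ hp
  refine ⟨γ 0, h0, le_antisymm ?_ (sub_le_fdist_of_level hF hmin hne h0)⟩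
  have h1 := h.fdist_le hF le_rfl h.nonneg le_rfl
  rwa [hℓ, sub_zero] at h1

/-- The distance from a level set of the distance from `K`. -/
theorem fdistFrom_level (hF : IsFinslerStructure F) (hmin : HasShortestCurves F) {K : Set M}
    (hK : IsCompact K) (hne : K.Nonempty) {t₀ : ℝ} (ht₀ : 0 ≤ t₀) {p : M}
    (hp : t₀ ≤ fdistFrom F K p) :
    fdistFrom F (fdistFrom F K ⁻¹' {t₀}) p = fdistFrom F K p - t₀ := by
  obtain ⟨q, hq, hqp⟩ := exists_fdist_eq_of_level hF hmin hK hne ht₀ hp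
  exact ((fdistFrom_le hF hq p).trans_eq hqp).antisymm
    (le_fdistFrom ⟨q, hq⟩ fun _ ha => sub_le_fdist_of_level hF hmin hne ha)

/-- The distance from the level `t₀` is computed by `fdistFrom_level` only where the distance from
`K` is at least `t₀`; removing the swept region selects exactly these points. -/
theorem wavefront_level (hF : IsFinslerStructure F) (hmin : HasShortestCurves F) {K : Set M}
    (hK : IsCompact K) (hne : K.Nonempty) {t₀ t : ℝ} (ht₀ : 0 ≤ t₀) (ht : t₀ ≤ t) :
    wavefront F (fdistFrom F K ⁻¹' Iio t₀) (fdistFrom F K ⁻¹' {t₀}) (t - t₀) =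
      fdistFrom F K ⁻¹' {t} := by
  ext p
  simp only [wavefront, mem_ofPred_eq, mem_preimage, mem_Iio, not_lt, mem_singleton_iff]
  constructor
  · rintro ⟨h1, h2⟩
    rw [fdistFrom_level hF hmin hK hne ht₀ h1] at h2
    linarith
  · intro h
    have h1 : t₀ ≤ fdistFrom F K p := h ▸ ht
    exact ⟨h1, by rw [fdistFrom_level hF hmin hK hne ht₀ h1, h]⟩

omit [IsManifold (𝓡 n) ∞ M] in
theorem wavefront_singleton (q : M) (τ : ℝ) :
    wavefront F ∅ {q} τ = fdistFrom F {q} ⁻¹' {τ} := by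
  ext p
  simp [wavefront]

/-- Outside the swept region the earliest arrival from the level `t₀` takes the time `fdistFrom F K
p - t₀`, and it is attained. Points beyond the level `t` are thus on no front at time `t - t₀`, and
points before it are reached earlier. -/
theorem level_eq_envelope_points (hF : IsFinslerStructure F) (hmin : HasShortestCurves F)
    {K : Set M} (hK : IsCompact K) (hne : K.Nonempty) {t₀ t : ℝ} (ht₀ : 0 ≤ t₀) (ht : t₀ ≤ t) :
    fdistFrom F K ⁻¹' {t} = {p | p ∉ fdistFrom F K ⁻¹' Iio t₀ ∧
      (∃ q ∈ fdistFrom F K ⁻¹' {t₀}, p ∈ wavefront F ∅ {q} (t - t₀)) ∧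
      ∀ q ∈ fdistFrom F K ⁻¹' {t₀}, ∀ τ < t - t₀, p ∉ wavefront F ∅ {q} τ} := by
  ext p
  simp only [wavefront_singleton, mem_ofPred_eq, mem_preimage (a := p), mem_Iio, not_lt,
    mem_singleton_iff, fdistFrom_singleton]
  constructor
  · rintro rfl
    exact ⟨ht, exists_fdist_eq_of_level hF hmin hK hne ht₀ ht, fun q hq τ hτ h => by
      linarith [sub_le_fdist_of_level (p := p) hF hmin hne hq]⟩
  · rintro ⟨h1, ⟨q, hq, hqp⟩, h3⟩
    obtain ⟨q', hq', hqp'⟩ := exists_fdist_eq_of_level hF hmin hK hne ht₀ h1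
    have h4 := sub_le_fdist_of_level (p := p) hF hmin hne hq
    have h5 : ¬ fdist F q' p < t - t₀ := fun h => h3 q' hq' _ h rfl
    linarith

variable [T2Space M]

theorem exists_hasTangentHyperplane (hF : IsFinslerStructure F) (hmin : HasShortestCurves F)
    {K : Set M} (hK : IsCompact K) (hne : K.Nonempty) {p : M} (hcut : p ∉ cutLocus F K)
    (hpos : 0 < fdistFrom F K p) : ∃ H : Submodule ℝ (TangentSpace (𝓡 n) p),
      HasTangentHyperplane (fdistFrom F K ⁻¹' {fdistFrom F K p}) p H := by
  have hp := mem_extChartAt_source (I := 𝓡 n) p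
  obtain ⟨v, hv, hd⟩ := exists_hasFDerivAt_fdistFrom hF hmin hK hne hp hcut hpos
  have hΩ := (extChartAt (𝓡 n) p).map_source hp
  have hN := (hF.isLocalFinsler p).isMinkowski _ hΩ
  have hv0 := (hF.isLocalFinsler p).ne_zero_of_unit hΩ hv
  refine ⟨_, hasTangentHyperplane_levelSet (continuous_fdistFrom hF hmin hne) hp hd (w := v) ?_⟩
  rw [hN.fderiv_self hv0, hv]
  exact one_pos

/-- A level of the distance from `K` is tangent at `p` to the level of the distance from a point
between `K` and `p`. -/
theorem areTangentAt_levels (hF : IsFinslerStructure F) (hmin : HasShortestCurves F)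
    {K : Set M} (hK : IsCompact K) (hne : K.Nonempty) {p q : M} (hqp : 0 < fdist F q p)
    (hbetween : fdistFrom F K q + fdist F q p = fdistFrom F K p)
    (hcut : ∀ z, fdistFrom F K z ∈ Icc (fdistFrom F K q) (fdistFrom F K p) → z ∉ cutLocus F K)
    (hpos : 0 < fdistFrom F K q) :
    AreTangentAt n (fdistFrom F {q} ⁻¹' {fdistFrom F {q} p})
      (fdistFrom F K ⁻¹' {fdistFrom F K p}) p := by
  refine ⟨rfl, rfl, ?_⟩
  obtain ⟨γ, h, h0, hℓ⟩ := hmin.exists_unitCurve q p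
  set ℓ := fdist F q p with hℓdef
  have hρ : fdistFrom F K (γ ℓ) = fdistFrom F K (γ 0) + ℓ := by rw [h0, hℓ, hbetween]
  have hgrow : ∀ u ∈ Icc 0 ℓ, fdistFrom F K (γ u) = fdistFrom F K q + u := fun u hu => by
    rw [h.fdistFrom_eq hF hmin hne hρ hu, h0]
  have hmem : ℓ ∈ Icc 0 ℓ := right_mem_Icc.2 hqp.le
  have hp : p ∈ (extChartAt (𝓡 n) p).source := mem_extChartAt_source (I := 𝓡 n) p
  obtain ⟨v, hv, hd, hγ, -⟩ := h.exists_ray_velocity hF hmin hK hne hqp hρ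
    (fun u hu => hcut _ (by rw [hgrow u hu]; exact ⟨by linarith [hu.1], by linarith [hu.2]⟩))
    (fun u hu => by rw [hgrow u hu]; linarith [hu.1]) hmem (p₀ := p) (by rwa [hℓ])
  rw [hℓ] at hv hd
  -- This makes the distance from `q` differentiable at `p` too.
  have hpcut : p ∉ cutLocus F {q} := notMem_cutLocus_singleton hF hmin hK hne
    (hcut p ⟨by linarith, le_rfl⟩) hbetween
  obtain ⟨w, hw, hdw⟩ := exists_hasFDerivAt_fdistFrom hF hmin isCompact_singleton
    (singleton_nonempty q) hp hpcut (by rwa [fdistFrom_singleton])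
  have hΩ := (extChartAt (𝓡 n) p).map_source hp
  have hN := (hF.isLocalFinsler p).isMinkowski _ hΩ
  have hs : IsShortest F {q} p γ ℓ := h.isShortest h0 hℓ (by rw [fdistFrom_singleton])
  have h1 : HasDerivWithinAt
      (fun u => fdistFrom F {q} ((extChartAt (𝓡 n) p).symm (extChartAt (𝓡 n) p (γ u))))
      (fderiv ℝ (localExpr F p (extChartAt (𝓡 n) p p)) w v) (Icc 0 ℓ) ℓ := by
    have hdw' : HasFDerivAt (fun x => fdistFrom F {q} ((extChartAt (𝓡 n) p).symm x))
        (fderiv ℝ (localExpr F p (extChartAt (𝓡 n) p p)) w) (extChartAt (𝓡 n) p (γ ℓ)) := by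
      rwa [hℓ]
    exact hdw'.comp_hasDerivWithinAt (f := fun u => extChartAt (𝓡 n) p (γ u)) ℓ hγ
  have h2 : HasDerivWithinAt (fun u : ℝ => u) (fderiv ℝ (localExpr F p (extChartAt (𝓡 n) p p)) w v)
      (Icc 0 ℓ) ℓ := by
    refine h1.congr_of_eventuallyEq_of_mem ?_ hmem
    have hsrc : ∀ᶠ u in 𝓝[Icc 0 ℓ] ℓ, γ u ∈ (extChartAt (𝓡 n) p).source :=
      (h.piecewiseSmooth.1 ℓ hmem) ((isOpen_extChartAt_source p).mem_nhds (by rwa [hℓ]))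
    filter_upwards [hsrc, self_mem_nhdsWithin] with u hu hu'
    rw [(extChartAt (𝓡 n) p).left_inv hu, hs.fdistFrom_eq hF hmin hu']
  -- The distance from `q` also grows at unit speed along `γ`, so the dual of `w` takes the value
  -- `1` on `v`. Hence `w = v`: both distances have the same derivative at `p`, and their levels the
  -- same hyperplane.
  have h3 : fderiv ℝ (localExpr F p (extChartAt (𝓡 n) p p)) w v = 1 :=
    (uniqueDiffOn_Icc hqp ℓ hmem).eq_deriv _ h2 (hasDerivWithinAt_id ℓ _)
  obtain rfl := hN.eq_of_fderiv_eq_one hw hv h3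
  have hpos' := h3.symm ▸ one_pos (α := ℝ)
  exact ⟨_, hasTangentHyperplane_levelSet
      (continuous_fdistFrom hF hmin (singleton_nonempty q)) hp hdw hpos',
    hasTangentHyperplane_levelSet (continuous_fdistFrom hF hmin hne) hp hd hpos'⟩

/-- Unit speed curves along which the distance from `K` grows by their whole length, off the cut
locus, are geodesics which cross the levels of the distance orthogonally. -/
theorem IsUnitCurve.isGeodesic_and_isOrthogonalTo (hF : IsFinslerStructure F)
    (hmin : HasShortestCurves F) {K : Set M} (hK : IsCompact K) (hne : K.Nonempty) {γ : ℝ → M}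
    {ℓ : ℝ} (h : IsUnitCurve F γ ℓ) (hℓ : 0 < ℓ)
    (hρ : fdistFrom F K (γ ℓ) = fdistFrom F K (γ 0) + ℓ)
    (hcut : ∀ u ∈ Icc 0 ℓ, γ u ∉ cutLocus F K) (hpos : ∀ u ∈ Icc 0 ℓ, 0 < fdistFrom F K (γ u)) :
    IsGeodesic F γ ℓ ∧ ∀ u ∈ Icc 0 ℓ, IsOrthogonalTo F (velocityWithin γ (Icc 0 ℓ) u)
      (fdistFrom F K ⁻¹' {fdistFrom F K (γ u)}) := by
  have hsmooth : ContMDiffOn 𝓘(ℝ, ℝ) (𝓡 n) ∞ γ (Icc 0 ℓ) := by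
    intro u hu
    obtain ⟨-, -, -, -, hs⟩ := h.exists_ray_velocity hF hmin hK hne hℓ hρ hcut hpos hu
      (p₀ := γ u) (mem_extChartAt_source (I := 𝓡 n) (γ u))
    rw [contMDiffWithinAt_iff_target]
    exact ⟨h.piecewiseSmooth.1 u hu, hs.contMDiffWithinAt⟩
  have key : ∀ u ∈ Icc 0 ℓ, ∃ v : EuclideanSpace ℝ (Fin n),
      localExpr F (γ u) (extChartAt (𝓡 n) (γ u) (γ u)) v = 1 ∧
      HasFDerivAt (fun x => fdistFrom F K ((extChartAt (𝓡 n) (γ u)).symm x))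
        (fderiv ℝ (localExpr F (γ u) (extChartAt (𝓡 n) (γ u) (γ u))) v)
        (extChartAt (𝓡 n) (γ u) (γ u)) ∧
      chartDeriv (γ u) (γ u) (mfderivWithin 𝓘(ℝ, ℝ) (𝓡 n) γ (Icc 0 ℓ) u (1 : ℝ)) = v := by
    intro u hu
    have hs := mem_extChartAt_source (I := 𝓡 n) (γ u)
    obtain ⟨v, hv, hd, hγ, -⟩ :=
      h.exists_ray_velocity hF hmin hK hne hℓ hρ hcut hpos hu (p₀ := γ u) hs
    exact ⟨v, hv, hd, (uniqueDiffOn_Icc hℓ u hu).eq_deriv _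
      (hasDerivWithinAt_chart_comp ((hsmooth u hu).mdifferentiableWithinAt (by simp)) hs) hγ⟩
  refine ⟨⟨hsmooth, fun u hu => ?_, fun u v hu huv hv => ?_⟩, fun u hu => ?_⟩
  · obtain ⟨v, hv, -, hγv⟩ := key u hu
    rw [← hγv, localExpr_chartDeriv (mem_extChartAt_source (I := 𝓡 n) (γ u))] at hv
    exact hv
  · rw [h.length_eq hu huv hv, h.fdist_eq hF hmin hne hρ hu huv hv]
  · obtain ⟨v, hv, hd, hγv⟩ := key u hu
    have hs := mem_extChartAt_source (I := 𝓡 n) (γ u)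
    have hΩ := (extChartAt (𝓡 n) (γ u)).map_source hs
    have hN := (hF.isLocalFinsler (γ u)).isMinkowski _ hΩ
    have hv0 := (hF.isLocalFinsler (γ u)).ne_zero_of_unit hΩ hv
    refine ⟨fun h0 => hv0 ?_, rfl, fun z hz => ?_⟩
    · rw [← hγv]
      exact (congrArg (chartDeriv (γ u) (γ u)) h0).trans (_root_.map_zero _)
    -- Vectors tangent to the level are annihilated by the dual of the velocity, which is `g_v(v,
    -- ·)` for a unit vector `v`.
    · have hz' := (mem_tangentVectors_levelSet (continuous_fdistFrom hF hmin hne) hs hd (w := v)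
        (by rw [hN.fderiv_self hv0, hv]; exact one_pos) z).1 hz
      have h1 := fundamentalTensor_chart (F := F) hs
        (mfderivWithin 𝓘(ℝ, ℝ) (𝓡 n) γ (Icc 0 ℓ) u (1 : ℝ))
        (mfderivWithin 𝓘(ℝ, ℝ) (𝓡 n) γ (Icc 0 ℓ) u (1 : ℝ)) z
      rw [hγv, hN.fundamentalTensor_left_self hv0, hz', mul_zero] at h1
      exact h1

end Wavefronts

end Finsler

/-! ### The theorem. -/

theorem theorem3p1 {n : ℕ} {M : Type*} [TopologicalSpace M] [T2Space M]
    [ChartedSpace (EuclideanSpace ℝ (Fin n)) M] [IsManifold (𝓡 n) ∞ M]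
    (F : TangentBundle (𝓡 n) M → ℝ) (hF : Finsler.IsFinslerStructure F)
    -- any two points are joined by a shortest unit speed curve
    (hmin : ∀ p q : M, ∃ (γ : ℝ → M) (ℓ : ℝ), Finsler.IsShortest F {p} q γ ℓ)
    (A : Set M) (hA : IsCompact A)
    (ρ : M → ℝ) (hρ : ∀ p, ρ p = Finsler.fdistFrom F A p)
    (U : Set M) (s r : ℝ) (hs : 0 < s) (hsr : s < r) (hU : ρ '' U = Icc s r)
    (hcut : ∀ p ∈ ρ ⁻¹' Icc s r, p ∉ Finsler.cutLocus F A) :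
    -- the wave with front `ρ⁻¹(s)` at time `0` has front `ρ⁻¹(t)` at time `t - s`
    (∀ t ∈ Icc s r,
      Finsler.wavefront F (ρ ⁻¹' Iio s) (ρ ⁻¹' {s}) (t - s) = ρ ⁻¹' {t}) ∧
    -- Huygens' envelope principle
    (∀ t₀ ∈ Icc s r, ∀ t ∈ Ioc t₀ r,
      Finsler.IsEnvelope F (ρ ⁻¹' Iio t₀) (ρ ⁻¹' {t₀}) (t - t₀) (ρ ⁻¹' {t})) ∧
    -- the fronts have tangent hyperplanes
    (∀ t ∈ Icc s r, ∀ p ∈ ρ ⁻¹' {t}, ∃ H : Submodule ℝ (TangentSpace (𝓡 n) p),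
      Finsler.HasTangentHyperplane (ρ ⁻¹' {t}) p H) ∧
    -- wave rays exist, are geodesics, and are orthogonal to every front they meet
    (∀ t ∈ Ioc s r, ∀ q ∈ ρ ⁻¹' {t},
      (∃ γ : ℝ → M, Finsler.IsShortest F (ρ ⁻¹' {s}) q γ (t - s)) ∧
      ∀ (γ : ℝ → M) (ℓ : ℝ), Finsler.IsShortest F (ρ ⁻¹' {s}) q γ ℓ →
        ℓ = t - s ∧ Finsler.IsGeodesic F γ ℓ ∧
        ∀ u ∈ Icc 0 ℓ, Finsler.IsOrthogonalTo F (Finsler.velocityWithin γ (Icc 0 ℓ) u)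
          (ρ ⁻¹' {s + u})) := by
  obtain rfl : ρ = Finsler.fdistFrom F A := funext hρ
  have hmin' : Finsler.HasShortestCurves F := hmin
  -- The value `s > 0` is attained by `ρ`, which would vanish identically for empty `A`.
  have hne : A.Nonempty := by
    obtain ⟨p, -, hp⟩ := hU.symm ▸ left_mem_Icc.2 hsr.le
    exact Finsler.nonempty_of_fdistFrom_pos (hp.symm ▸ hs)
  refine ⟨fun t ht => Finsler.wavefront_level hF hmin' hA hne hs.le ht.1,
    fun t₀ ht₀ t ht => ⟨Finsler.level_eq_envelope_points hF hmin' hA hne (hs.le.trans ht₀.1)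
      ht.1.le, ?_⟩, ?_, fun t ht q hq => ⟨?_, ?_⟩⟩
  · rintro p rfl q hq hqp
    rw [Finsler.wavefront_singleton] at hqp ⊢
    rw [mem_preimage, mem_singleton_iff] at hq hqp
    have hd : Finsler.fdist F q p = Finsler.fdistFrom F A p - t₀ := by
      rw [← hqp, Finsler.fdistFrom_singleton]
    rw [← hqp]
    -- The source `q` lies between `A` and `p`, and the levels from `ρ q = t₀` to `ρ p = t` stay in
    -- the range free of cut points.
    refine Finsler.areTangentAt_levels hF hmin' hA hne ?_ ?_ (fun z hz => hcut z ?_) ?_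
    · rw [hd]
      exact sub_pos.2 ht.1
    · rw [hq, hd, add_sub_cancel]
    · rw [hq] at hz
      exact ⟨ht₀.1.trans hz.1, hz.2.trans ht.2⟩
    · rw [hq]
      exact hs.trans_le ht₀.1
  · rintro t ht p rfl
    exact Finsler.exists_hasTangentHyperplane hF hmin' hA hne (hcut p ht) (hs.trans_le ht.1)
  · rw [mem_preimage, mem_singleton_iff] at hq
    have hsq : s ≤ Finsler.fdistFrom F A q := hq ▸ ht.1.le
    obtain ⟨γ, h, h0, hℓ⟩ := Finsler.exists_unitCurve_from_level hF hmin' hA hne hs.le hsq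
    have h1 := h.isShortest h0 hℓ (Finsler.fdistFrom_level hF hmin' hA hne hs.le hsq).symm
    rw [hq] at h1
    exact ⟨γ, h1⟩
  · intro γ ℓ h
    rw [mem_preimage, mem_singleton_iff] at hq
    have hℓ : ℓ = t - s := by
      rw [h.length_eq_fdistFrom, Finsler.fdistFrom_level hF hmin' hA hne hs.le (hq ▸ ht.1.le), hq]
    have h0 : Finsler.fdistFrom F A (γ 0) = s := h.source
    -- A ray from the level `s` to the level `t` has length `t - s`, so `ρ` increases by its whole
    -- length, hence at unit speed.
    have hgrow : Finsler.fdistFrom F A (γ ℓ) = Finsler.fdistFrom F A (γ 0) + ℓ := by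
      rw [h.target, h0, hq, hℓ, add_sub_cancel]
    have hu : ∀ u ∈ Icc 0 ℓ, Finsler.fdistFrom F A (γ u) = s + u := fun u hu => by
      rw [h.isUnitCurve.fdistFrom_eq hF hmin' hne hgrow hu, h0]
    have hcut' : ∀ u ∈ Icc 0 ℓ, γ u ∉ Finsler.cutLocus F A := fun u h' => hcut _ (by
      rw [mem_preimage, hu u h']
      exact ⟨by linarith [h'.1], by linarith [h'.2, ht.2]⟩)
    obtain ⟨hgeo, hort⟩ := h.isUnitCurve.isGeodesic_and_isOrthogonalTo hF hmin' hA hne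
      (by rw [hℓ]; exact sub_pos.2 ht.1) hgrow hcut'
      (fun u h' => by rw [hu u h']; linarith [h'.1])
    refine ⟨hℓ, hgeo, fun u h' => ?_⟩
    have h2 := hort u h'
    rwa [hu u h'] at h2
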